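/- **Setting.** Let $d,k\ge 1$ be integers, $T>0$, $\mathbb T^d=\mathbb R^d/\mathbb Z^d$, $Q=\mathbb T^d\times[0,T]$, and $p>d+2$. Let $\mathcal D_1$ be the set of $m\in L^\infty(\mathbb T^d)$ with $m\ge 0$ a.e. and $\int_{\mathbb T^d} m\,dx=1$. The data are $m_0\in\mathcal D_1$, $g:\mathbb T^d\to\mathbb R$, $L:Q\times\mathbb R^d\to\mathbb R$, $f:Q\times\mathcal D_1\to\mathbb R$, $\phi:[0,T]\times\mathbb R^k\to\mathbb R^k$, $a:Q\to\mathbb R^{k\times d}$, $F:[0,T]\times\mathcal D_1\to\mathbb R$ and $\Phi:[0,T]\times\mathbb R^k\to\mathbb R$. Assume that there are constants $C_0,\varepsilon_0>0$ such that the following hold for all $(x,t)\in Q$, $y\in\mathbb T^d$, $v,v'\in\mathbb R^d$, $z,z'\in\mathbb R^k$, $m,m_1,m_2\in\mathcal D_1$. 1. $L$ is differentiable in $v$, $L_v$ is differentiable in $x$ and in $v$, $a$ is differentiable in $x$, and $\langle L_v(x,t,v)-L_v(x,t,v'),v-v'\rangle\ge \frac1{C_0}|v-v'|^2$, $\;L(x,t,v)\le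 C_0|v|^2+C_0$, $\;|L(x,t,v)-L(y,t,v)|\le C_0|x-y|(1+|v|^2)$. 2. $|\phi(t,z)|\le C_0$, $\;|\phi(t,z)-\phi(t,z')|\le C_0|z-z'|$, $\;|f(x,t,m)|\le C_0$. 3. For every $R>0$ there is $\alpha_0\in(0,1)$ such that $L,L_v,L_{vx},L_{vv}$ are $\alpha_0$-Hölder on $Q\times\{|v|\le R\}$ and $\phi$ is $\alpha_0$-Hölder on $[0,T]\times\{|z|\le R\}$; for some $\alpha_0\in(0,1)$, $a$ and $D_xa$ are $\alpha_0$-Hölder on $Q$. 4. For some $\alpha_0\in(0,1)$, $|f(x_2,t_2,m_2)-f(x_1,t_1,m_1)|\le C_0(|x_2-x_1|+|t_2-t_1|^{\alpha_0}+\|m_2-m_1\|_{L^2(\mathbb T^d)})$ for all $(x_1,t_1),(x_2,t_2)\in Q$. 5. $m_0\ge\varepsilon_0$, and $m_0,g\in\mathcal C^{2+\alpha_0}(\mathbb T^d)$ for some $\alpha_0\in(0,1)$. 6. $f$ is monotone, $\int_{\mathbb T^d}(f(x,t,m_2)-f(x,t,m_1))(m_2-m_1)\,dx\ge0$, and $F$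 is a primitive of $f$: $F(t,m_2)-F(t,m_1)=\int_0^1\int_{\mathbb T^d}f(x,t,sm_2+(1-s)m_1)(m_2(x)-m_1(x))\,dx\,ds$. 7. $\Phi$ is measurable, convex in $z$, and $\nabla_z\Phi=\phi$. 8. $F(\cdot,m)$ and $\Phi(\cdot,z)$ are integrable on $[0,T]$. Set $H(x,t,q)=\sup_{v\in\mathbb R^d}\{-\langle q,v\rangle-L(x,t,v)\}$, $A[w](t)=\int_{\mathbb T^d}a(x,t)w(x,t)\,dx$, and $A^\star[P](x,t)=a(x,t)^{\top}P(t)$. A *solution of the MFG system* is a tuple $(\bar m,\bar v,\bar u,\bar\gamma,\bar P)$ such that, for some $\alpha\in(0,1)$, $\bar m,\bar u\in\mathcal C^{2+\alpha,1+\alpha/2}(Q)$ (continuous, with $\partial_t$, $\nabla$, $D^2_{xx}$ existing and $\alpha$-Hölder on $Q$), $\bar v\in\mathcal C^{1+\alpha,\alpha}(Q;\mathbb R^d)$ ($\bar v$ and $D_x\bar v$ are $\alpha$-Hölder on $Q$), $\bar\gamma\in\mathcal C^\alpha(Q)$, $\bar P\in\mathcal C^\alpha(0,T;\mathbb R^k)$,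 and, for $x\in\mathbb T^d$ and $t\in[0,T]$, $$\begin{aligned} &-\partial_t\bar u-\Delta\bar u+H(x,t,\nabla\bar u+A^\star\bar P)=\bar\gamma,\qquad \bar u(x,T)=g(x),\\ &\bar v=-H_p(x,t,\nabla\bar u+A^\star\bar P),\\ &\partial_t\bar m-\Delta\bar m+\nabla\cdot(\bar v\bar m)=0,\qquad \bar m(x,0)=m_0(x),\\ &\bar\gamma(x,t)=f(x,t,\bar m(\cdot,t)),\qquad \bar P(t)=\phi(t,A[\bar m\bar v](t)), \end{aligned}$$ where $H_p$ is the gradient of $H$ in its last variable. Let $\mathcal R$ be the set of pairs $(m,v)\in W^{2,1,p}(Q)\times W^{1,0,\infty}(Q;\mathbb R^d)$ with $\partial_tm-\Delta m+\nabla\cdot(vm)=0$ in $Q$ and $m(0)=m_0$, where $W^{2,1,p}(Q)=W^{1,p}(Q)\cap L^p(0,T;W^{2,p}(\mathbb T^d))$, $W^{1,0,\infty}(Q)=L^\infty(0,T;W^{1,\infty}(\mathbb T^d))$, and $m$ is identified with its continuous representative. Let $$\mathcal J(m,v)=\int_QL(x,t,v)\,m\,dx\,dt+\int_0^T\big(F(t,m(\cdot,t))+\Phi(t,A[mv](t))\big)dt+\int_{\mathbb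 T^d}g\,m(\cdot,T)\,dx .$$ **Lemma.** There exists a constant $C>0$, depending only on the data, such that for every solution $(\bar m,\bar v,\bar u,\bar\gamma,\bar P)$ of the MFG system and every $(m,v)\in\mathcal R$, all integrals in $\mathcal J(m,v)$ and $\mathcal J(\bar m,\bar v)$ and the integral below are well defined and finite, and $$\mathcal J(m,v)-\mathcal J(\bar m,\bar v)\ \ge\ \frac1C\int_Q|v-\bar v|^2\,m\,dx\,dt .$$ -/

import Mathlib

open MeasureTheory Set
open scoped NNReal ENNReal RealInnerProductSpace

noncomputable section

namespace MFG

/-! ### The torus, partial derivatives, Hölder classes -/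

/-- Euclidean space `ℝⁿ`. -/
abbrev E (n : ℕ) : Type := EuclideanSpace ℝ (Fin n)

/-- The torus `𝕋ᵈ = ℝᵈ/ℤᵈ`, with its Lebesgue (probability) measure `volume`. -/
abbrev Torus (d : ℕ) : Type := UnitAddTorus (Fin d)

/-- The class in `𝕋ᵈ` of a vector of `ℝᵈ`. -/
def Torus.proj {d : ℕ} (y : Fin d → ℝ) : Torus d := fun i => (y i : UnitAddCircle)

/-- The closed cylinder `Q = 𝕋ᵈ × [0,T]`. -/
def cyl (d : ℕ) (T : ℝ) : Set (Torus d × ℝ) := univ ×ˢ Icc 0 T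

/-- Lebesgue measure on `Q`. -/
def cylMeasure (d : ℕ) (T : ℝ) : Measure (Torus d × ℝ) := volume.restrict (cyl d T)

section Derivatives

variable {d : ℕ} {V : Type*} [NormedAddCommGroup V] [NormedSpace ℝ V]

/-- `u` restricted to the line through `x` in the direction of the `i`-th coordinate. -/
def alongCoord (i : Fin d) (u : Torus d → V) (x : Torus d) : ℝ → V :=
  fun s => u (x + Pi.single i (s : UnitAddCircle))

/-- The partial derivative `∂u/∂xᵢ` on the torus. -/
def pderiv (i : Fin d) (u : Torus d → V) (x : Torus d) : V :=
  deriv (alongCoord i u x) 0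

/-- All first partial derivatives of `u` exist everywhere on the torus. -/
def HasPartials (u : Torus d → V) : Prop :=
  ∀ i x, DifferentiableAt ℝ (alongCoord i u x) 0

/-- `∂u/∂xᵢ` for a function of `(x,t)`. -/
def dx (i : Fin d) (u : Torus d × ℝ → V) (z : Torus d × ℝ) : V :=
  pderiv i (fun y => u (y, z.2)) z.1

/-- `∂u/∂t` on `Q` (one-sided at `t = 0` and `t = T`). -/
def dt (T : ℝ) (u : Torus d × ℝ → V) (z : Torus d × ℝ) : V :=
  derivWithin (fun s => u (z.1, s)) (Icc 0 T) z.2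

/-- The spatial gradient of a scalar function of `(x,t)`. -/
def gradx (u : Torus d × ℝ → ℝ) (z : Torus d × ℝ) : E d :=
  WithLp.toLp 2 fun i => dx i u z

/-- The spatial Laplacian. -/
def lapx (u : Torus d × ℝ → ℝ) (z : Torus d × ℝ) : ℝ := ∑ i, dx i (dx i u) z

/-- The spatial divergence. -/
def divx (w : Torus d × ℝ → E d) (z : Torus d × ℝ) : ℝ := ∑ i, dx i (fun y => w y i) z

/-- `u` is continuously differentiable on the torus, i.e. its periodic lift to `ℝᵈ` is `C¹`. -/
def IsC1 (u : Torus d → ℝ) : Prop :=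
  ContDiff ℝ 1 fun y : Fin d → ℝ => u (Torus.proj y)

/-- `u` is continuously differentiable on `𝕋ᵈ × ℝ`. -/
def IsC1SpaceTime (u : Torus d × ℝ → ℝ) : Prop :=
  ContDiff ℝ 1 fun y : (Fin d → ℝ) × ℝ => u (Torus.proj y.1, y.2)

/-- `u` is Hölder continuous with exponent `α` on `S`. -/
def HolderOn {X Y : Type*} [PseudoMetricSpace X] [PseudoMetricSpace Y]
    (α : ℝ≥0) (u : X → Y) (S : Set X) : Prop := ∃ K : ℝ≥0, HolderOnWith K α u S

/-- The class `𝒞^{2+α}(𝕋ᵈ)`. -/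
def MemC2 (α : ℝ≥0) (u : Torus d → ℝ) : Prop :=
  Continuous u ∧ HasPartials u ∧ (∀ i, HasPartials (pderiv i u)) ∧
    (∀ i, HolderOn α (pderiv i u) univ) ∧ ∀ i j, HolderOn α (pderiv j (pderiv i u)) univ

/-- The class `𝒞^{2+α,1+α/2}(Q)`: continuous functions on `Q` whose derivatives `∂ₜu`, `∇u`,
`D²ₓₓu` exist and are Hölder continuous of exponent `α` on `Q`. -/
def MemC21 (T : ℝ) (α : ℝ≥0) (u : Torus d × ℝ → ℝ) : Prop :=
  ContinuousOn u (cyl d T) ∧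
  (∀ x, DifferentiableOn ℝ (fun s => u (x, s)) (Icc 0 T)) ∧
  (∀ t ∈ Icc 0 T, HasPartials (fun x => u (x, t)) ∧
    ∀ i, HasPartials (fun x => dx i u (x, t))) ∧
  HolderOn α (dt T u) (cyl d T) ∧
  (∀ i, HolderOn α (dx i u) (cyl d T)) ∧
  ∀ i j, HolderOn α (dx j (dx i u)) (cyl d T)

/-- The class `𝒞^{1+α,α}(Q;V)`: `α`-Hölder continuous functions on `Q` whose spatial derivatives
exist and are `α`-Hölder continuous on `Q`. -/
def MemC10 (T : ℝ) (α : ℝ≥0) (v : Torus d × ℝ → V) : Prop :=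
  HolderOn α v (cyl d T) ∧ (∀ t ∈ Icc 0 T, HasPartials (fun x => v (x, t))) ∧
    ∀ i, HolderOn α (dx i v) (cyl d T)

/-! ### Parabolic Sobolev spaces -/

/-- `g ∈ L^q(Q;V)` is the weak derivative `∂u/∂xᵢ`: for almost every `t`, the function `g(·,t)` is
the weak `i`-th partial derivative of `u(·,t)` on `𝕋ᵈ`. -/
def HasWeakDx (q : ℝ≥0∞) (T : ℝ) (i : Fin d) (u g : Torus d × ℝ → V) : Prop :=
  MemLp g q (cylMeasure d T) ∧
    ∀ᵐ t ∂(volume.restrict (Icc 0 T) : Measure ℝ), ∀ ψ : Torus d → ℝ, IsC1 ψ →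
      ∫ x, pderiv i ψ x • u (x, t) = -∫ x, ψ x • g (x, t)

/-- `g ∈ L^q(Q;V)` is the weak derivative `∂u/∂t` in `𝕋ᵈ × (0,T)`. -/
def HasWeakDt (q : ℝ≥0∞) (T : ℝ) (u g : Torus d × ℝ → V) : Prop :=
  MemLp g q (cylMeasure d T) ∧
    ∀ ψ : Torus d × ℝ → ℝ, IsC1SpaceTime ψ → tsupport ψ ⊆ univ ×ˢ Ioo 0 T →
      ∫ z, deriv (fun s => ψ (z.1, s)) z.2 • u z ∂cylMeasure d T
        = -∫ z, ψ z • g z ∂cylMeasure d T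

/-- The space `W^{1,0,q}(Q;V) = L^q(0,T;W^{1,q}(𝕋ᵈ;V))`. -/
def MemW10 (q : ℝ≥0∞) (T : ℝ) (u : Torus d × ℝ → V) : Prop :=
  MemLp u q (cylMeasure d T) ∧ ∀ i, ∃ g, HasWeakDx q T i u g

/-- The space `W^{2,1,q}(Q) = W^{1,q}(Q) ∩ L^q(0,T;W^{2,q}(𝕋ᵈ))`. -/
def MemW21 (q : ℝ≥0∞) (T : ℝ) (u : Torus d × ℝ → ℝ) : Prop :=
  MemLp u q (cylMeasure d T) ∧ (∃ g, HasWeakDt q T u g) ∧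
    ∀ i, ∃ g, HasWeakDx q T i u g ∧ ∀ j, ∃ h, HasWeakDx q T j g h

/-- The equation `∂ₜm - Δm + ∇·(vm) = 0` in `L^q(Q)`, all derivatives being weak ones. -/
def FokkerPlanck (q : ℝ≥0∞) (T : ℝ) (m : Torus d × ℝ → ℝ) (v : Torus d × ℝ → E d) : Prop :=
  ∃ (mt : Torus d × ℝ → ℝ) (mx mxx : Fin d → Torus d × ℝ → ℝ) (wx : Fin d → Torus d × ℝ → E d),
    HasWeakDt q T m mt ∧
    (∀ i, HasWeakDx q T i m (mx i) ∧ HasWeakDx q T i (mx i) (mxx i) ∧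
      HasWeakDx q T i (fun z => m z • v z) (wx i)) ∧
    ∀ᵐ z ∂cylMeasure d T, mt z - ∑ i, mxx i z + ∑ i, wx i z i = 0

end Derivatives

/-! ### Data of the mean field game -/

/-- `𝒟₁(𝕋ᵈ)`: essentially bounded probability densities on the torus. -/
def D1 (d : ℕ) : Set (Torus d → ℝ) :=
  {m | MemLp m ∞ volume ∧ (∀ᵐ x, 0 ≤ m x) ∧ ∫ x, m x = 1}

/-- The data of the problem: horizon, initial density, terminal cost, running cost, congestion
cost, price, aggregation kernel, and the potentials `F` of `f` and `Φ` of `φ`. Functions of time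
are only used for times in `[0,T]`, and `f`, `F` only for densities in `𝒟₁(𝕋ᵈ)`. -/
structure Data (d k : ℕ) where
  T : ℝ
  m₀ : Torus d → ℝ
  g : Torus d → ℝ
  L : Torus d × ℝ → E d → ℝ
  f : Torus d × ℝ → (Torus d → ℝ) → ℝ
  φ : ℝ → E k → E k
  a : Torus d × ℝ → (E d →L[ℝ] E k)
  F : ℝ → (Torus d → ℝ) → ℝ
  Φ : ℝ → E k → ℝ

namespace Data

variable {d k : ℕ} (D : Data d k)

/-- The derivative `L_v` of the running cost. -/
def Lv (z : Torus d × ℝ) (v : E d) : E d := gradient (D.L z) v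

/-- The Hamiltonian `H(x,t,p) = sup_v (-⟨p,v⟩ - L(x,t,v))`. -/
def H (z : Torus d × ℝ) (p : E d) : ℝ := ⨆ v : E d, (-⟪p, v⟫ - D.L z v)

/-- The derivative `H_p` of the Hamiltonian. -/
def Hp (z : Torus d × ℝ) (p : E d) : E d := gradient (D.H z) p

/-- `A[w](t) = ∫ a(x,t) w(x,t) dx`. -/
def A (w : Torus d × ℝ → E d) (t : ℝ) : E k := ∫ x, D.a (x, t) (w (x, t))

/-- `A⋆[P](x,t) = a⋆(x,t) P(t)`. -/
def Astar (P : ℝ → E k) (z : Torus d × ℝ) : E d :=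
  ContinuousLinearMap.adjoint (D.a z) (P z.2)

/-- The set `Q × B_R`, with `B_R` the ball of radius `R` of `ℝᵈ`. -/
def ball (R : ℝ) : Set ((Torus d × ℝ) × E d) := cyl d D.T ×ˢ Metric.closedBall 0 R

/-- The standing assumptions on the data. -/
structure Assumptions : Prop where
  T_pos : 0 < D.T
  m₀_mem : D.m₀ ∈ D1 d
  L_diff : ∀ z ∈ cyl d D.T, Differentiable ℝ (D.L z)
  Lv_diff_v : ∀ z ∈ cyl d D.T, Differentiable ℝ (D.Lv z)
  Lv_diff_x : ∀ t ∈ Icc 0 D.T, ∀ v, HasPartials fun x => D.Lv (x, t) v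
  a_diff_x : ∀ t ∈ Icc 0 D.T, HasPartials fun x => D.a (x, t)
  /-- strong convexity of `L` -/
  L_strong : ∃ C₀ > 0, ∀ z ∈ cyl d D.T, ∀ v v' : E d,
    1 / C₀ * ‖v - v'‖ ^ 2 ≤ ⟪D.Lv z v - D.Lv z v', v - v'⟫
  L_growth : ∃ C₀ > 0, ∀ z ∈ cyl d D.T, ∀ v, D.L z v ≤ C₀ * ‖v‖ ^ 2 + C₀
  L_lip : ∃ C₀ > 0, ∀ t ∈ Icc 0 D.T, ∀ x y v,
    |D.L (x, t) v - D.L (y, t) v| ≤ C₀ * dist x y * (1 + ‖v‖ ^ 2)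
  φ_bdd : ∃ C₀ > 0, ∀ t ∈ Icc 0 D.T, ∀ z, ‖D.φ t z‖ ≤ C₀
  f_bdd : ∃ C₀ > 0, ∀ z ∈ cyl d D.T, ∀ m ∈ D1 d, |D.f z m| ≤ C₀
  /-- local Hölder regularity of `L`, its derivatives `L_v`, `L_vx`, `L_vv`, and `φ` -/
  holder_loc : ∀ R > 0, ∃ α₀ : ℝ≥0, 0 < α₀ ∧ α₀ < 1 ∧
    HolderOn α₀ (fun q : (Torus d × ℝ) × E d => D.L q.1 q.2) (D.ball R) ∧
    HolderOn α₀ (fun q : (Torus d × ℝ) × E d => D.Lv q.1 q.2) (D.ball R) ∧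
    (∀ i, HolderOn α₀
      (fun q : (Torus d × ℝ) × E d => dx i (fun z => D.Lv z q.2) q.1) (D.ball R)) ∧
    HolderOn α₀ (fun q : (Torus d × ℝ) × E d => fderiv ℝ (D.Lv q.1) q.2) (D.ball R) ∧
    HolderOn α₀ (fun q : ℝ × E k => D.φ q.1 q.2) (Icc 0 D.T ×ˢ Metric.closedBall 0 R)
  a_holder : ∃ α₀ : ℝ≥0, 0 < α₀ ∧ α₀ < 1 ∧ HolderOn α₀ D.a (cyl d D.T) ∧
    ∀ i, HolderOn α₀ (dx i D.a) (cyl d D.T)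
  f_holder : ∃ α₀ : ℝ, 0 < α₀ ∧ α₀ < 1 ∧ ∃ C₀ > 0,
    ∀ x₁ x₂ : Torus d, ∀ t₁ ∈ Icc 0 D.T, ∀ t₂ ∈ Icc 0 D.T, ∀ m₁ ∈ D1 d, ∀ m₂ ∈ D1 d,
      |D.f (x₂, t₂) m₂ - D.f (x₁, t₁) m₁| ≤
        C₀ * (dist x₂ x₁ + |t₂ - t₁| ^ α₀ + (eLpNorm (m₂ - m₁) 2 volume).toReal)
  φ_lip : ∃ C₀ > 0, ∀ t ∈ Icc 0 D.T, ∀ z₁ z₂, ‖D.φ t z₂ - D.φ t z₁‖ ≤ C₀ * ‖z₂ - z₁‖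
  m₀_pos : ∃ ε₀ > 0, ∀ x, ε₀ ≤ D.m₀ x
  boundary_reg : ∃ α₀ : ℝ≥0, 0 < α₀ ∧ α₀ < 1 ∧ MemC2 α₀ D.m₀ ∧ MemC2 α₀ D.g
  /-- `f` is monotone -/
  f_mono : ∀ t ∈ Icc 0 D.T, ∀ m₁ ∈ D1 d, ∀ m₂ ∈ D1 d,
    0 ≤ ∫ x, (D.f (x, t) m₂ - D.f (x, t) m₁) * (m₂ x - m₁ x)
  /-- `F` is a primitive of `f` -/
  F_primitive : ∀ t ∈ Icc 0 D.T, ∀ m₁ ∈ D1 d, ∀ m₂ ∈ D1 d,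
    D.F t m₂ - D.F t m₁ =
      ∫ s in (0 : ℝ)..1, ∫ x, D.f (x, t) (s • m₂ + (1 - s) • m₁) * (m₂ x - m₁ x)
  F_int : ∀ m ∈ D1 d, IntegrableOn (fun t => D.F t m) (Icc 0 D.T)
  /-- `Φ` is a measurable convex potential of `φ` -/
  Φ_meas : Measurable fun q : Icc 0 D.T × E k => D.Φ q.1 q.2
  Φ_convex : ∀ t ∈ Icc 0 D.T, ConvexOn ℝ univ (D.Φ t)
  Φ_grad : ∀ t ∈ Icc 0 D.T, ∀ z, HasGradientAt (D.Φ t) (D.φ t z) z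
  Φ_int : ∀ z, IntegrableOn (fun t => D.Φ t z) (Icc 0 D.T)

/-- `(m,v,u,γ,P)` is a classical solution of the mean field game system. -/
structure IsSolution (m : Torus d × ℝ → ℝ) (v : Torus d × ℝ → E d) (u γ : Torus d × ℝ → ℝ)
    (P : ℝ → E k) : Prop where
  regular : ∃ α : ℝ≥0, 0 < α ∧ α < 1 ∧ MemC21 D.T α m ∧ MemC10 D.T α v ∧ MemC21 D.T α u ∧
    HolderOn α γ (cyl d D.T) ∧ HolderOn α P (Icc 0 D.T)
  hjb : ∀ z ∈ cyl d D.T,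
    -dt D.T u z - lapx u z + D.H z (gradx u z + D.Astar P z) = γ z
  hjb_final : ∀ x, u (x, D.T) = D.g x
  control : ∀ z ∈ cyl d D.T, v z = -D.Hp z (gradx u z + D.Astar P z)
  fp : ∀ z ∈ cyl d D.T, dt D.T m z - lapx m z + divx (fun y => m y • v y) z = 0
  fp_init : ∀ x, m (x, 0) = D.m₀ x
  congestion : ∀ x, ∀ t ∈ Icc 0 D.T, γ (x, t) = D.f (x, t) fun y => m (y, t)
  price : ∀ t ∈ Icc 0 D.T, P t = D.φ t (D.A (fun y => m y • v y) t)

/-- The feasible set `ℛ`: pairs `(m,v) ∈ W^{2,1,p}(Q) × W^{1,0,∞}(Q;ℝᵈ)` solving the Fokker-Planck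
equation with initial condition `m₀`. Since `p > d + 2`, elements of `W^{2,1,p}(Q)` are identified
with their continuous representatives, which give a meaning to `m(0)` and `m(T)`. -/
def feasible (p : ℝ) : Set ((Torus d × ℝ → ℝ) × (Torus d × ℝ → E d)) :=
  {mv | ContinuousOn mv.1 (cyl d D.T) ∧ MemW21 (ENNReal.ofReal p) D.T mv.1 ∧
    MemW10 ∞ D.T mv.2 ∧ FokkerPlanck (ENNReal.ofReal p) D.T mv.1 mv.2 ∧
    ∀ x, mv.1 (x, 0) = D.m₀ x}

/-- The potential cost `𝒥(m,v)`. -/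
def J (m : Torus d × ℝ → ℝ) (v : Torus d × ℝ → E d) : ℝ :=
  (∫ z, D.L z (v z) * m z ∂cylMeasure d D.T) +
  (∫ t in Icc 0 D.T, (D.F t (fun x => m (x, t)) + D.Φ t (D.A (fun z => m z • v z) t))) +
  ∫ x, D.g x * m (x, D.T)

/-- The integrals in the definition of `𝒥(m,v)` exist. -/
def JFinite (m : Torus d × ℝ → ℝ) (v : Torus d × ℝ → E d) : Prop :=
  Integrable (fun z => D.L z (v z) * m z) (cylMeasure d D.T) ∧
  IntegrableOn (fun t => D.F t (fun x => m (x, t))) (Icc 0 D.T) ∧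
  IntegrableOn (fun t => D.Φ t (D.A (fun z => m z • v z) t)) (Icc 0 D.T) ∧
  Integrable (fun x => D.g x * m (x, D.T)) volume

end Data

end MFG

end

noncomputable section

namespace MFG

open Filter
open scoped Topology ContDiff

/-! ### Calculus on the torus -/

/-! The potential cost is convex in the pair (m, mv), the Fokker-Planck equation is linear in that
pair, and the MFG system is its first-order optimality condition; strong convexity of `L` supplies
the quadratic gain. Put q = ∇ū + A⋆P̄ and let c be the strong monotonicity constant of `L_v`. Since
v̄ = -H_p(q), one has L_v(v̄) = -q and H(q) = -⟨q,v̄⟩ - L(v̄). The tangent inequality for `L` at v̄,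
multiplied by m ≥ 0, gives L(v)m - L(v̄)m̄ ≥ -H(q)(m - m̄) - ⟨q, mv - m̄v̄⟩ + (c/2)|v - v̄|²m
(`Assumptions.cost_sub_ge`). After integration over Q, the Hamilton-Jacobi equation replaces H(q) by
γ̄ + ∂ₜū + Δū. Testing both Fokker-Planck equations with ū turns the terms in ū into -∫g(m - m̄)(T),
because the initial densities agree. What remains is ∫γ̄(m - m̄) and ∫⟨P̄, A[mv] - A[m̄v̄]⟩, which
are bounded by the increments of F and Φ, by monotonicity of f (`Assumptions.F_sub_ge`) and
convexity of Φ (`Assumptions.Φ_sub_ge`).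

The analytic work lies in justifying m ≥ 0 and the test with ū for a competitor whose velocity is
only bounded. Classical and Sobolev solutions are both reduced to `IsWeakFP`: a continuous density m
and a measurable flux b with |b| ≤ M|m|, satisfying the equation in integrated form in time against
smooth functions of x (`exists_isAdmissible_of_classical`, `exists_isAdmissible_of_fokkerPlanck`).
Mollification in x makes such a solution smooth in x and Lipschitz in t. Then `IsWeakFP.nonneg`
follows from an energy estimate for the negative part together with Grönwall's inequality, and
`IsWeakFP.dual` from the product rule and integration by parts; in both the mollification is removed
at the end. The Legendre transform is shown to be differentiable (`hasGradientAt_legendre`), so that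
H_p, defined through `gradient`, is a genuine derivative. -/

instance isProbabilityMeasure_unitAddCircle :
    IsProbabilityMeasure (volume : Measure UnitAddCircle) :=
  ⟨by simp⟩

section Torus

variable {d : ℕ}

instance isProbabilityMeasure_torus : IsProbabilityMeasure (volume : Measure (Torus d)) := by
  unfold Torus UnitAddTorus
  infer_instance

instance isNegInvariant_torus : (volume : Measure (Torus d)).IsNegInvariant :=
  Measure.IsAddHaarMeasure.isNegInvariant_of_regular _

/-- A continuous function on the torus is integrable. -/
theorem integrable_of_continuous {V : Type*} [NormedAddCommGroup V] {f : Torus d → V}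
    (hf : Continuous f) : Integrable f := by
  rw [← integrableOn_univ]
  exact hf.continuousOn.integrableOn_compact isCompact_univ

/-- A continuous function on the torus is bounded. -/
theorem exists_norm_le_of_continuous {V : Type*} [NormedAddCommGroup V] {f : Torus d → V}
    (hf : Continuous f) : ∃ C, 0 ≤ C ∧ ∀ x, ‖f x‖ ≤ C := by
  obtain ⟨C, hC⟩ := isCompact_univ.exists_bound_of_continuousOn hf.continuousOn
  exact ⟨max C 0, le_max_right _ _, fun x => (hC x (mem_univ x)).trans (le_max_left _ _)⟩

/-- The partial derivative in the `i`-th direction exists everywhere. -/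
def HasPartial {V : Type*} [NormedAddCommGroup V] [NormedSpace ℝ V] (i : Fin d)
    (u : Torus d → V) : Prop :=
  ∀ x, DifferentiableAt ℝ (alongCoord i u x) 0

/-- The unit vector `s eᵢ` on the torus. -/
def shift (i : Fin d) (s : ℝ) : Torus d := Pi.single i (s : UnitAddCircle)

theorem shift_add (i : Fin d) (s r : ℝ) : shift i (s + r) = shift i s + shift i r := by
  simp only [shift, ← Pi.single_add]
  norm_cast

theorem shift_zero (i : Fin d) : shift i 0 = 0 := by
  simp [shift]

theorem shift_neg (i : Fin d) (s : ℝ) : shift i (-s) = -shift i s := by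
  rw [eq_neg_iff_add_eq_zero, ← shift_add, neg_add_cancel, shift_zero]

theorem alongCoord_eq {V : Type*} (i : Fin d) (u : Torus d → V) (x : Torus d) (s : ℝ) :
    alongCoord i u x s = u (x + shift i s) := rfl

/-- `HasPartial` only speaks of the parameter 0, but at every base point; recentring the line at `x
+ shift i s` reaches every other parameter. -/
theorem HasPartial.hasDerivAt {V : Type*} [NormedAddCommGroup V] [NormedSpace ℝ V] {i : Fin d}
    {u : Torus d → V} (h : HasPartial i u) (x : Torus d) (s : ℝ) :
    HasDerivAt (fun r => u (x + shift i r)) (pderiv i u (x + shift i s)) s := by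
  have h1 : HasDerivAt (alongCoord i u (x + shift i s)) (pderiv i u (x + shift i s)) (s - s) := by
    rw [sub_self]
    exact (h _).hasDerivAt
  refine (h1.comp_sub_const s s).congr_of_eventuallyEq (Eventually.of_forall fun r => ?_)
  simp only [alongCoord_eq, add_assoc, ← shift_add]
  congr 3
  ring

theorem HasPartial.of_hasDerivAt {V : Type*} [NormedAddCommGroup V] [NormedSpace ℝ V] {i : Fin d}
    {u u' : Torus d → V} (h : ∀ x, HasDerivAt (fun r => u (x + shift i r)) (u' x) 0) :
    HasPartial i u ∧ pderiv i u = u' :=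
  ⟨fun x => (h x).differentiableAt, funext fun x => (h x).deriv⟩

theorem HasPartial.hasDerivAt_zero {V : Type*} [NormedAddCommGroup V] [NormedSpace ℝ V]
    {i : Fin d} {u : Torus d → V} (h : HasPartial i u) (x : Torus d) :
    HasDerivAt (fun r => u (x + shift i r)) (pderiv i u x) 0 := (h x).hasDerivAt

theorem pderiv_const {V : Type*} [NormedAddCommGroup V] [NormedSpace ℝ V] (i : Fin d) (c : V) :
    pderiv i (fun _ : Torus d => c) = fun _ => 0 :=
  funext fun _ => deriv_const (0 : ℝ) c

theorem pderiv_neg {V : Type*} [NormedAddCommGroup V] [NormedSpace ℝ V] (i : Fin d)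
    (u : Torus d → V) : pderiv i (fun x => -u x) = fun x => -pderiv i u x :=
  funext fun x => deriv.fun_neg (f := alongCoord i u x) (x := (0 : ℝ))

theorem HasPartial.mul {i : Fin d} {f g : Torus d → ℝ} (hf : HasPartial i f)
    (hg : HasPartial i g) :
    HasPartial i (fun x => f x * g x) ∧
      pderiv i (fun x => f x * g x) = fun x => pderiv i f x * g x + f x * pderiv i g x := by
  refine HasPartial.of_hasDerivAt fun x => ?_
  have h := (hf.hasDerivAt_zero x).mul (hg.hasDerivAt_zero x)
  simp only [shift_zero, add_zero] at h
  exact h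

theorem HasPartial.sub {i : Fin d} {f g : Torus d → ℝ} (hf : HasPartial i f)
    (hg : HasPartial i g) :
    HasPartial i (fun x => f x - g x) ∧
      pderiv i (fun x => f x - g x) = fun x => pderiv i f x - pderiv i g x :=
  HasPartial.of_hasDerivAt fun x => (hf.hasDerivAt_zero x).sub (hg.hasDerivAt_zero x)

theorem HasPartial.comp {i : Fin d} {f : Torus d → ℝ} (hf : HasPartial i f) {β β' : ℝ → ℝ}
    (hβ : ∀ s, HasDerivAt β (β' s) s) :
    HasPartial i (fun x => β (f x)) ∧
      pderiv i (fun x => β (f x)) = fun x => β' (f x) * pderiv i f x := by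
  refine HasPartial.of_hasDerivAt fun x => ?_
  have h := hf.hasDerivAt_zero x
  have h2 := hβ (f (x + shift i 0))
  rw [shift_zero, add_zero] at h2
  exact HasDerivAt.comp (h₂ := β) (0 : ℝ) (by simpa [shift_zero] using h2) h

/-- By translation invariance the integral of the translate of `f` by `s eᵢ` does not depend on `s`;
differentiating under the integral at `s = 0` gives the claim. -/
theorem integral_pderiv_eq_zero {i : Fin d} {f : Torus d → ℝ} (hf : HasPartial i f)
    (hc : Continuous f) (hc' : Continuous (pderiv i f)) : ∫ x, pderiv i f x = 0 := by
  obtain ⟨C, -, hC⟩ := exists_norm_le_of_continuous hc'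
  have key := hasDerivAt_integral_of_dominated_loc_of_deriv_le (μ := (volume : Measure (Torus d)))
    (F := fun s x => f (x + shift i s)) (F' := fun s x => pderiv i f (x + shift i s))
    (x₀ := (0 : ℝ)) (s := univ) (bound := fun _ => C) univ_mem
    (Eventually.of_forall fun s => (hc.comp (by fun_prop)).aestronglyMeasurable)
    (integrable_of_continuous (hc.comp (by fun_prop)))
    (hc'.comp (by fun_prop)).aestronglyMeasurable
    (Eventually.of_forall fun x s _ => hC _) (integrable_const _)
    (Eventually.of_forall fun x s _ => hf.hasDerivAt x s)
  have h2 : HasDerivAt (fun s : ℝ => ∫ x, f (x + shift i s)) 0 0 := by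
    simp_rw [integral_add_right_eq_self]
    exact hasDerivAt_const _ _
  have := key.2.unique h2
  simpa [shift_zero] using this

/-- Integration by parts on the torus. -/
theorem integral_mul_pderiv {i : Fin d} {f g : Torus d → ℝ} (hf : HasPartial i f)
    (hg : HasPartial i g) (hfc : Continuous f) (hgc : Continuous g)
    (hfc' : Continuous (pderiv i f)) (hgc' : Continuous (pderiv i g)) :
    ∫ x, f x * pderiv i g x = -∫ x, pderiv i f x * g x := by
  obtain ⟨h1, h2⟩ := hf.mul hg
  have h3 := integral_pderiv_eq_zero h1 (hfc.mul hgc) (h2 ▸ (hfc'.mul hgc).add (hfc.mul hgc'))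
  rw [h2] at h3
  have h4 := integral_add (integrable_of_continuous (hfc'.mul hgc))
    (integrable_of_continuous (hfc.mul hgc'))
  simp only [Pi.mul_apply] at h4
  linarith

/-! ### Smooth functions on the torus -/

/-- `ψ` has a smooth periodic lift. -/
def IsSmooth (ψ : Torus d → ℝ) : Prop := ContDiff ℝ ∞ fun y : Fin d → ℝ => ψ (Torus.proj y)

/-- This lets continuity descend from periodic lifts and provides a lift of each point of the torus.
-/
theorem isOpenQuotientMap_proj : IsOpenQuotientMap (Torus.proj : (Fin d → ℝ) → Torus d) :=
  IsOpenQuotientMap.piMap fun _ => QuotientAddGroup.isOpenQuotientMap_mk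

theorem proj_add (y y' : Fin d → ℝ) : Torus.proj (y + y') = Torus.proj y + Torus.proj y' := by
  ext i
  simp [Torus.proj]

theorem proj_single (i : Fin d) (s : ℝ) : Torus.proj (s • Pi.single i 1) = shift i s := by
  ext j
  rcases eq_or_ne j i with rfl | h
  · simp [Torus.proj, shift]
  · simp [Torus.proj, shift, h]

theorem IsSmooth.continuous {ψ : Torus d → ℝ} (h : IsSmooth ψ) : Continuous ψ :=
  isOpenQuotientMap_proj.isQuotientMap.continuous_iff.2 (ContDiff.continuous h)

theorem IsSmooth.isC1 {ψ : Torus d → ℝ} (h : IsSmooth ψ) : IsC1 ψ := h.of_le (by simp)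

theorem IsSmooth.hasDerivAt {ψ : Torus d → ℝ} (h : IsSmooth ψ) (i : Fin d) (y : Fin d → ℝ) :
    HasDerivAt (fun r => ψ (Torus.proj y + shift i r))
      (fderiv ℝ (fun y : Fin d → ℝ => ψ (Torus.proj y)) y (Pi.single i 1)) 0 := by
  have h1 : HasFDerivAt (fun y : Fin d → ℝ => ψ (Torus.proj y))
      (fderiv ℝ (fun y : Fin d → ℝ => ψ (Torus.proj y)) y) y :=
    (h.differentiable (by simp) y).hasFDerivAt
  have h2 := h1.hasLineDerivAt (Pi.single i 1)
  refine HasDerivAt.congr_of_eventuallyEq h2 (Eventually.of_forall fun r => ?_)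
  simp only [proj_add, proj_single]

theorem IsSmooth.hasPartial {ψ : Torus d → ℝ} (h : IsSmooth ψ) (i : Fin d) :
    HasPartial i ψ := by
  intro x
  obtain ⟨y, rfl⟩ := isOpenQuotientMap_proj.surjective x
  exact (h.hasDerivAt i y).differentiableAt

theorem IsSmooth.pderiv {ψ : Torus d → ℝ} (h : IsSmooth ψ) (i : Fin d) :
    IsSmooth (pderiv i ψ) := by
  have h1 : (fun y : Fin d → ℝ => MFG.pderiv i ψ (Torus.proj y)) = fun y =>
      fderiv ℝ (fun y : Fin d → ℝ => ψ (Torus.proj y)) y (Pi.single i 1) :=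
    funext fun y => (h.hasDerivAt i y).deriv
  unfold IsSmooth
  rw [h1]
  exact (ContDiff.fderiv_right (m := ∞) h (by simp)).clm_apply contDiff_const

theorem isSmooth_const (c : ℝ) : IsSmooth (fun _ : Torus d => c) := contDiff_const

/-- Translates of reflections of smooth functions are smooth. -/
theorem IsSmooth.comp_const_sub {ψ : Torus d → ℝ} (h : IsSmooth ψ) (x : Torus d) :
    IsSmooth fun y => ψ (x - y) := by
  obtain ⟨z, rfl⟩ := isOpenQuotientMap_proj.surjective x
  have h1 : (fun y : Fin d → ℝ => ψ (Torus.proj z - Torus.proj y)) =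
      fun y => ψ (Torus.proj (z - y)) := by
    funext y
    congr 1
  unfold IsSmooth
  rw [h1]
  exact ContDiff.comp (g := fun y : Fin d → ℝ => ψ (Torus.proj y)) h
    (contDiff_const.sub contDiff_id)

theorem IsSmooth.pderiv_comp_const_sub {ψ : Torus d → ℝ} (h : IsSmooth ψ) (x : Torus d)
    (i : Fin d) :
    MFG.pderiv i (fun y => ψ (x - y)) = fun y => -MFG.pderiv i ψ (x - y) := by
  refine (HasPartial.of_hasDerivAt fun y => ?_).2
  have h1 : HasDerivAt (fun r => ψ (x - y + shift i r)) (MFG.pderiv i ψ (x - y)) (-0) := by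
    rw [neg_zero]
    exact (h.hasPartial i).hasDerivAt_zero (x - y)
  have h2 := HasDerivAt.comp (0 : ℝ) h1 (hasDerivAt_neg (0 : ℝ))
  rw [mul_neg_one] at h2
  refine h2.congr_of_eventuallyEq (Eventually.of_forall fun r => ?_)
  simp only [Function.comp_apply, shift_neg]
  congr 1
  abel

/-- Smooth bumps concentrated near the origin. -/
theorem exists_mollifier (d : ℕ) {ε : ℝ} (hε : 0 < ε) :
    ∃ ρ : Torus d → ℝ, IsSmooth ρ ∧ (∀ x, 0 ≤ ρ x) ∧ ∫ x, ρ x = 1 ∧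
      ∀ x, ρ x ≠ 0 → ‖x‖ < ε := by
  -- The function ∑(1 - cos 2πxᵢ) is smooth, periodic and zero only at the origin, so it replaces
  -- the squared distance and no charts are needed.
  set θ : Torus d → ℝ := fun x => ∑ i, (1 - (fourier 1 (x i)).re) with hθ
  have hθc : Continuous θ := by
    refine continuous_finsetSum _ fun i _ => continuous_const.sub ?_
    exact Complex.continuous_re.comp ((map_continuous (fourier 1)).comp (continuous_apply i))
  have hlift : ∀ y : Fin d → ℝ, θ (Torus.proj y) = ∑ i, (1 - Real.cos (2 * Real.pi * y i)) := by
    intro y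
    refine Finset.sum_congr rfl fun i _ => ?_
    have : (fourier 1 ((y i : ℝ) : UnitAddCircle)) = Complex.exp ((2 * Real.pi * y i : ℝ) * Complex.I) := by
      rw [fourier_coe_apply]
      congr 1
      push_cast
      ring
    rw [Torus.proj, this, Complex.exp_ofReal_mul_I_re]
  have hpos : ∀ x, x ≠ 0 → 0 < θ x := by
    intro x hx
    obtain ⟨y, rfl⟩ := isOpenQuotientMap_proj.surjective x
    rw [hlift]
    obtain ⟨i, hi⟩ : ∃ i, ((y i : ℝ) : UnitAddCircle) ≠ 0 := by
      by_contra! h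
      exact hx (funext h)
    refine Finset.sum_pos' (fun j _ => sub_nonneg.2 (Real.cos_le_one _))
      ⟨i, Finset.mem_univ i, sub_pos.2 (lt_of_le_of_ne (Real.cos_le_one _) fun h => hi ?_)⟩
    obtain ⟨n, hn⟩ := (Real.cos_eq_one_iff _).1 h
    rw [AddCircle.coe_eq_zero_iff]
    refine ⟨n, ?_⟩
    have hpi := Real.pi_pos
    have : 2 * Real.pi * (n - y i) = 0 := by linarith
    have : (n : ℝ) - y i = 0 := by
      rcases mul_eq_zero.1 this with h | h
      · linarith
      · exact h
    simp only [zsmul_eq_mul, mul_one]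
    linarith
  -- Outside the ball of radius ε the minimum of `θ` is attained by compactness and is positive; if
  -- nothing lies outside the ball, any δ will do.
  obtain ⟨δ, hδ, hδ'⟩ : ∃ δ > 0, ∀ x, θ x < δ → ‖x‖ < ε := by
    by_cases hK : ({x : Torus d | ε ≤ ‖x‖}).Nonempty
    · have hKc : IsCompact {x : Torus d | ε ≤ ‖x‖} :=
        (isClosed_le continuous_const continuous_norm).isCompact
      obtain ⟨x₀, hx₀, hmin⟩ := hKc.exists_isMinOn hK hθc.continuousOn
      refine ⟨θ x₀, hpos x₀ ?_, fun x hx => ?_⟩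
      · rintro rfl
        rw [mem_ofPred_eq, norm_zero] at hx₀
        linarith
      · by_contra! h
        exact absurd (hmin h) (not_le.2 hx)
    · refine ⟨1, one_pos, fun x _ => ?_⟩
      by_contra! h
      exact hK ⟨x, h⟩
  -- Equal to 1 at the origin and 0 wherever `θ ≥ δ`; dividing by its integral gives the kernel.
  set b : Torus d → ℝ := fun x => Real.smoothTransition (1 - θ x / δ) with hb
  have hbs : IsSmooth b := by
    unfold IsSmooth
    simp only [hb, hlift]
    refine Real.smoothTransition.contDiff.comp (contDiff_const.sub (ContDiff.div_const ?_ _))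
    refine ContDiff.sum fun i _ => contDiff_const.sub (Real.contDiff_cos.comp ?_)
    exact contDiff_const.mul (contDiff_apply ℝ ℝ i)
  have hb0 : ∀ x, 0 ≤ b x := fun x => Real.smoothTransition.nonneg _
  have hbz : b 0 ≠ 0 := by
    have : θ 0 = 0 := by
      have : (0 : Torus d) = Torus.proj 0 := by
        ext i; simp [Torus.proj]
      rw [this, hlift]
      simp
    simp [hb, this]
  have hI : 0 < ∫ x, b x :=
    hbs.continuous.integral_pos_of_hasCompactSupport_nonneg_nonzero
      (HasCompactSupport.of_compactSpace b) hb0 hbz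
  refine ⟨fun x => (∫ x, b x)⁻¹ * b x, contDiff_const.mul hbs,
    fun x => mul_nonneg (inv_nonneg.2 hI.le) (hb0 x), ?_, fun x hx => hδ' x ?_⟩
  · rw [integral_const_mul, inv_mul_cancel₀ hI.ne']
  · by_contra! h
    refine hx (mul_eq_zero_of_right _ (Real.smoothTransition.zero_of_nonpos ?_))
    have := (one_le_div hδ).2 h
    linarith

/-! ### Mollification -/

/-- The convolution `ρ * w` on the torus. -/
def conv (ρ w : Torus d → ℝ) (x : Torus d) : ℝ := ∫ y, ρ (x - y) * w y

theorem continuous_conv {ρ w : Torus d → ℝ} (hρ : Continuous ρ) (hw : Integrable w) :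
    Continuous (conv ρ w) := by
  obtain ⟨C, -, hC⟩ := exists_norm_le_of_continuous hρ
  refine continuous_of_dominated (bound := fun y => C * ‖w y‖)
    (fun x => (hρ.comp (by fun_prop)).aestronglyMeasurable.mul hw.1)
    (fun x => Eventually.of_forall fun y => ?_) (hw.norm.const_mul C)
    (Eventually.of_forall fun y => (hρ.comp (by fun_prop)).mul continuous_const)
  rw [norm_mul]
  exact mul_le_mul_of_nonneg_right (hC _) (norm_nonneg _)

/-- All derivatives fall on the kernel, so `w` need only be integrable. -/
theorem hasPartial_conv {ρ w : Torus d → ℝ} (hρ : IsSmooth ρ) (hw : Integrable w) (i : Fin d) :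
    HasPartial i (conv ρ w) ∧ pderiv i (conv ρ w) = conv (pderiv i ρ) w := by
  obtain ⟨C, -, hC⟩ := exists_norm_le_of_continuous (hρ.pderiv i).continuous
  obtain ⟨C', -, hC'⟩ := exists_norm_le_of_continuous hρ.continuous
  refine HasPartial.of_hasDerivAt fun x => ?_
  have key := hasDerivAt_integral_of_dominated_loc_of_deriv_le (μ := (volume : Measure (Torus d)))
    (F := fun s y => ρ (x + shift i s - y) * w y)
    (F' := fun s y => pderiv i ρ (x + shift i s - y) * w y)
    (x₀ := (0 : ℝ)) (s := univ) (bound := fun y => C * ‖w y‖) univ_mem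
    (Eventually.of_forall fun s =>
      (hρ.continuous.comp (by fun_prop)).aestronglyMeasurable.mul hw.1)
    (hw.bdd_mul (hρ.continuous.comp (by fun_prop)).aestronglyMeasurable
      (Eventually.of_forall fun y => hC' _))
    (((hρ.pderiv i).continuous.comp (by fun_prop)).aestronglyMeasurable.mul hw.1)
    (Eventually.of_forall fun y s _ => by
      rw [norm_mul]
      exact mul_le_mul_of_nonneg_right (hC _) (norm_nonneg _)) (hw.norm.const_mul C)
    (Eventually.of_forall fun y s _ => by
      have h := ((hρ.hasPartial i).hasDerivAt (x - y) s).mul_const (w y)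
      simpa only [sub_add_eq_add_sub] using h)
  have h := key.2
  simp only [shift_zero, add_zero] at h
  exact h

theorem norm_conv_le {ρ w : Torus d → ℝ} {C M : ℝ} (hC : ∀ x, ‖ρ x‖ ≤ C) (hC0 : 0 ≤ C)
    (hM : ∀ x, ‖w x‖ ≤ M) : ‖conv ρ w x‖ ≤ C * M := by
  have := norm_integral_le_of_norm_le_const (μ := (volume : Measure (Torus d)))
    (f := fun y => ρ (x - y) * w y) (C := C * M) (Eventually.of_forall fun y => by
      rw [norm_mul]
      exact mul_le_mul (hC _) (hM _) (norm_nonneg _) hC0)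
  simpa [conv] using this

/-- If `w` is close to `c` near `x`, so is its mollification at `x`. -/
theorem abs_conv_sub_le {ρ w : Torus d → ℝ} {ε η c : ℝ} {x : Torus d} (hρ : Continuous ρ)
    (hρ0 : ∀ x, 0 ≤ ρ x) (hρ1 : ∫ x, ρ x = 1) (hρε : ∀ x, ρ x ≠ 0 → ‖x‖ < ε)
    (hw : Integrable w) (h : ∀ y, dist x y < ε → |w y - c| ≤ η) :
    |conv ρ w x - c| ≤ η := by
  have hρx : Continuous fun y => ρ (x - y) := hρ.comp (by fun_prop)
  have h1 : ∫ y, ρ (x - y) = 1 := by rw [integral_sub_left_eq_self, hρ1]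
  obtain ⟨C, -, hC⟩ := exists_norm_le_of_continuous hρ
  have hi : Integrable fun y => ρ (x - y) * w y :=
    hw.bdd_mul hρx.aestronglyMeasurable (Eventually.of_forall fun y => hC _)
  have h2 : conv ρ w x - c = ∫ y, ρ (x - y) * (w y - c) := by
    simp_rw [mul_sub]
    rw [integral_sub hi ((integrable_of_continuous hρx).mul_const c), integral_mul_const, h1,
      one_mul, conv]
  have h3 : η = ∫ y, ρ (x - y) * η := by rw [integral_mul_const, h1, one_mul]
  rw [h2, h3, ← Real.norm_eq_abs]
  refine norm_integral_le_of_norm_le ((integrable_of_continuous hρx).mul_const η)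
    (Eventually.of_forall fun y => ?_)
  rw [norm_mul, Real.norm_eq_abs, abs_of_nonneg (hρ0 _)]
  by_cases hy : ρ (x - y) = 0
  · simp [hy]
  · refine mul_le_mul_of_nonneg_left (h y ?_) (hρ0 _)
    rw [dist_eq_norm]
    exact hρε _ hy

end Torus

/-! ### Functions of time -/

section Time

/-- Such points are global minima (value 0) or maxima (value 1) of the transition, hence critical;
this covers the endpoints 0 and 1 as well. -/
theorem deriv_smoothTransition_eq_zero {s : ℝ} (hs : s ∉ Ioo (0 : ℝ) 1) :
    deriv Real.smoothTransition s = 0 := by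
  rw [mem_Ioo, not_and_or, not_lt, not_lt] at hs
  rcases hs with hs | hs
  · refine IsLocalMin.deriv_eq_zero (Eventually.of_forall fun r => ?_)
    rw [Real.smoothTransition.zero_of_nonpos hs]
    exact Real.smoothTransition.nonneg r
  · refine IsLocalMax.deriv_eq_zero (Eventually.of_forall fun r => ?_)
    rw [Real.smoothTransition.one_of_one_le hs]
    exact Real.smoothTransition.le_one r

theorem continuous_deriv_smoothTransition : Continuous (deriv Real.smoothTransition) :=
  (Real.smoothTransition.contDiff (n := 1)).continuous_deriv (by simp)

theorem hasCompactSupport_deriv_smoothTransition :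
    HasCompactSupport (deriv Real.smoothTransition) :=
  HasCompactSupport.intro (K := Icc 0 1) isCompact_Icc fun _ hs =>
    deriv_smoothTransition_eq_zero fun h => hs (Ioo_subset_Icc_self h)

theorem integrable_deriv_smoothTransition : Integrable (deriv Real.smoothTransition) :=
  continuous_deriv_smoothTransition.integrable_of_hasCompactSupport
    hasCompactSupport_deriv_smoothTransition

theorem integral_deriv_smoothTransition : ∫ s, deriv Real.smoothTransition s = 1 := by
  have h1 : ∫ s, deriv Real.smoothTransition s =
      ∫ s in (0 : ℝ)..1, deriv Real.smoothTransition s := by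
    rw [intervalIntegral.integral_of_le zero_le_one]
    refine (setIntegral_eq_integral_of_forall_compl_eq_zero fun s hs => ?_).symm
    exact deriv_smoothTransition_eq_zero fun h => hs (Ioo_subset_Ioc_self h)
  rw [h1, intervalIntegral.integral_deriv_eq_sub
    (fun s _ => (Real.smoothTransition.contDiff (n := 1)).differentiable (by simp) s)
    (continuous_deriv_smoothTransition.intervalIntegrable _ _)]
  simp

/-- The derivatives of steep smooth transitions form an approximate identity. -/
theorem tendsto_integral_deriv_smoothTransition {h : ℝ → ℝ} (hc : Continuous h) {C : ℝ}
    (hC : ∀ t, |h t| ≤ C) (c e : ℝ) :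
    Tendsto (fun n : ℕ => ∫ s, n * deriv Real.smoothTransition (n * (s - c) + e) * h s) atTop
      (𝓝 (h c)) := by
  -- This is the integral after the substitution `y = n (s - c) + e`; the factor `n` is absorbed and
  -- dominated convergence applies.
  have h1 : Tendsto (fun n : ℕ => ∫ y, deriv Real.smoothTransition y * h (c + (y - e) / n)) atTop
      (𝓝 (∫ y, deriv Real.smoothTransition y * h c)) := by
    refine tendsto_integral_of_dominated_convergence
      (fun y => ‖deriv Real.smoothTransition y‖ * C) (fun n => ?_)
      (integrable_deriv_smoothTransition.norm.mul_const C) (fun n => ?_) ?_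
    · exact (continuous_deriv_smoothTransition.mul (hc.comp (by fun_prop))).aestronglyMeasurable
    · refine Eventually.of_forall fun y => ?_
      rw [norm_mul]
      exact mul_le_mul_of_nonneg_left (hC _) (norm_nonneg _)
    · refine Eventually.of_forall fun y => Tendsto.const_mul _ ?_
      refine (hc.tendsto c).comp ?_
      have : Tendsto (fun n : ℕ => c + (y - e) / (n : ℝ)) atTop (𝓝 (c + 0)) :=
        tendsto_const_nhds.add (tendsto_const_div_atTop_nhds_zero_nat _)
      rwa [add_zero] at this
  rw [integral_mul_const, integral_deriv_smoothTransition, one_mul] at h1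
  refine h1.congr' ?_
  filter_upwards [eventually_gt_atTop 0] with n hn
  have hn' : (0 : ℝ) < n := Nat.cast_pos.2 hn
  have h2 := Measure.integral_comp_mul_left
    (fun y => n * deriv Real.smoothTransition (y - (n * c - e)) * h (y / n)) (n : ℝ)
  have h3 := integral_sub_right_eq_self (μ := (volume : Measure ℝ))
    (fun y => (n : ℝ) * deriv Real.smoothTransition y * h (c + (y - e) / n)) (n * c - e)
  have h4 : ∀ y : ℝ, c + (y - (n * c - e) - e) / n = y / n := by
    intro y
    field_simp
    ring
  simp only [h4] at h3
  rw [h3] at h2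
  have h5 : ∀ s : ℝ, (n : ℝ) * s - (n * c - e) = n * (s - c) + e := fun s => by ring
  have h6 : ∀ s : ℝ, (n : ℝ) * s / n = s := fun s => by field_simp
  simp only [h5, h6, smul_eq_mul, mul_assoc, integral_const_mul] at h2 ⊢
  rw [h2, abs_of_pos (inv_pos.2 hn'), inv_mul_cancel_left₀ hn'.ne']

/-- A continuous function whose weak derivative is the integrable function `k` is a primitive
of `k`. -/
theorem sub_eq_integral_of_weak_deriv {T : ℝ} {h k : ℝ → ℝ} (hc : Continuous h)
    {C : ℝ} (hC : ∀ t, |h t| ≤ C) (hk : IntegrableOn k (Icc 0 T))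
    (H : ∀ χ : ℝ → ℝ, ContDiff ℝ 1 χ → tsupport χ ⊆ Ioo 0 T →
      ∫ t in Icc 0 T, deriv χ t * h t = -∫ t in Icc 0 T, χ t * k t)
    {t : ℝ} (ht : t ∈ Icc 0 T) : h t - h 0 = ∫ s in (0 : ℝ)..t, k s := by
  rcases ht.1.eq_or_lt with rfl | ht0
  · simp
  set S := Real.smoothTransition with hS
  -- A smooth approximation of the indicator of `(0, t)`: it rises on `[1/n, 2/n]` and falls on `[t
  -- - 2/n, t - 1/n]`. The shifts -1 and 2 place both ramps strictly inside `(0, t)`.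
  set χ : ℕ → ℝ → ℝ := fun n s => S (n * (s - 0) + (-1)) - S (n * (s - t) + 2) with hχ
  have hSd : ∀ s, HasDerivAt S (deriv S s) s := fun s =>
    ((Real.smoothTransition.contDiff (n := 1)).differentiable (by simp) s).hasDerivAt
  have hd : ∀ (n : ℕ) s, HasDerivAt (χ n)
      (n * deriv S (n * (s - 0) + (-1)) - n * deriv S (n * (s - t) + 2)) s := by
    intro n s
    have hl : ∀ c e : ℝ, HasDerivAt (fun s => S (n * (s - c) + e))
        (n * deriv S (n * (s - c) + e)) s := by
      intro c e
      have h1 : HasDerivAt (fun s : ℝ => (n : ℝ) * (s - c) + e) n s := by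
        simpa using (((hasDerivAt_id s).sub_const c).const_mul (n : ℝ)).add_const e
      rw [mul_comm]
      exact (hSd _).comp s h1
    exact (hl 0 (-1)).sub (hl t 2)
  have hcd : ∀ n, ContDiff ℝ 1 (χ n) := fun n =>
    (Real.smoothTransition.contDiff.comp (by fun_prop)).sub
      (Real.smoothTransition.contDiff.comp (by fun_prop))
  have hbig : ∀ᶠ n : ℕ in atTop, 3 ≤ n * t :=
    (tendsto_natCast_atTop_atTop.atTop_mul_const ht0).eventually_ge_atTop 3
  -- The bound `n t ≥ 3` ensures that to the left of `1/n` both transitions are 0 and to the right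
  -- of `t - 1/n` both are 1.
  have hzero : ∀ n : ℕ, 3 ≤ n * t → ∀ s, s ∉ Icc (1 / (n : ℝ)) (t - 1 / n) → χ n s = 0 := by
    intro n hn s hs
    have hn0 : (0 : ℝ) < n := by
      by_contra! h
      nlinarith
    rw [mem_Icc, not_and_or, not_le, not_le, lt_div_iff₀ hn0, sub_lt_comm, lt_div_iff₀ hn0] at hs
    rcases hs with hs | hs
    · simp only [hχ, hS]
      rw [Real.smoothTransition.zero_of_nonpos (by linarith),
        Real.smoothTransition.zero_of_nonpos (by linarith), sub_zero]
    · have : (n : ℝ) * (s - t) > -1 := by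
        rcases lt_or_ge s t with h | h <;> nlinarith
      simp only [hχ, hS]
      rw [Real.smoothTransition.one_of_one_le (by linarith),
        Real.smoothTransition.one_of_one_le (by linarith), sub_self]
  have hsupp : ∀ n : ℕ, 3 ≤ n * t → tsupport (χ n) ⊆ Ioo 0 t := by
    intro n hn
    have hn0 : (0 : ℝ) < n := by
      by_contra! h
      nlinarith
    have h1 : tsupport (χ n) ⊆ Icc (1 / (n : ℝ)) (t - 1 / n) :=
      closure_minimal (fun s hs => by
        by_contra h
        exact hs (hzero n hn s h)) isClosed_Icc
    have h2 : 0 < 1 / (n : ℝ) := by positivity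
    exact h1.trans fun s hs => ⟨by linarith [hs.1], by linarith [hs.2]⟩
  have hbd : ∀ n s, |χ n s| ≤ 1 := by
    intro n s
    have h1 := Real.smoothTransition.nonneg (n * (s - 0) + (-1))
    have h2 := Real.smoothTransition.le_one (n * (s - 0) + (-1))
    have h3 := Real.smoothTransition.nonneg (n * (s - t) + 2)
    have h4 := Real.smoothTransition.le_one (n * (s - t) + 2)
    rw [abs_le]
    constructor <;> simp only [hχ, hS] <;> linarith
  have hlim : ∀ s, Tendsto (fun n => χ n s) atTop (𝓝 (indicator (Ioo 0 t) 1 s)) := by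
    intro s
    by_cases hs : s ∈ Ioo 0 t
    · refine tendsto_const_nhds.congr' ?_
      have h1 : ∀ᶠ n : ℕ in atTop, 2 ≤ n * s :=
        (tendsto_natCast_atTop_atTop.atTop_mul_const hs.1).eventually_ge_atTop 2
      have h2 : ∀ᶠ n : ℕ in atTop, 2 ≤ n * (t - s) :=
        (tendsto_natCast_atTop_atTop.atTop_mul_const (sub_pos.2 hs.2)).eventually_ge_atTop 2
      filter_upwards [h1, h2] with n hn1 hn2
      simp only [hχ, hS, indicator_of_mem hs, Pi.one_apply]
      rw [Real.smoothTransition.one_of_one_le (by linarith),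
        Real.smoothTransition.zero_of_nonpos (by linarith), sub_zero]
    · refine tendsto_const_nhds.congr' ?_
      filter_upwards [hbig] with n hn
      rw [indicator_of_notMem hs]
      by_contra h
      exact hs (hsupp n hn (subset_tsupport _ (Ne.symm h)))
  have hR : Tendsto (fun n => ∫ s in Icc 0 T, χ n s * k s) atTop (𝓝 (∫ s in (0 : ℝ)..t, k s)) := by
    have h1 : ∫ s in (0 : ℝ)..t, k s = ∫ s in Icc 0 T, indicator (Ioo 0 t) 1 s * k s := by
      have : (fun s => indicator (Ioo 0 t) (1 : ℝ → ℝ) s * k s) = indicator (Ioo 0 t) k := by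
        funext s
        by_cases hs : s ∈ Ioo 0 t <;> simp [hs]
      rw [this, setIntegral_indicator measurableSet_Ioo,
        inter_eq_right.2 (Ioo_subset_Icc_self.trans (Icc_subset_Icc_right ht.2)),
        intervalIntegral.integral_of_le ht0.le, integral_Ioc_eq_integral_Ioo]
    rw [h1]
    refine tendsto_integral_of_dominated_convergence (fun s => ‖k s‖) (fun n => ?_) hk.norm
      (fun n => Eventually.of_forall fun s => ?_)
      (Eventually.of_forall fun s => (hlim s).mul_const _)
    · exact (hcd n).continuous.aestronglyMeasurable.mul hk.1
    · rw [norm_mul]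
      exact mul_le_of_le_one_left (norm_nonneg _) (hbd n s)
  -- The derivative of `χ n` is a positive unit bump near 0 minus one near `t`, so the weak
  -- formulation picks out the two endpoint values of `h`.
  have hL : Tendsto (fun n => ∫ s in Icc 0 T, deriv (χ n) s * h s) atTop (𝓝 (h 0 - h t)) := by
    refine ((tendsto_integral_deriv_smoothTransition hc hC 0 (-1)).sub
      (tendsto_integral_deriv_smoothTransition hc hC t 2)).congr' ?_
    filter_upwards [hbig] with n hn
    have hn0 : (0 : ℝ) < n := by
      by_contra! h
      nlinarith
    rw [setIntegral_eq_integral_of_forall_compl_eq_zero, ← integral_sub]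
    · refine integral_congr_ae (Eventually.of_forall fun s => ?_)
      simp only [(hd n s).deriv, sub_mul]
      rfl
    · refine Continuous.integrable_of_hasCompactSupport ?_ ?_
      · exact (continuous_const.mul (continuous_deriv_smoothTransition.comp (by fun_prop))).mul hc
      · refine HasCompactSupport.mul_right (HasCompactSupport.intro (K := Icc (1 / n) (2 / n))
          isCompact_Icc fun s hs => ?_)
        refine mul_eq_zero_of_right _ (deriv_smoothTransition_eq_zero fun h => hs ?_)
        rw [mem_Icc, div_le_iff₀ hn0, le_div_iff₀ hn0]
        constructor <;> linarith [h.1, h.2]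
    · refine Continuous.integrable_of_hasCompactSupport ?_ ?_
      · exact (continuous_const.mul (continuous_deriv_smoothTransition.comp (by fun_prop))).mul hc
      · refine HasCompactSupport.mul_right (HasCompactSupport.intro
          (K := Icc (t - 2 / n) (t - 1 / n)) isCompact_Icc fun s hs => ?_)
        refine mul_eq_zero_of_right _ (deriv_smoothTransition_eq_zero fun h => hs ?_)
        rw [mem_Icc, sub_le_comm, le_sub_comm, le_div_iff₀ hn0, div_le_iff₀ hn0]
        constructor <;> linarith [h.1, h.2]
    · intro s hs
      have h1 : s ∉ tsupport (χ n) := fun h' =>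
        hs (Ioo_subset_Icc_self ((hsupp n hn).trans (Ioo_subset_Ioo_right ht.2) h'))
      have h2 : deriv (χ n) s = 0 := by
        by_contra h3
        exact h1 (support_deriv_subset h3)
      rw [h2, zero_mul]
  have hev : (fun n => ∫ s in Icc 0 T, deriv (χ n) s * h s) =ᶠ[atTop]
      fun n => -∫ s in Icc 0 T, χ n s * k s := by
    filter_upwards [hbig] with n hn
    exact H _ (hcd n) ((hsupp n hn).trans (Ioo_subset_Ioo_right ht.2))
  have := tendsto_nhds_unique (hL.congr' hev) hR.neg
  linarith

theorem lipschitzWith_integral {k : ℝ → ℝ} {M : ℝ≥0} (hk : ∀ t, |k t| ≤ M)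
    (hkm : Measurable k) (y₀ : ℝ) : LipschitzWith M fun t => y₀ + ∫ s in (0 : ℝ)..t, k s := by
  have hi : ∀ a b, IntervalIntegrable k volume a b := fun a b =>
    (intervalIntegrable_const (c := (M : ℝ))).mono_fun hkm.aestronglyMeasurable
      (Eventually.of_forall fun t => by simpa using hk t)
  refine LipschitzWith.of_dist_le_mul fun a b => ?_
  rw [Real.dist_eq, Real.dist_eq, add_sub_add_left_eq_sub,
    intervalIntegral.integral_interval_sub_left (hi _ _) (hi _ _)]
  exact intervalIntegral.norm_integral_le_of_norm_le_const (f := k) fun t _ => hk t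

theorem ae_hasDerivAt_integral {k : ℝ → ℝ} {M : ℝ≥0} (hk : ∀ t, |k t| ≤ M)
    (hkm : Measurable k) (y₀ : ℝ) :
    ∀ᵐ t, HasDerivAt (fun t => y₀ + ∫ s in (0 : ℝ)..t, k s) (k t) t := by
  have hl : LocallyIntegrable k := fun x =>
    ((isCompact_Icc (a := x - 1) (b := x + 1)).exists_bound_of_continuousOn
      (f := fun _ : ℝ => (0 : ℝ)) continuousOn_const).elim fun _ _ =>
      ⟨Icc (x - 1) (x + 1), Icc_mem_nhds (by linarith) (by linarith),
        Measure.integrableOn_of_bounded (M := M) (by simp) hkm.aestronglyMeasurable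
          (Eventually.of_forall fun t => hk t)⟩
  filter_upwards [LocallyIntegrable.ae_hasDerivAt_integral hl] with t ht
  exact (ht 0).const_add y₀

/-- The chain rule for primitives of bounded functions. -/
theorem comp_sub_eq_integral {k : ℝ → ℝ} {M : ℝ≥0} (hk : ∀ t, |k t| ≤ M) (hkm : Measurable k)
    {y : ℝ → ℝ} {T : ℝ} (hy : ∀ t ∈ Icc 0 T, y t - y 0 = ∫ s in (0 : ℝ)..t, k s)
    {β β' : ℝ → ℝ} (hβ : ∀ s, HasDerivAt β (β' s) s) (hβ' : Continuous β') {t : ℝ}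
    (ht : t ∈ Icc 0 T) : β (y t) - β (y 0) = ∫ s in (0 : ℝ)..t, β' (y s) * k s := by
  -- `z` is Lipschitz on the whole line and agrees with `y` on `[0, T]`. Thus `β ∘ z` is absolutely
  -- continuous, and the chain rule is needed only at almost every point.
  set z : ℝ → ℝ := fun t => y 0 + ∫ s in (0 : ℝ)..t, k s with hz
  have hzy : ∀ s ∈ Icc 0 T, z s = y s := fun s hs => by
    simp only [hz, ← hy s hs]
    ring
  have hzl : LipschitzWith M z := lipschitzWith_integral hk hkm _
  have hac : AbsolutelyContinuousOnInterval (fun s => β (z s)) 0 t := by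
    obtain ⟨R, hR⟩ := (isCompact_uIcc (a := (0 : ℝ)) (b := t)).exists_bound_of_continuousOn
      hzl.continuous.continuousOn
    obtain ⟨K, hK⟩ := (isCompact_closedBall (0 : ℝ) R).exists_bound_of_continuousOn
      hβ'.continuousOn
    have h1 : LipschitzOnWith K.toNNReal β (Metric.closedBall 0 R) :=
      (convex_closedBall (0 : ℝ) R).lipschitzOnWith_of_nnnorm_hasDerivWithin_le
        (fun s _ => (hβ s).hasDerivWithinAt) fun s hs => by
          rw [← NNReal.coe_le_coe, coe_nnnorm]
          exact (hK s hs).trans (Real.le_coe_toNNReal K)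
    exact (h1.comp (hzl.lipschitzOnWith (s := uIcc 0 t)) fun s hs => by
      simpa using hR s hs).absolutelyContinuousOnInterval
  have h1 := hac.integral_deriv_eq_sub
  simp only [hzy t ht, hzy 0 ⟨le_rfl, ht.1.trans ht.2⟩] at h1
  rw [← h1]
  refine intervalIntegral.integral_congr_ae ?_
  filter_upwards [ae_hasDerivAt_integral hk hkm (y 0)] with s hs hsm
  rw [uIoc_of_le ht.1] at hsm
  rw [← hzy s ⟨hsm.1.le, hsm.2.trans ht.2⟩]
  exact ((hβ _).comp s hs).deriv

/-- The product rule for a `C¹` function and a primitive of a bounded function. -/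
theorem mul_sub_eq_integral {k : ℝ → ℝ} {M : ℝ≥0} (hk : ∀ t, |k t| ≤ M) (hkm : Measurable k)
    {y : ℝ → ℝ} {T : ℝ} (hT : 0 < T) (hy : ∀ t ∈ Icc 0 T, y t - y 0 = ∫ s in (0 : ℝ)..t, k s)
    {u : ℝ → ℝ} (hu : DifferentiableOn ℝ u (Icc 0 T))
    (hu' : ContinuousOn (derivWithin u (Icc 0 T)) (Icc 0 T)) :
    u T * y T - u 0 * y 0 =
      ∫ s in (0 : ℝ)..T, (derivWithin u (Icc 0 T) s * y s + u s * k s) := by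
  set z : ℝ → ℝ := fun t => y 0 + ∫ s in (0 : ℝ)..t, k s with hz
  have hzy : ∀ s ∈ Icc 0 T, z s = y s := fun s hs => by
    simp only [hz, ← hy s hs]
    ring
  have hzl : LipschitzWith M z := lipschitzWith_integral hk hkm _
  have hua : AbsolutelyContinuousOnInterval u 0 T := by
    refine ContDiffOn.absolutelyContinuousOnInterval ?_
    rw [uIcc_of_le hT.le, contDiffOn_one_iff_derivWithin (uniqueDiffOn_Icc hT)]
    exact ⟨hu, hu'⟩
  have hza : AbsolutelyContinuousOnInterval z 0 T :=
    (hzl.lipschitzOnWith (s := uIcc 0 T)).absolutelyContinuousOnInterval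
  have h1 := (hua.mul hza).integral_deriv_eq_sub
  simp only [Pi.mul_apply, hzy T ⟨hT.le, le_rfl⟩, hzy 0 ⟨le_rfl, hT.le⟩] at h1
  rw [← h1]
  refine intervalIntegral.integral_congr_ae ?_
  -- At `T` the one-sided derivative of `u` need not be a two-sided one; discarding this point costs
  -- nothing under the integral.
  have hne : ∀ᵐ s : ℝ, s ≠ T := by simp [ae_iff]
  filter_upwards [ae_hasDerivAt_integral hk hkm (y 0), hne] with s hs hsT hsm
  rw [uIoc_of_le hT.le] at hsm
  have hsT' : s < T := lt_of_le_of_ne hsm.2 hsT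
  rw [← hzy s ⟨hsm.1.le, hsm.2⟩]
  have hus : HasDerivAt u (derivWithin u (Icc 0 T) s) s :=
    (hu s ⟨hsm.1.le, hsm.2⟩).hasDerivWithinAt.hasDerivAt (Icc_mem_nhds hsm.1 hsT')
  exact (hus.mul hs).deriv

end Time

/-! ### Integrals over space-time of functions bounded on `Q` -/

section SpaceTime

variable {d : ℕ}

theorem integrable_slice {F : Torus d × ℝ → ℝ} (hF : Measurable F) {C : ℝ} {t : ℝ}
    (hC : ∀ x, |F (x, t)| ≤ C) : Integrable fun x => F (x, t) :=
  Integrable.of_bound (hF.comp (by fun_prop)).aestronglyMeasurable C (Eventually.of_forall hC)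

theorem abs_integral_slice_le {F : Torus d → ℝ} {C : ℝ} (hC : ∀ x, |F x| ≤ C) :
    |∫ x, F x| ≤ C := by
  have := norm_integral_le_of_norm_le_const (μ := (volume : Measure (Torus d)))
    (f := F) (C := C) (Eventually.of_forall hC)
  simpa using this

theorem measurable_integral_slice {F : Torus d × ℝ → ℝ} (hF : Measurable F) :
    Measurable fun t => ∫ x, F (x, t) := by
  have h : StronglyMeasurable (Function.uncurry fun (t : ℝ) (x : Torus d) => F (x, t)) :=
    (hF.comp measurable_swap).stronglyMeasurable
  exact h.integral_prod_right.measurable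

theorem intervalIntegrable_of_bound {f : ℝ → ℝ} (hf : Measurable f) {C T t : ℝ}
    (hC : ∀ s ∈ Icc 0 T, |f s| ≤ C) (ht : t ∈ Icc 0 T) : IntervalIntegrable f volume 0 t := by
  rw [intervalIntegrable_iff, uIoc_of_le ht.1]
  refine Measure.integrableOn_of_bounded (M := C) (by simp) hf.aestronglyMeasurable ?_
  exact (ae_restrict_iff' measurableSet_Ioc).2
    (Eventually.of_forall fun s hs => hC s ⟨hs.1.le, hs.2.trans ht.2⟩)

theorem intervalIntegrable_slice {F : Torus d × ℝ → ℝ} (hF : Measurable F) {C T t : ℝ}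
    (hC : ∀ x, ∀ s ∈ Icc 0 T, |F (x, s)| ≤ C) (ht : t ∈ Icc 0 T) :
    IntervalIntegrable (fun s => ∫ x, F (x, s)) volume 0 t :=
  intervalIntegrable_of_bound (measurable_integral_slice hF)
    (fun s hs => abs_integral_slice_le fun x => hC x s hs) ht

theorem integral_swap_of_bound {F : Torus d × ℝ → ℝ} (hF : Measurable F) {C T t : ℝ}
    (hC : ∀ x, ∀ s ∈ Icc 0 T, |F (x, s)| ≤ C) (ht : t ∈ Icc 0 T) :
    ∫ x, ∫ s in (0 : ℝ)..t, F (x, s) = ∫ s in (0 : ℝ)..t, ∫ x, F (x, s) := by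
  simp only [intervalIntegral.integral_of_le ht.1]
  refine integral_integral_swap (f := fun x s => F (x, s)) ?_
  refine Integrable.of_bound hF.aestronglyMeasurable C ?_
  have h : ∀ᵐ s ∂(volume.restrict (Ioc 0 t) : Measure ℝ), s ∈ Ioc 0 t :=
    ae_restrict_mem measurableSet_Ioc
  filter_upwards [Measure.quasiMeasurePreserving_snd.ae h] with z hz
  exact hC z.1 z.2 ⟨hz.1.le, hz.2.trans ht.2⟩

theorem isCompact_cyl (d : ℕ) (T : ℝ) : IsCompact (cyl d T) := isCompact_univ.prod isCompact_Icc

theorem exists_bound_cyl {F : Torus d × ℝ → ℝ} (hF : Continuous F) (T : ℝ) :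
    ∃ C, 0 ≤ C ∧ ∀ x, ∀ t ∈ Icc 0 T, |F (x, t)| ≤ C := by
  obtain ⟨C, hC⟩ := (isCompact_cyl d T).exists_bound_of_continuousOn hF.continuousOn
  exact ⟨max C 0, le_max_right _ _, fun x t ht =>
    (hC (x, t) ⟨mem_univ _, ht⟩).trans (le_max_left _ _)⟩

theorem exists_modulus_cyl {F : Torus d × ℝ → ℝ} (hF : Continuous F) (T : ℝ) {η : ℝ}
    (hη : 0 < η) :
    ∃ ε > 0, ∀ t ∈ Icc 0 T, ∀ x y, dist x y < ε → |F (y, t) - F (x, t)| ≤ η := by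
  have h := (isCompact_cyl d T).uniformContinuousOn_of_continuous hF.continuousOn
  obtain ⟨ε, hε, h⟩ := Metric.uniformContinuousOn_iff.1 h η hη
  refine ⟨ε, hε, fun t ht x y hxy => ?_⟩
  have := h (y, t) ⟨mem_univ _, ht⟩ (x, t) ⟨mem_univ _, ht⟩ (by
    rw [Prod.dist_eq, dist_self, max_eq_left dist_nonneg, dist_comm]
    exact hxy)
  exact this.le

/-- Joint measurability in space and time, needed to exchange the two integrations when `w` is a
component of the flux. -/
theorem measurable_conv {ρ : Torus d → ℝ} (hρ : Continuous ρ) {w : Torus d × ℝ → ℝ}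
    (hw : Measurable w) : Measurable fun z : Torus d × ℝ => conv ρ (fun y => w (y, z.2)) z.1 := by
  have h : StronglyMeasurable (Function.uncurry fun (z : Torus d × ℝ) (y : Torus d) =>
      ρ (z.1 - y) * w (y, z.2)) := by
    refine Measurable.stronglyMeasurable ?_
    exact (hρ.measurable.comp (by fun_prop)).mul (hw.comp (by fun_prop))
  exact h.integral_prod_right.measurable

theorem continuous_integral_slice {F : Torus d × ℝ → ℝ} (hF : Continuous F) :
    Continuous fun t => ∫ x, F (x, t) := by
  have h := continuous_parametric_integral_of_continuous
    (μ := (volume : Measure (Torus d))) (f := fun (t : ℝ) (x : Torus d) => F (x, t))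
    (hF.comp continuous_swap) isCompact_univ
  simpa using h

theorem continuous_conv_slice {ρ : Torus d → ℝ} (hρ : Continuous ρ) {w : Torus d × ℝ → ℝ}
    (hw : Continuous w) :
    Continuous fun z : Torus d × ℝ => conv ρ (fun y => w (y, z.2)) z.1 := by
  have h := continuous_parametric_integral_of_continuous
    (μ := (volume : Measure (Torus d)))
    (f := fun (z : Torus d × ℝ) (y : Torus d) => ρ (z.1 - y) * w (y, z.2))
    ((hρ.comp (by fun_prop)).mul (hw.comp (by fun_prop))) isCompact_univ
  simpa [conv] using h

/-- Mollification is self-adjoint up to a reflection of the kernel. -/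
theorem integral_mul_conv {ρ f w : Torus d → ℝ} (hρ : Continuous ρ) (hf : Continuous f)
    (hw : Integrable w) :
    ∫ x, f x * conv ρ w x = ∫ y, w y * conv (fun z => ρ (-z)) f y := by
  obtain ⟨C, hC0, hC⟩ := exists_norm_le_of_continuous hρ
  obtain ⟨K, hK0, hK⟩ := exists_norm_le_of_continuous hf
  have h1 : ∀ x, f x * conv ρ w x = ∫ y, f x * (ρ (x - y) * w y) := fun x => by
    rw [integral_const_mul, conv]
  have h2 : ∀ y, w y * conv (fun z => ρ (-z)) f y = ∫ x, f x * (ρ (x - y) * w y) := fun y => by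
    rw [conv, ← integral_const_mul]
    refine integral_congr_ae (Eventually.of_forall fun x => ?_)
    simp only [neg_sub]
    ring
  simp_rw [h1, h2]
  refine integral_integral_swap (f := fun x y => f x * (ρ (x - y) * w y)) ?_
  have hg : Integrable (fun z : Torus d × Torus d => w z.2)
      ((volume : Measure (Torus d)).prod volume) := hw.comp_snd volume
  have hb : Continuous fun z : Torus d × Torus d => f z.1 * ρ (z.1 - z.2) :=
    (hf.comp continuous_fst).mul (hρ.comp (by fun_prop))
  refine (hg.bdd_mul (c := K * C) hb.aestronglyMeasurable
    (Eventually.of_forall fun z => ?_)).congr (Eventually.of_forall fun z => ?_)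
  · rw [norm_mul]
    exact mul_le_mul (hK _) (hC _) (norm_nonneg _) hK0
  · simp only [Function.uncurry]
    ring

end SpaceTime

/-! ### Weak solutions of Fokker-Planck equations -/

section FP

variable {d : ℕ}

/-- `m` is a continuous weak solution of `∂ₜm - Δm + ∇·b = 0`, with flux `b` controlled by `m`. -/
structure IsWeakFP (T M B : ℝ) (m : Torus d × ℝ → ℝ) (b : Torus d × ℝ → E d) : Prop where
  T_pos : 0 < T
  M_nonneg : 0 ≤ M
  cont : Continuous m
  bdd : ∀ z, |m z| ≤ B
  meas : Measurable b
  flux : ∀ z, ‖b z‖ ≤ M * |m z|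
  weak : ∀ ψ, IsSmooth ψ → ∀ t ∈ Icc 0 T,
    (∫ x, ψ x * m (x, t)) - ∫ x, ψ x * m (x, 0) =
      ∫ s in (0 : ℝ)..t, ∫ x, ∑ i, (pderiv i (pderiv i ψ) x * m (x, s) + pderiv i ψ x * b (x, s) i)

namespace IsWeakFP

variable {T M B : ℝ} {m : Torus d × ℝ → ℝ} {b : Torus d × ℝ → E d} (h : IsWeakFP T M B m b)
  {ρ : Torus d → ℝ}

include h

theorem B_nonneg : 0 ≤ B := (abs_nonneg _).trans (h.bdd (0, 0))

theorem abs_coord_le (z : Torus d × ℝ) (i : Fin d) : |b z i| ≤ M * |m z| :=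
  (PiLp.norm_apply_le (b z) i).trans (h.flux z)

theorem abs_coord_le' (z : Torus d × ℝ) (i : Fin d) : |b z i| ≤ M * B :=
  (h.abs_coord_le z i).trans (mul_le_mul_of_nonneg_left (h.bdd z) h.M_nonneg)

theorem measurable_coord (i : Fin d) : Measurable fun z => b z i :=
  (EuclideanSpace.proj (𝕜 := ℝ) i).continuous.measurable.comp h.meas

theorem integrable_m (t : ℝ) : Integrable fun x => m (x, t) :=
  integrable_slice h.cont.measurable fun x => h.bdd (x, t)

theorem integrable_b (t : ℝ) (i : Fin d) : Integrable fun x => b (x, t) i :=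
  integrable_slice (F := fun z => b z i) (h.measurable_coord i) fun x => h.abs_coord_le' (x, t) i

/-- Conservation of mass. -/
theorem integral_eq {t : ℝ} (ht : t ∈ Icc 0 T) : ∫ x, m (x, t) = ∫ x, m (x, 0) := by
  have h1 := h.weak (fun _ => 1) (isSmooth_const 1) t ht
  simp only [pderiv_const, one_mul, zero_mul, add_zero, Finset.sum_const_zero, integral_zero,
    intervalIntegral.integral_zero] at h1
  linarith

omit h in
variable (m b ρ) in
/-- The `i`-th component of the mollified total flux `∇m - b`. -/
def molFlux (i : Fin d) (z : Torus d × ℝ) : ℝ :=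
  conv (pderiv i ρ) (fun y => m (y, z.2)) z.1 - conv ρ (fun y => b (y, z.2) i) z.1

omit h in
variable (m b ρ) in
/-- The time derivative of the mollified density. -/
def molRate (z : Torus d × ℝ) : ℝ :=
  ∑ i, (conv (pderiv i (pderiv i ρ)) (fun y => m (y, z.2)) z.1 -
    conv (pderiv i ρ) (fun y => b (y, z.2) i) z.1)

theorem measurable_molRate (hρ : IsSmooth ρ) : Measurable (molRate m b ρ) := by
  refine Finset.measurable_sum _ fun i _ => ?_
  exact (measurable_conv ((hρ.pderiv i).pderiv i).continuous h.cont.measurable).sub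
    (measurable_conv (w := fun z => b z i) (hρ.pderiv i).continuous (h.measurable_coord i))

/-- With all derivatives on the kernel, `m` and `b` enter only through their sup bounds. Hence the
mollified density is Lipschitz in time, although `m` is only continuous. -/
theorem exists_molRate_bound (hρ : IsSmooth ρ) :
    ∃ K : ℝ≥0, ∀ z, |molRate m b ρ z| ≤ K := by
  choose C hC0 hC using fun i => exists_norm_le_of_continuous (hρ.pderiv i).continuous
  choose C' hC0' hC' using fun i => exists_norm_le_of_continuous ((hρ.pderiv i).pderiv i).continuous
  have hK : ∀ z, |molRate m b ρ z| ≤ ∑ i, (C' i * B + C i * (M * B)) := by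
    intro z
    refine (Finset.abs_sum_le_sum_abs _ _).trans (Finset.sum_le_sum fun i _ => ?_)
    refine (abs_sub _ _).trans (add_le_add ?_ ?_)
    · exact norm_conv_le (hC' i) (hC0' i) fun y => h.bdd _
    · exact norm_conv_le (hC i) (hC0 i) fun y => h.abs_coord_le' (y, z.2) i
  exact ⟨⟨_, (abs_nonneg _).trans (hK (0, 0))⟩, hK⟩

/-- Summed over `i`, this says that `molRate` is the spatial divergence of `molFlux`. -/
theorem hasPartial_molFlux (hρ : IsSmooth ρ) (i : Fin d) (t : ℝ) :
    HasPartial i (fun x => molFlux m b ρ i (x, t)) ∧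
      pderiv i (fun x => molFlux m b ρ i (x, t)) = fun x =>
        conv (pderiv i (pderiv i ρ)) (fun y => m (y, t)) x -
          conv (pderiv i ρ) (fun y => b (y, t) i) x := by
  obtain ⟨h1, h2⟩ := hasPartial_conv (hρ.pderiv i) (h.integrable_m t) i
  obtain ⟨h3, h4⟩ := hasPartial_conv hρ (h.integrable_b t i) i
  rw [← h2, ← h4]
  exact h1.sub h3

theorem continuous_molFlux (hρ : IsSmooth ρ) (i : Fin d) (t : ℝ) :
    Continuous (fun x => molFlux m b ρ i (x, t)) :=
  (continuous_conv (hρ.pderiv i).continuous (h.integrable_m t)).sub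
    (continuous_conv hρ.continuous (h.integrable_b t i))

theorem continuous_pderiv_molFlux (hρ : IsSmooth ρ) (i : Fin d) (t : ℝ) :
    Continuous (pderiv i fun x => molFlux m b ρ i (x, t)) := by
  rw [(h.hasPartial_molFlux hρ i t).2]
  exact (continuous_conv ((hρ.pderiv i).pderiv i).continuous (h.integrable_m t)).sub
    (continuous_conv (hρ.pderiv i).continuous (h.integrable_b t i))

/-- This is the weak formulation with test function `y ↦ ρ (x - y)`. The reflection flips the sign
of first derivatives and leaves second derivatives unchanged, whence the minus sign in `molRate`. -/
theorem mol_sub_eq (hρ : IsSmooth ρ) (x : Torus d) {t : ℝ} (ht : t ∈ Icc 0 T) :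
    conv ρ (fun y => m (y, t)) x - conv ρ (fun y => m (y, 0)) x =
      ∫ s in (0 : ℝ)..t, molRate m b ρ (x, s) := by
  have h1 := h.weak _ (hρ.comp_const_sub x) t ht
  refine h1.trans (intervalIntegral.integral_congr fun s _ => ?_)
  have h2 : ∀ i, pderiv i (pderiv i fun y => ρ (x - y)) =
      fun y => pderiv i (pderiv i ρ) (x - y) := by
    intro i
    rw [hρ.pderiv_comp_const_sub]
    rw [pderiv_neg, (hρ.pderiv i).pderiv_comp_const_sub x i]
    simp only [neg_neg]
  simp only [h2]
  simp only [hρ.pderiv_comp_const_sub]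
  have hi1 : ∀ i, Integrable fun y => pderiv i (pderiv i ρ) (x - y) * m (y, s) := fun i =>
    (integrable_of_continuous ((((hρ.pderiv i).pderiv i).continuous.comp (by fun_prop)).mul
      (h.cont.comp (by fun_prop))))
  have hi2 : ∀ i, Integrable fun y => -pderiv i ρ (x - y) * b (y, s) i := fun i => by
    obtain ⟨C, -, hC⟩ := exists_norm_le_of_continuous (hρ.pderiv i).continuous
    refine (h.integrable_b s i).bdd_mul (c := C) ?_ (Eventually.of_forall fun y => ?_)
    · exact ((hρ.pderiv i).continuous.comp (by fun_prop)).neg.aestronglyMeasurable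
    · rw [norm_neg]
      exact hC _
  have hi : ∀ i, Integrable fun y => pderiv i (pderiv i ρ) (x - y) * m (y, s) +
      -pderiv i ρ (x - y) * b (y, s) i := fun i => (hi1 i).add (hi2 i)
  rw [integral_finsetSum _ fun i _ => hi i]
  refine Finset.sum_congr rfl fun i _ => ?_
  rw [integral_add (hi1 i) (hi2 i), sub_eq_add_neg]
  simp only [neg_mul, integral_neg]
  rfl

theorem integral_mul_molRate (hρ : IsSmooth ρ) {θ : Torus d → ℝ} (hθ : Continuous θ)
    (hθp : ∀ i, HasPartial i θ) (hθc : ∀ i, Continuous (pderiv i θ)) (t : ℝ) :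
    ∫ x, θ x * molRate m b ρ (x, t) = -∑ i, ∫ x, pderiv i θ x * molFlux m b ρ i (x, t) := by
  have h1 : ∀ x, θ x * molRate m b ρ (x, t) =
      ∑ i, θ x * pderiv i (fun x => molFlux m b ρ i (x, t)) x := fun x => by
    rw [molRate, Finset.mul_sum]
    refine Finset.sum_congr rfl fun i _ => ?_
    rw [(h.hasPartial_molFlux hρ i t).2]
  simp_rw [h1]
  have hi : ∀ i, Integrable fun x => θ x * pderiv i (fun x => molFlux m b ρ i (x, t)) x :=
    fun i => integrable_of_continuous (hθ.mul (h.continuous_pderiv_molFlux hρ i t))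
  rw [integral_finsetSum _ fun i _ => hi i, ← Finset.sum_neg_distrib]
  refine Finset.sum_congr rfl fun i _ => ?_
  exact integral_mul_pderiv (hθp i) (h.hasPartial_molFlux hρ i t).1 hθ
    (h.continuous_molFlux hρ i t) (hθc i) (h.continuous_pderiv_molFlux hρ i t)

end IsWeakFP

end FP

/-! ### Nonnegativity of weak solutions -/

/-- With exponent at least two the one-sided derivatives at 0 both vanish and can be glued. Both the
fourth power and the cube are needed: the energy density and the test function derived from it. -/
theorem hasDerivAt_min_zero_pow (n : ℕ) (s : ℝ) :
    HasDerivAt (fun s : ℝ => min s 0 ^ (n + 2)) ((n + 2 : ℕ) * min s 0 ^ (n + 1)) s := by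
  have hp : HasDerivAt (fun s : ℝ => s ^ (n + 2)) ((n + 2 : ℕ) * s ^ (n + 1)) s := by
    simpa using hasDerivAt_pow (n + 2) s
  have hl : s ≤ 0 → HasDerivWithinAt (fun s : ℝ => min s 0 ^ (n + 2))
      ((n + 2 : ℕ) * min s 0 ^ (n + 1)) (Iic 0) s := fun hs => by
    rw [min_eq_left hs]
    exact hp.hasDerivWithinAt.congr (fun r hr => by rw [min_eq_left hr]) (by rw [min_eq_left hs])
  have hr : 0 ≤ s → HasDerivWithinAt (fun s : ℝ => min s 0 ^ (n + 2))
      ((n + 2 : ℕ) * min s 0 ^ (n + 1)) (Ici 0) s := fun hs => by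
    rw [min_eq_right hs, zero_pow (by omega), mul_zero]
    exact (hasDerivWithinAt_const s (Ici 0) (0 : ℝ)).congr
      (fun r hr => by rw [min_eq_right hr, zero_pow (by omega)])
      (by rw [min_eq_right hs, zero_pow (by omega)])
  rcases lt_trichotomy s 0 with hs | rfl | hs
  · exact (hl hs.le).hasDerivAt (Iic_mem_nhds hs)
  · have := (hl le_rfl).union (hr le_rfl)
    rwa [Iic_union_Ici, hasDerivWithinAt_univ] at this
  · exact (hr hs.le).hasDerivAt (Ici_mem_nhds hs)

/-- Completing the square: the diffusion term in `x`, a derivative of the mollified density, absorbs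
its product with the drift flux `y`. -/
theorem neg_mul_sub_le_sq (c x y : ℝ) (hc : 0 ≤ c) : -(c * x * (x - y)) ≤ c * (y ^ 2 / 4) := by
  nlinarith [mul_nonneg hc (sq_nonneg (x - y / 2))]

/-- Here `r` is the negative part of the mollified density and `2η` the mollification error. The
mixed term is split by `24 r² η² ≤ 12 r⁴ + 12 η⁴`, which gives 6 + 12 = 18. -/
theorem flux_term_le {r y M η : ℝ} (hy : |y| ≤ M * (-r + 2 * η)) :
    12 * r ^ 2 * (y ^ 2 / 4) ≤ 18 * M ^ 2 * (r ^ 4 + η ^ 4) := by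
  have h1 : y ^ 2 ≤ (M * (-r + 2 * η)) ^ 2 := by
    rw [← sq_abs y]
    exact pow_le_pow_left₀ (abs_nonneg y) hy 2
  have h2 : (-r + 2 * η) ^ 2 ≤ 2 * r ^ 2 + 8 * η ^ 2 := by nlinarith [sq_nonneg (r + 2 * η)]
  have h3 : y ^ 2 ≤ M ^ 2 * (2 * r ^ 2 + 8 * η ^ 2) := by
    rw [mul_pow] at h1
    exact h1.trans (mul_le_mul_of_nonneg_left h2 (sq_nonneg M))
  have h4 : 3 * r ^ 2 * y ^ 2 ≤ 3 * r ^ 2 * (M ^ 2 * (2 * r ^ 2 + 8 * η ^ 2)) :=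
    mul_le_mul_of_nonneg_left h3 (by positivity)
  have h5 : 0 ≤ 12 * M ^ 2 * (r ^ 2 - η ^ 2) ^ 2 := by positivity
  have h6 : 0 ≤ M ^ 2 * η ^ 4 := by positivity
  nlinarith

/-- Integral form of Grönwall's inequality with a constant source. -/
theorem le_of_le_integral {e : ℝ → ℝ} (he : Continuous e) {T K δ : ℝ} (hK : 0 < K)
    (h : ∀ t ∈ Icc 0 T, e t ≤ ∫ s in (0 : ℝ)..t, K * (e s + δ)) {t : ℝ} (ht : t ∈ Icc 0 T) :
    e t ≤ δ * (Real.exp (K * t) - 1) := by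
  -- The differential form of Grönwall is applied to this integral, which is differentiable while
  -- `e` is only continuous.
  set I : ℝ → ℝ := fun t => ∫ s in (0 : ℝ)..t, K * (e s + δ) with hI
  have hd : ∀ t, HasDerivAt I (K * (e t + δ)) t := fun t =>
    ((continuous_const.mul (he.add continuous_const)).integral_hasStrictDerivAt 0 t).hasDerivAt
  have h1 := le_gronwallBound_of_liminf_deriv_right_le (f := I) (f' := fun t => K * (e t + δ))
    (δ := 0) (K := K) (ε := K * δ) (a := 0) (b := T)
    (fun t _ => (hd t).continuousAt.continuousWithinAt)
    (fun t _ r hr => (hd t).hasDerivWithinAt.liminf_right_slope_le hr)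
    (by simp [hI]) (fun t ht => by
      have := mul_le_mul_of_nonneg_left (h t (Ico_subset_Icc_self ht)) hK.le
      rw [mul_add]
      linarith) t ht
  refine (h t ht).trans (h1.trans (le_of_eq ?_))
  rw [gronwallBound_of_K_ne_0 hK.ne']
  simp only [zero_mul, zero_add, sub_zero]
  field_simp

namespace IsWeakFP

variable {d : ℕ} {T M B : ℝ} {m : Torus d × ℝ → ℝ} {b : Torus d × ℝ → E d}
  (h : IsWeakFP T M B m b) {ρ : Torus d → ℝ}

include h

/-- The energy identity for the fourth power of the negative part of the mollified density. -/
theorem energy_le (hρ : IsSmooth ρ) (hρ0 : ∀ x, 0 ≤ ρ x) (hρ1 : ∫ x, ρ x = 1) {ε η : ℝ}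
    (hρε : ∀ x, ρ x ≠ 0 → ‖x‖ < ε)
    (hmod : ∀ t ∈ Icc 0 T, ∀ x y, dist x y < ε → |m (y, t) - m (x, t)| ≤ η)
    (h0 : ∀ x, 0 ≤ m (x, 0)) {t : ℝ} (ht : t ∈ Icc 0 T) :
    ∫ x, min (conv ρ (fun y => m (y, t)) x) 0 ^ 4 ≤
      ∫ s in (0 : ℝ)..t, (18 * d * M ^ 2 + 1) *
        ((∫ x, min (conv ρ (fun y => m (y, s)) x) 0 ^ 4) + η ^ 4) := by
  set mρ : Torus d × ℝ → ℝ := fun z => conv ρ (fun y => m (y, z.2)) z.1 with hmρ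
  have hmc : Continuous mρ := continuous_conv_slice hρ.continuous h.cont
  -- The fourth power rather than the square, so that the derivative `4 min(s,0)³`, used as a test
  -- function in `x`, is itself continuously differentiable.
  have hβ : ∀ s, HasDerivAt (fun s : ℝ => min s 0 ^ 4) (4 * min s 0 ^ 3) s := fun s => by
    simpa using hasDerivAt_min_zero_pow 2 s
  have hβ' : ∀ s, HasDerivAt (fun s : ℝ => 4 * min s 0 ^ 3) (4 * (3 * min s 0 ^ 2)) s :=
    fun s => by simpa using (hasDerivAt_min_zero_pow 1 s).const_mul 4
  obtain ⟨K, hK⟩ := h.exists_molRate_bound hρ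
  have hkm := h.measurable_molRate hρ
  -- Averages of a nonnegative initial density are nonnegative, so the energy starts from zero.
  have hstart : ∀ x, min (mρ (x, 0)) 0 ^ 4 = 0 := fun x => by
    have : 0 ≤ mρ (x, 0) := integral_nonneg fun y => mul_nonneg (hρ0 _) (h0 _)
    rw [min_eq_right this, zero_pow (by norm_num)]
  have hchain : ∀ x, min (mρ (x, t)) 0 ^ 4 =
      ∫ s in (0 : ℝ)..t, 4 * min (mρ (x, s)) 0 ^ 3 * molRate m b ρ (x, s) := by
    intro x
    have := comp_sub_eq_integral (k := fun s => molRate m b ρ (x, s)) (M := K)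
      (fun s => hK (x, s)) (hkm.comp (by fun_prop)) (y := fun s => mρ (x, s)) (T := T)
      (fun s hs => h.mol_sub_eq hρ x hs) hβ (by fun_prop) ht
    rw [hstart, sub_zero] at this
    exact this
  obtain ⟨C, hC0, hC⟩ := exists_bound_cyl (F := fun z => 4 * min (mρ z) 0 ^ 3)
    (by fun_prop) T
  have hFm : Measurable fun z => 4 * min (mρ z) 0 ^ 3 * molRate m b ρ z :=
    (Continuous.measurable (f := fun z => 4 * min (mρ z) 0 ^ 3) (by fun_prop)).mul hkm
  have hFb : ∀ x, ∀ s ∈ Icc 0 T, |4 * min (mρ (x, s)) 0 ^ 3 * molRate m b ρ (x, s)| ≤ C * K :=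
    fun x s hs => by
      rw [abs_mul]
      exact mul_le_mul (hC x s hs) (hK _) (abs_nonneg _) hC0
  have hec : Continuous fun s => ∫ x, min (mρ (x, s)) 0 ^ 4 :=
    continuous_integral_slice (F := fun z => min (mρ z) 0 ^ 4) (by fun_prop)
  calc ∫ x, min (mρ (x, t)) 0 ^ 4
      = ∫ s in (0 : ℝ)..t, ∫ x, 4 * min (mρ (x, s)) 0 ^ 3 * molRate m b ρ (x, s) := by
        rw [← integral_swap_of_bound hFm hFb ht]
        exact integral_congr_ae (Eventually.of_forall hchain)
    _ ≤ _ := by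
        refine intervalIntegral.integral_mono_on ht.1 (intervalIntegrable_slice hFm hFb ht)
          ((continuous_const.mul (hec.add continuous_const)).intervalIntegrable _ _)
          fun s hs => ?_
        have hsT : s ∈ Icc 0 T := ⟨hs.1, hs.2.trans ht.2⟩
        have hms : Continuous fun x => mρ (x, s) := by fun_prop
        have hconv := fun i => hasPartial_conv hρ (h.integrable_m s) i
        have hθ := fun i => (hconv i).1.comp hβ'
        have hmi : ∀ i, Continuous (conv (pderiv i ρ) fun y => m (y, s)) := fun i =>
          continuous_conv (hρ.pderiv i).continuous (h.integrable_m s)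
        have hθc : ∀ i, Continuous (pderiv i fun x => 4 * min (mρ (x, s)) 0 ^ 3) := fun i => by
          rw [(hθ i).2, (hconv i).2]
          exact (Continuous.comp (g := fun r : ℝ => 4 * (3 * min r 0 ^ 2)) (by fun_prop) hms).mul
            (hmi i)
        rw [h.integral_mul_molRate hρ (θ := fun x => 4 * min (mρ (x, s)) 0 ^ 3) (by fun_prop)
          (fun i => (hθ i).1) hθc s, ← Finset.sum_neg_distrib]
        have hes : Integrable fun x => min (mρ (x, s)) 0 ^ 4 :=
          integrable_of_continuous (by fun_prop)
        have hterm : ∀ i : Fin d, -∫ x, pderiv i (fun x => 4 * min (mρ (x, s)) 0 ^ 3) x *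
            molFlux m b ρ i (x, s) ≤
            18 * M ^ 2 * ((∫ x, min (mρ (x, s)) 0 ^ 4) + η ^ 4) := by
          intro i
          rw [← integral_neg]
          have hright : 18 * M ^ 2 * ((∫ x, min (mρ (x, s)) 0 ^ 4) + η ^ 4) =
              ∫ x, 18 * M ^ 2 * (min (mρ (x, s)) 0 ^ 4 + η ^ 4) := by
            rw [integral_const_mul, integral_add hes (integrable_const _)]
            simp
          rw [hright]
          refine integral_mono (integrable_of_continuous
            ((hθc i).mul (h.continuous_molFlux hρ i s))).neg
            ((hes.add (integrable_const _)).const_mul _) fun x => ?_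
          have hpt : pderiv i (fun x => 4 * min (mρ (x, s)) 0 ^ 3) x =
              12 * min (mρ (x, s)) 0 ^ 2 * conv (pderiv i ρ) (fun y => m (y, s)) x := by
            rw [(hθ i).2, (hconv i).2]
            ring
          simp only [hpt, molFlux]
          refine (neg_mul_sub_le_sq _ _ _ (by positivity)).trans ?_
          -- Where the mollified density is nonnegative the weight `r²` vanishes; only points of
          -- negativity require a bound on the flux.
          by_cases hneg : 0 ≤ mρ (x, s)
          · rw [min_eq_right hneg]
            have : 0 ≤ 18 * M ^ 2 * ((0 : ℝ) ^ 4 + η ^ 4) := by positivity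
            simpa using this
          · push Not at hneg
            rw [min_eq_left hneg.le]
            refine flux_term_le ?_
            have hbnd : |conv ρ (fun y => b (y, s) i) x| ≤
                M * conv ρ (fun y => |m (y, s)|) x := by
              rw [conv, conv, ← integral_const_mul, ← Real.norm_eq_abs]
              refine norm_integral_le_of_norm_le (integrable_of_continuous ?_)
                (Eventually.of_forall fun y => ?_)
              · exact continuous_const.mul ((hρ.continuous.comp (by fun_prop)).mul
                  (h.cont.comp (by fun_prop)).abs)
              · rw [norm_mul, Real.norm_eq_abs, Real.norm_eq_abs, abs_of_nonneg (hρ0 _),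
                  mul_left_comm]
                exact mul_le_mul_of_nonneg_left (h.abs_coord_le (y, s) i) (hρ0 _)
            -- The mollified flux is at most `M` times the average of `|m|`. One η is lost in
            -- replacing that average by `|m (x, s)|`, another in replacing `|m (x, s)|` by minus
            -- the negative mollified value.
            have h1 := abs_conv_sub_le (x := x) (c := |m (x, s)|) hρ.continuous hρ0 hρ1 hρε
              (h.integrable_m s).abs fun y hy =>
                (abs_abs_sub_abs_le_abs_sub _ _).trans (hmod s hsT x y hy)
            have h2 := abs_conv_sub_le (x := x) (c := m (x, s)) hρ.continuous hρ0 hρ1 hρε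
              (h.integrable_m s) fun y hy => hmod s hsT x y hy
            have h3 := (abs_le.1 h1).2
            have h4 := abs_le.1 h2
            have h5 : |m (x, s)| ≤ -mρ (x, s) + η := by
              rw [abs_le]
              constructor <;> simp only [hmρ] at hneg ⊢ <;> linarith
            exact hbnd.trans (mul_le_mul_of_nonneg_left (by linarith) h.M_nonneg)
        refine (Finset.sum_le_sum fun i _ => hterm i).trans ?_
        rw [Finset.sum_const, Finset.card_univ, Fintype.card_fin, nsmul_eq_mul]
        have h6 : 0 ≤ (∫ x, min (mρ (x, s)) 0 ^ 4) + η ^ 4 :=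
          add_nonneg (integral_nonneg fun x => by positivity) (by positivity)
        simp only [hmρ] at h6 ⊢
        nlinarith

/-- A weak solution with nonnegative initial density is nonnegative. -/
theorem nonneg (h0 : ∀ x, 0 ≤ m (x, 0)) {t : ℝ} (ht : t ∈ Icc 0 T) (x : Torus d) :
    0 ≤ m (x, t) := by
  set K : ℝ := 18 * d * M ^ 2 + 1 with hK
  -- The summand 1 in `K` makes it positive even when `M = 0`, as `le_of_le_integral` requires.
  have hK0 : 0 < K := by positivity
  have hmt : Continuous fun x => min (m (x, t)) 0 ^ 4 :=
    ((h.cont.comp (by fun_prop)).min continuous_const).pow 4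
  -- Grönwall bounds the mollified energy by `η⁴ (exp (K t) - 1)`. Removing the mollification costs
  -- `(r + η)⁴ ≤ 8 (r⁴ + η⁴)`, and the two contributions add up to the right-hand side.
  have key : ∀ η > 0, ∫ x, min (m (x, t)) 0 ^ 4 ≤ η ^ 4 * (8 * Real.exp (K * t)) := by
    intro η hη
    obtain ⟨ε, hε, hmod⟩ := exists_modulus_cyl h.cont T hη
    obtain ⟨ρ, hρ, hρ0, hρ1, hρε⟩ := exists_mollifier d hε
    have hmc := continuous_conv_slice hρ.continuous h.cont
    have hgr := le_of_le_integral
      (e := fun t => ∫ x, min (conv ρ (fun y => m (y, t)) x) 0 ^ 4) (δ := η ^ 4)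
      (continuous_integral_slice (F := fun z => min (conv ρ (fun y => m (y, z.2)) z.1) 0 ^ 4)
        (by fun_prop)) hK0
      (fun s hs => h.energy_le hρ hρ0 hρ1 hρε hmod h0 hs) ht
    have hct : Continuous (conv ρ fun y => m (y, t)) :=
      continuous_conv hρ.continuous (h.integrable_m t)
    have hle : ∫ x, min (m (x, t)) 0 ^ 4 ≤
        ∫ x, 8 * (min (conv ρ (fun y => m (y, t)) x) 0 ^ 4 + η ^ 4) := by
      refine integral_mono (integrable_of_continuous hmt)
        (integrable_of_continuous (by fun_prop)) fun x => ?_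
      have h2 := abs_conv_sub_le (x := x) (c := m (x, t)) hρ.continuous hρ0 hρ1 hρε
        (h.integrable_m t) fun y hy => hmod t ht x y hy
      set p := min (m (x, t)) 0 with hp
      set r := min (conv ρ (fun y => m (y, t)) x) 0 with hr
      have h3 : |p - r| ≤ η := by
        refine (abs_min_sub_min_le_max _ _ _ _).trans ?_
        rw [sub_self, abs_zero, max_eq_left (abs_nonneg _), abs_sub_comm]
        exact h2
      have h4 : |p| ≤ |r| + η := by
        have := abs_sub_abs_le_abs_sub p r
        linarith
      have h5 : p ^ 4 ≤ (|r| + η) ^ 4 := by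
        rw [← (show Even 4 by decide).pow_abs p]
        exact pow_le_pow_left₀ (abs_nonneg p) h4 4
      have h6 := add_pow_le (abs_nonneg r) hη.le 4
      rw [(show Even 4 by decide).pow_abs r] at h6
      norm_num at h6
      exact h5.trans h6
    rw [integral_const_mul, integral_add (integrable_of_continuous (by fun_prop))
      (integrable_const _)] at hle
    simp only [integral_const, probReal_univ, smul_eq_mul, one_mul] at hle
    linarith
  have hz : ∫ x, min (m (x, t)) 0 ^ 4 ≤ 0 := by
    have hlim : Tendsto (fun η : ℝ => η ^ 4 * (8 * Real.exp (K * t))) (𝓝[>] 0) (𝓝 0) := by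
      have : Continuous fun η : ℝ => η ^ 4 * (8 * Real.exp (K * t)) := by fun_prop
      have h1 := (this.tendsto 0).mono_left (nhdsWithin_le_nhds (s := Ioi 0))
      simpa using h1
    exact ge_of_tendsto hlim (eventually_mem_nhdsWithin.mono fun η hη => key η hη)
  -- A continuous nonnegative function with zero integral vanishes everywhere, which upgrades the
  -- conclusion to every point.
  by_contra! hx
  have hpos : 0 < ∫ x, min (m (x, t)) 0 ^ 4 := by
    refine Continuous.integral_pos_of_hasCompactSupport_nonneg_nonzero (x := x) hmt
      (HasCompactSupport.of_compactSpace _) (fun x => by positivity) ?_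
    rw [min_eq_left hx.le]
    exact pow_ne_zero 4 hx.ne
  exact absurd hz (not_le.2 hpos)

end IsWeakFP

/-! ### Duality between weak solutions and classical functions -/

section Dual

variable {d : ℕ}

/-- `u` is of class `C^{2,1}` in the space-time cylinder, with time derivative `ut`. -/
structure IsC21 (T : ℝ) (u ut : Torus d × ℝ → ℝ) : Prop where
  cont : Continuous u
  cont_t : Continuous ut
  diff : ∀ x, DifferentiableOn ℝ (fun s => u (x, s)) (Icc 0 T)
  deriv_eq : ∀ x, ∀ t ∈ Icc 0 T, derivWithin (fun s => u (x, s)) (Icc 0 T) t = ut (x, t)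
  part : ∀ i t, HasPartial i fun x => u (x, t)
  part2 : ∀ i t, HasPartial i fun x => dx i u (x, t)
  cont_x : ∀ i, Continuous (dx i u)
  cont_xx : ∀ i, Continuous (dx i (dx i u))

namespace IsWeakFP

variable {T M B : ℝ} {m : Torus d × ℝ → ℝ} {b : Torus d × ℝ → E d}
  (h : IsWeakFP T M B m b) {ρ : Torus d → ℝ}

include h

theorem integrable_dual (hρ : Continuous ρ) {u ut : Torus d × ℝ → ℝ} (hu : IsC21 T u ut)
    (t : ℝ) (i : Fin d) :
    Integrable fun x => dx i u (x, t) * conv ρ (fun y => b (y, t) i) x :=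
  integrable_of_continuous (((hu.cont_x i).comp (by fun_prop)).mul
    (continuous_conv hρ (h.integrable_b t i)))

/-- Two integrations by parts move the divergence and then the gradient of the diffusive flux onto
`u`, after which no derivative of the mollified density remains and the limit can be taken. -/
theorem integral_mul_molRate_eq (hρ : IsSmooth ρ) {u ut : Torus d × ℝ → ℝ} (hu : IsC21 T u ut)
    (t : ℝ) :
    ∫ x, (ut (x, t) * conv ρ (fun y => m (y, t)) x + u (x, t) * molRate m b ρ (x, t)) =
      ∫ x, ((ut (x, t) + lapx u (x, t)) * conv ρ (fun y => m (y, t)) x +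
        ∑ i, dx i u (x, t) * conv ρ (fun y => b (y, t) i) x) := by
  have hmc : Continuous (conv ρ fun y => m (y, t)) :=
    continuous_conv hρ.continuous (h.integrable_m t)
  have hux := fun i => (hu.cont_x i).comp (Continuous.prodMk_left t)
  have huxx := fun i => (hu.cont_xx i).comp (Continuous.prodMk_left t)
  have hut := hu.cont_t.comp (Continuous.prodMk_left t)
  have huc : Continuous fun x => u (x, t) := hu.cont.comp (Continuous.prodMk_left t)
  have h1 : Integrable fun x => ut (x, t) * conv ρ (fun y => m (y, t)) x :=
    integrable_of_continuous (hut.mul hmc)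
  obtain ⟨K, hK⟩ := h.exists_molRate_bound hρ
  have h2 : Integrable fun x => u (x, t) * molRate m b ρ (x, t) :=
    Integrable.mul_bdd (c := K) (integrable_of_continuous huc)
      ((h.measurable_molRate hρ).comp (by fun_prop)).aestronglyMeasurable
      (Eventually.of_forall fun x => hK _)
  have h3 : ∀ i, Integrable fun x => dx i (dx i u) (x, t) * conv ρ (fun y => m (y, t)) x :=
    fun i => integrable_of_continuous ((huxx i).mul hmc)
  have h4 := h.integrable_dual hρ.continuous hu t
  have h5 : ∀ i, -∫ x, pderiv i (fun x => u (x, t)) x * molFlux m b ρ i (x, t) =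
      ∫ x, (dx i (dx i u) (x, t) * conv ρ (fun y => m (y, t)) x +
        dx i u (x, t) * conv ρ (fun y => b (y, t) i) x) := by
    intro i
    obtain ⟨hp1, hp2⟩ := hasPartial_conv hρ (h.integrable_m t) i
    have h6 := integral_mul_pderiv (hu.part2 i t) hp1 (hux i) hmc (huxx i)
      (hp2 ▸ continuous_conv (hρ.pderiv i).continuous (h.integrable_m t))
    have h7 : Integrable fun x => dx i u (x, t) *
        conv (pderiv i ρ) (fun y => m (y, t)) x :=
      integrable_of_continuous ((hux i).mul
        (continuous_conv (hρ.pderiv i).continuous (h.integrable_m t)))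
    rw [integral_add (h3 i) (h4 i)]
    have h8 : ∫ x, pderiv i (fun x => u (x, t)) x * molFlux m b ρ i (x, t) =
        (∫ x, dx i u (x, t) * conv (pderiv i ρ) (fun y => m (y, t)) x) -
          ∫ x, dx i u (x, t) * conv ρ (fun y => b (y, t) i) x := by
      rw [← integral_sub h7 (h4 i)]
      refine integral_congr_ae (Eventually.of_forall fun x => ?_)
      simp only [molFlux, mul_sub]
      rfl
    rw [h8]
    rw [hp2] at h6
    have h9 : ∫ x, pderiv i (fun x => dx i u (x, t)) x * conv ρ (fun y => m (y, t)) x =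
      ∫ x, dx i (dx i u) (x, t) * conv ρ (fun y => m (y, t)) x := rfl
    linarith
  have h34 : ∀ i, Integrable fun x => dx i (dx i u) (x, t) * conv ρ (fun y => m (y, t)) x +
        dx i u (x, t) * conv ρ (fun y => b (y, t) i) x := fun i => (h3 i).add (h4 i)
  rw [integral_add h1 h2, h.integral_mul_molRate hρ huc (fun i => hu.part i t) hux t,
    ← Finset.sum_neg_distrib, Finset.sum_congr rfl fun i _ => h5 i,
    ← integral_finsetSum _ fun i _ => h34 i, ← integral_add h1 (integrable_finsetSum _ fun i _ =>
      h34 i)]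
  refine integral_congr_ae (Eventually.of_forall fun x => ?_)
  simp only [lapx, Finset.sum_add_distrib, add_mul, Finset.sum_mul]
  ring

/-- The duality identity for the mollified equation. -/
theorem dual_mollified (hρ : IsSmooth ρ) {u ut : Torus d × ℝ → ℝ} (hu : IsC21 T u ut) :
    (∫ x, u (x, T) * conv ρ (fun y => m (y, T)) x) -
      ∫ x, u (x, 0) * conv ρ (fun y => m (y, 0)) x =
      ∫ t in (0 : ℝ)..T, ∫ x, ((ut (x, t) + lapx u (x, t)) * conv ρ (fun y => m (y, t)) x +
        ∑ i, dx i u (x, t) * conv ρ (fun y => b (y, t) i) x) := by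
  have hT : T ∈ Icc 0 T := ⟨h.T_pos.le, le_rfl⟩
  obtain ⟨K, hK⟩ := h.exists_molRate_bound hρ
  have hkm := h.measurable_molRate hρ
  have hmc := continuous_conv_slice hρ.continuous h.cont
  have hprod : ∀ x, u (x, T) * conv ρ (fun y => m (y, T)) x -
      u (x, 0) * conv ρ (fun y => m (y, 0)) x =
      ∫ t in (0 : ℝ)..T, (ut (x, t) * conv ρ (fun y => m (y, t)) x +
        u (x, t) * molRate m b ρ (x, t)) := by
    intro x
    have hcd : ContinuousOn (derivWithin (fun s => u (x, s)) (Icc 0 T)) (Icc 0 T) :=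
      ContinuousOn.congr (f := fun t => ut (x, t)) (hu.cont_t.comp (by fun_prop)).continuousOn
        fun t ht => hu.deriv_eq x t ht
    rw [mul_sub_eq_integral (k := fun s => molRate m b ρ (x, s)) (M := K) (fun s => hK (x, s))
      (hkm.comp (by fun_prop)) (y := fun s => conv ρ (fun y => m (y, s)) x) h.T_pos
      (fun s hs => h.mol_sub_eq hρ x hs) (hu.diff x) hcd]
    refine intervalIntegral.integral_congr fun t ht => ?_
    rw [uIcc_of_le h.T_pos.le] at ht
    simp only [hu.deriv_eq x t ht]
  obtain ⟨C₁, hC₁0, hC₁⟩ := exists_bound_cyl (hu.cont_t.mul hmc) T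
  obtain ⟨C₂, hC₂0, hC₂⟩ := exists_bound_cyl hu.cont T
  have hi : ∀ t, Integrable fun x => u (x, t) * conv ρ (fun y => m (y, t)) x := fun t =>
    integrable_of_continuous ((hu.cont.comp (Continuous.prodMk_left t)).mul
      (continuous_conv hρ.continuous (h.integrable_m t)))
  rw [← integral_sub (hi T) (hi 0), integral_congr_ae (Eventually.of_forall hprod),
    integral_swap_of_bound (F := fun z => ut z * conv ρ (fun y => m (y, z.2)) z.1 +
      u z * molRate m b ρ z) (C := C₁ + C₂ * K) _ _ hT]
  · exact intervalIntegral.integral_congr fun t _ => h.integral_mul_molRate_eq hρ hu t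
  · exact (hu.cont_t.mul hmc).measurable.add (hu.cont.measurable.mul hkm)
  · intro x s hs
    refine (abs_add_le _ _).trans (add_le_add (hC₁ x s hs) ?_)
    rw [abs_mul]
    exact mul_le_mul (hC₂ x s hs) (hK _) (abs_nonneg _) hC₂0

/-- Testing a weak solution against a function of class `C^{2,1}`. -/
theorem dual {u ut : Torus d × ℝ → ℝ} (hu : IsC21 T u ut) :
    (∫ x, u (x, T) * m (x, T)) - ∫ x, u (x, 0) * m (x, 0) =
      ∫ t in (0 : ℝ)..T, ∫ x, ((ut (x, t) + lapx u (x, t)) * m (x, t) +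
        ∑ i, dx i u (x, t) * b (x, t) i) := by
  have hT : T ∈ Icc 0 T := ⟨h.T_pos.le, le_rfl⟩
  have h0 : (0 : ℝ) ∈ Icc 0 T := ⟨le_rfl, h.T_pos.le⟩
  have hwc : Continuous fun z => ut z + lapx u z :=
    hu.cont_t.add (continuous_finsetSum _ fun i _ => hu.cont_xx i)
  obtain ⟨C₁, hC₁0, hC₁⟩ := exists_bound_cyl hwc T
  obtain ⟨C₂, hC₂0, hC₂⟩ := exists_bound_cyl hu.cont T
  choose C₃ hC₃0 hC₃ using fun i => exists_bound_cyl (hu.cont_x i) T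
  have hB := h.B_nonneg
  have hMB : 0 ≤ M * B := mul_nonneg h.M_nonneg hB
  set S : ℝ := (∫ x, u (x, T) * m (x, T)) - ∫ x, u (x, 0) * m (x, 0)
  set R : ℝ → ℝ := fun t => ∫ x, ((ut (x, t) + lapx u (x, t)) * m (x, t) +
        ∑ i, dx i u (x, t) * b (x, t) i) with hR
  have hRi : IntervalIntegrable R volume 0 T := by
    refine intervalIntegrable_slice (F := fun z => (ut z + lapx u z) * m z +
      ∑ i, dx i u z * b z i) (C := C₁ * B + ∑ i, C₃ i * (M * B)) ?_ (fun x s hs => ?_) hT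
    · exact (hwc.mul h.cont).measurable.add (Finset.measurable_sum _ fun i _ =>
        (hu.cont_x i).measurable.mul (h.measurable_coord i))
    · refine (abs_add_le _ _).trans (add_le_add ?_ ((Finset.abs_sum_le_sum_abs _ _).trans
        (Finset.sum_le_sum fun i _ => ?_)))
      · rw [abs_mul]
        exact mul_le_mul (hC₁ x s hs) (h.bdd _) (abs_nonneg _) hC₁0
      · rw [abs_mul]
        exact mul_le_mul (hC₃ i x s hs) (h.abs_coord_le' _ i) (abs_nonneg _) (hC₃0 i)
  -- The total error is linear in η: `2 C₂` comes from the two endpoint integrals, `C₁` from the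
  -- density term and `M B` per coordinate from the flux term, the last two integrated over time.
  have key : ∀ η > 0, |S - ∫ t in (0 : ℝ)..T, R t| ≤
      η * (2 * C₂ + (C₁ + ∑ _i : Fin d, M * B) * T) := by
    intro η hη
    obtain ⟨ε₀, hε₀, hmod⟩ := exists_modulus_cyl h.cont T hη
    choose ε' hε' hmod' using fun i => exists_modulus_cyl (hu.cont_x i) T hη
    -- One radius serves the moduli of continuity of `m` and of the finitely many derivatives of
    -- `u`.
    obtain ⟨ε, hε, hεm, hεi⟩ : ∃ ε > 0, ε ≤ ε₀ ∧ ∀ i, ε ≤ ε' i := by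
      have hev : ∀ᶠ ε in 𝓝[>] (0 : ℝ), 0 < ε ∧ ε ≤ ε₀ ∧ ∀ i, ε ≤ ε' i := by
        refine eventually_mem_nhdsWithin.and (nhdsWithin_le_nhds ?_)
        exact Eventually.and (Iic_mem_nhds hε₀) (eventually_all.2 fun i => Iic_mem_nhds (hε' i))
      exact hev.exists
    obtain ⟨ρ, hρ, hρ0, hρ1, hρε⟩ := exists_mollifier d hε
    have happ : ∀ t ∈ Icc 0 T, ∀ x, |conv ρ (fun y => m (y, t)) x - m (x, t)| ≤ η :=
      fun t ht x => abs_conv_sub_le hρ.continuous hρ0 hρ1 hρε (h.integrable_m t)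
        fun y hy => hmod t ht x y (hy.trans_le hεm)
    have happ' : ∀ i, ∀ t ∈ Icc 0 T, ∀ x,
        |conv (fun z => ρ (-z)) (fun y => dx i u (y, t)) x - dx i u (x, t)| ≤ η := by
      intro i t ht x
      refine abs_conv_sub_le (ε := ε) (hρ.continuous.comp continuous_neg) (fun x => hρ0 _)
        (by rw [integral_neg_eq_self, hρ1]) (fun x hx => by simpa using hρε _ hx)
        (integrable_of_continuous ((hu.cont_x i).comp (Continuous.prodMk_left t)))
        fun y hy => hmod' i t ht x y (hy.trans_le (hεi i))
    have hdual := h.dual_mollified hρ hu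
    set Rρ : ℝ → ℝ := fun t => ∫ x, ((ut (x, t) + lapx u (x, t)) * conv ρ (fun y => m (y, t)) x +
        ∑ i, dx i u (x, t) * conv ρ (fun y => b (y, t) i) x) with hRρ
    have hbd : ∀ t ∈ Icc 0 T, |∫ x, u (x, t) * (conv ρ (fun y => m (y, t)) x - m (x, t))| ≤
        C₂ * η := fun t ht => abs_integral_slice_le fun x => by
      rw [abs_mul]
      exact mul_le_mul (hC₂ x t ht) (happ t ht x) (abs_nonneg _) hC₂0
    have hmi : ∀ t, Continuous (conv ρ fun y => m (y, t)) := fun t =>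
      continuous_conv hρ.continuous (h.integrable_m t)
    have hmt : ∀ t, Continuous fun x => m (x, t) := fun t => h.cont.comp (by fun_prop)
    have hut : ∀ t, Continuous fun x => u (x, t) := fun t => hu.cont.comp (by fun_prop)
    have hsplit : ∀ t, ∫ x, u (x, t) * (conv ρ (fun y => m (y, t)) x - m (x, t)) =
        (∫ x, u (x, t) * conv ρ (fun y => m (y, t)) x) - ∫ x, u (x, t) * m (x, t) := fun t => by
      simp_rw [mul_sub]
      exact integral_sub (integrable_of_continuous ((hut t).mul (hmi t)))
        (integrable_of_continuous ((hut t).mul (hmt t)))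
    have hRbd : ∀ t ∈ Icc 0 T, |Rρ t - R t| ≤ (C₁ + ∑ _i : Fin d, M * B) * η := by
      intro t ht
      have hwt : Continuous fun x => ut (x, t) + lapx u (x, t) := hwc.comp (by fun_prop)
      have hb1 := h.integrable_dual hρ.continuous hu t
      have hb2 : ∀ i, Integrable fun x => dx i u (x, t) * b (x, t) i := fun i =>
        Integrable.bdd_mul (c := C₃ i) (h.integrable_b t i)
          ((hu.cont_x i).comp (Continuous.prodMk_left t)).aestronglyMeasurable
          (Eventually.of_forall fun x => hC₃ i x t ht)
      -- The flux is merely measurable, so its mollification need not be uniformly close to it. The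
      -- reflected kernel is moved onto the continuous factor `dx i u`, where uniform closeness does
      -- hold.
      have hd1 : ∀ i, (∫ x, dx i u (x, t) * conv ρ (fun y => b (y, t) i) x) -
          ∫ x, dx i u (x, t) * b (x, t) i = ∫ x, b (x, t) i *
            (conv (fun z => ρ (-z)) (fun y => dx i u (y, t)) x - dx i u (x, t)) := by
        intro i
        have hcu : Continuous fun x => dx i u (x, t) :=
          (hu.cont_x i).comp (Continuous.prodMk_left t)
        have hci : Continuous (conv (fun z => ρ (-z)) (fun y => dx i u (y, t))) :=
          continuous_conv (hρ.continuous.comp continuous_neg) (integrable_of_continuous hcu)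
        obtain ⟨K, -, hK⟩ := exists_norm_le_of_continuous hci
        rw [integral_mul_conv hρ.continuous hcu (h.integrable_b t i),
          ← integral_sub ((h.integrable_b t i).mul_bdd (c := K) hci.aestronglyMeasurable
            (Eventually.of_forall hK)) (hb2 i)]
        refine integral_congr_ae (Eventually.of_forall fun x => ?_)
        simp only
        rw [mul_sub, mul_comm (dx i u (x, t))]
      have hd2 : Rρ t - R t = (∫ x, (ut (x, t) + lapx u (x, t)) *
          (conv ρ (fun y => m (y, t)) x - m (x, t))) + ∑ i, ∫ x, b (x, t) i *
            (conv (fun z => ρ (-z)) (fun y => dx i u (y, t)) x - dx i u (x, t)) := by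
        have hw1 : Integrable fun x => (ut (x, t) + lapx u (x, t)) *
          conv ρ (fun y => m (y, t)) x := integrable_of_continuous (hwt.mul (hmi t))
        have hw2 : Integrable fun x => (ut (x, t) + lapx u (x, t)) * m (x, t) :=
          integrable_of_continuous (hwt.mul (hmt t))
        simp only [hRρ, hR]
        rw [integral_add hw1 (integrable_finsetSum _ fun i _ => hb1 i),
          integral_add hw2 (integrable_finsetSum _ fun i _ => hb2 i),
          integral_finsetSum _ fun i _ => hb1 i, integral_finsetSum _ fun i _ => hb2 i,
          ← Finset.sum_congr rfl fun i _ => hd1 i, Finset.sum_sub_distrib]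
        simp_rw [mul_sub]
        rw [integral_sub hw1 hw2]
        ring
      rw [hd2, add_mul, Finset.sum_mul]
      refine (abs_add_le _ _).trans (add_le_add (abs_integral_slice_le fun x => ?_)
        ((Finset.abs_sum_le_sum_abs _ _).trans (Finset.sum_le_sum fun i _ =>
          abs_integral_slice_le fun x => ?_)))
      · rw [abs_mul]
        exact mul_le_mul (hC₁ x t ht) (happ t ht x) (abs_nonneg _) hC₁0
      · rw [abs_mul]
        exact mul_le_mul (h.abs_coord_le' _ i) (happ' i t ht x) (abs_nonneg _) hMB
    have hRρi : IntervalIntegrable Rρ volume 0 T := by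
      refine intervalIntegrable_of_bound (T := T) (C := |(C₁ + ∑ _i : Fin d, M * B) * η| +
        (C₁ * B + ∑ i, C₃ i * (M * B))) ?_ (fun s hs => ?_) hT
      · exact measurable_integral_slice (F := fun z => (ut z + lapx u z) *
          conv ρ (fun y => m (y, z.2)) z.1 + ∑ i, dx i u z * conv ρ (fun y => b (y, z.2) i) z.1)
          ((hwc.measurable.mul (measurable_conv hρ.continuous h.cont.measurable)).add
            (Finset.measurable_sum _ fun i _ => (hu.cont_x i).measurable.mul
              (measurable_conv (w := fun z => b z i) hρ.continuous (h.measurable_coord i))))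
      · have h1 : |R s| ≤ C₁ * B + ∑ i, C₃ i * (M * B) := by
          refine abs_integral_slice_le fun x => (abs_add_le _ _).trans (add_le_add ?_
            ((Finset.abs_sum_le_sum_abs _ _).trans (Finset.sum_le_sum fun i _ => ?_)))
          · rw [abs_mul]
            exact mul_le_mul (hC₁ x s hs) (h.bdd _) (abs_nonneg _) hC₁0
          · rw [abs_mul]
            exact mul_le_mul (hC₃ i x s hs) (h.abs_coord_le' _ i) (abs_nonneg _) (hC₃0 i)
        have h2 := (hRbd s hs).trans (le_abs_self _)
        have h3 := abs_add_le (Rρ s - R s) (R s)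
        rw [sub_add_cancel] at h3
        linarith
    have hint : |(∫ t in (0 : ℝ)..T, Rρ t) - ∫ t in (0 : ℝ)..T, R t| ≤
        (C₁ + ∑ _i : Fin d, M * B) * η * T := by
      rw [← intervalIntegral.integral_sub hRρi hRi]
      have := intervalIntegral.norm_integral_le_of_norm_le_const (a := 0) (b := T)
        (f := fun t => Rρ t - R t) (C := (C₁ + ∑ _i : Fin d, M * B) * η) fun t ht => by
          rw [uIoc_of_le h.T_pos.le] at ht
          exact hRbd t (Ioc_subset_Icc_self ht)
      rwa [sub_zero, abs_of_pos h.T_pos] at this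
    have hb1 := hbd T hT
    have hb0 := hbd 0 h0
    rw [hsplit] at hb1 hb0
    rw [← hdual] at hint
    rw [abs_le] at hb1 hb0 hint ⊢
    constructor <;> simp only [S] <;> nlinarith
  have hz : |S - ∫ t in (0 : ℝ)..T, R t| ≤ 0 := by
    have hlim : Tendsto (fun η : ℝ => η * (2 * C₂ + (C₁ + ∑ _i : Fin d, M * B) * T)) (𝓝[>] 0)
        (𝓝 0) := by
      have : Continuous fun η : ℝ => η * (2 * C₂ + (C₁ + ∑ _i : Fin d, M * B) * T) := by fun_prop
      simpa using (this.tendsto 0).mono_left (nhdsWithin_le_nhds (s := Ioi 0))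
    exact ge_of_tendsto hlim (eventually_mem_nhdsWithin.mono fun η hη => key η hη)
  exact sub_eq_zero.1 (abs_nonpos_iff.1 hz)

end IsWeakFP

end Dual

/-! ### Functions on `Q`, extended to all times -/

section Clamp

variable {d : ℕ} {T : ℝ}

/-- The retraction of `𝕋ᵈ × ℝ` onto `Q`. -/
def clamp (T : ℝ) (z : Torus d × ℝ) : Torus d × ℝ := (z.1, max 0 (min T z.2))

theorem continuous_clamp : Continuous (clamp T : Torus d × ℝ → _) := by
  unfold clamp
  fun_prop

theorem clamp_mem (hT : 0 ≤ T) (z : Torus d × ℝ) : clamp T z ∈ cyl d T :=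
  ⟨mem_univ _, le_max_left _ _, max_le hT (min_le_left _ _)⟩

theorem clamp_of_mem {z : Torus d × ℝ} (hz : z ∈ cyl d T) : clamp T z = z := by
  obtain ⟨x, t⟩ := z
  obtain ⟨-, h1, h2⟩ := hz
  simp only at h1 h2
  simp [clamp, h1, h2]

theorem clamp_mk {x : Torus d} {t : ℝ} (ht : t ∈ Icc 0 T) : clamp T (x, t) = (x, t) :=
  clamp_of_mem ⟨mem_univ _, ht⟩

theorem ContinuousOn.comp_clamp {V : Type*} [TopologicalSpace V] (hT : 0 ≤ T)
    {u : Torus d × ℝ → V} (hu : ContinuousOn u (cyl d T)) : Continuous (u ∘ clamp T) :=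
  hu.comp_continuous continuous_clamp (clamp_mem hT)

theorem cylMeasure_eq : cylMeasure d T = volume.prod (volume.restrict (Icc 0 T)) := by
  rw [cylMeasure, cyl, Measure.volume_eq_prod, ← Measure.prod_restrict, Measure.restrict_univ]

instance isFiniteMeasure_cylMeasure : IsFiniteMeasure (cylMeasure d T) := by
  rw [cylMeasure_eq]
  infer_instance

theorem ae_mem_cyl : ∀ᵐ z ∂cylMeasure d T, z ∈ cyl d T :=
  ae_restrict_mem (MeasurableSet.univ.prod measurableSet_Icc)

theorem comp_clamp_ae_eq {V : Type*} (u : Torus d × ℝ → V) :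
    u ∘ clamp T =ᵐ[cylMeasure d T] u := by
  filter_upwards [ae_mem_cyl] with z hz
  simp [clamp_of_mem hz]

theorem integrable_cyl_of_bound {F : Torus d × ℝ → ℝ} (hF : Measurable F) {C : ℝ}
    (hC : ∀ x, ∀ s ∈ Icc 0 T, |F (x, s)| ≤ C) : Integrable F (cylMeasure d T) := by
  refine Integrable.of_bound hF.aestronglyMeasurable C ?_
  filter_upwards [ae_mem_cyl] with z hz
  exact hC z.1 z.2 hz.2

theorem integrable_cyl_of_continuous {F : Torus d × ℝ → ℝ} (hF : Continuous F) :
    Integrable F (cylMeasure d T) := by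
  obtain ⟨C, -, hC⟩ := exists_bound_cyl hF T
  exact integrable_cyl_of_bound hF.measurable hC

theorem integral_cyl {F : Torus d × ℝ → ℝ} (hF : Integrable F (cylMeasure d T)) :
    ∫ z, F z ∂cylMeasure d T = ∫ t in Icc 0 T, ∫ x, F (x, t) := by
  rw [cylMeasure_eq] at hF ⊢
  exact integral_prod_symm F hF

theorem ae_ae_of_ae_cyl {p : Torus d × ℝ → Prop} (h : ∀ᵐ z ∂cylMeasure d T, p z) :
    ∀ᵐ t ∂(volume.restrict (Icc 0 T) : Measure ℝ), ∀ᵐ x, p (x, t) := by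
  rw [cylMeasure_eq] at h
  exact Measure.ae_ae_of_ae_prod
    (μ := (volume.restrict (Icc 0 T) : Measure ℝ)) (ν := (volume : Measure (Torus d)))
    (p := fun z => p z.swap) (Measure.measurePreserving_swap.quasiMeasurePreserving.ae h)

theorem integrable_slice_ae {V : Type*} [NormedAddCommGroup V] {F : Torus d × ℝ → V}
    (h : Integrable F (cylMeasure d T)) :
    ∀ᵐ t ∂(volume.restrict (Icc 0 T) : Measure ℝ), Integrable fun x => F (x, t) := by
  rw [cylMeasure_eq] at h
  exact h.prod_left_ae

/-- Clamping leaves the space variable untouched, so spatial derivatives commute with it by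
definition. Time derivatives do not, which is why `IsC21` uses derivatives within `[0, T]`. -/
theorem dx_comp_clamp {V : Type*} [NormedAddCommGroup V] [NormedSpace ℝ V] (i : Fin d)
    (u : Torus d × ℝ → V) : dx i (u ∘ clamp T) = dx i u ∘ clamp T := rfl

theorem lapx_comp_clamp (u : Torus d × ℝ → ℝ) : lapx (u ∘ clamp T) = lapx u ∘ clamp T := rfl

theorem MemC21.isC21 {α : ℝ≥0} (hα : 0 < α) (hT : 0 < T) {u : Torus d × ℝ → ℝ}
    (h : MemC21 T α u) : IsC21 T (u ∘ clamp T) (dt T u ∘ clamp T) := by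
  obtain ⟨h1, h2, h3, ⟨K, h4⟩, h5, h6⟩ := h
  have heq : ∀ x : Torus d, EqOn (fun s => (u ∘ clamp T) (x, s)) (fun s => u (x, s)) (Icc 0 T) :=
    fun x s hs => by simp [clamp_mk hs]
  refine ⟨ContinuousOn.comp_clamp hT.le h1, ContinuousOn.comp_clamp hT.le (h4.continuousOn hα),
    fun x => (h2 x).congr (heq x), fun x t ht => ?_, fun i t => ?_, fun i t => ?_, fun i => ?_,
    fun i => ?_⟩
  · rw [derivWithin_congr (heq x) (heq x ht), Function.comp_apply, clamp_mk ht, dt]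
  · exact (h3 _ (clamp_mem hT.le ((0 : Torus d), t)).2).1 i
  · exact (h3 _ (clamp_mem hT.le ((0 : Torus d), t)).2).2 i i
  · rw [dx_comp_clamp]
    obtain ⟨K, hK⟩ := h5 i
    exact ContinuousOn.comp_clamp hT.le (hK.continuousOn hα)
  · rw [dx_comp_clamp, dx_comp_clamp]
    obtain ⟨K, hK⟩ := h6 i i
    exact ContinuousOn.comp_clamp hT.le (hK.continuousOn hα)

theorem HasPartial.coord {n : ℕ} {i : Fin d} {w : Torus d → E n} (hw : HasPartial i w)
    (j : Fin n) :
    HasPartial i (fun x => w x j) ∧ pderiv i (fun x => w x j) = fun x => pderiv i w x j :=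
  HasPartial.of_hasDerivAt fun x =>
    (EuclideanSpace.proj (𝕜 := ℝ) j).hasFDerivAt.comp_hasDerivAt (0 : ℝ) (hw.hasDerivAt_zero x)

/-- A bounded velocity field together with a density gives rise to a weak solution; `v₁` is an
everywhere bounded, measurable representative of `v`. -/
structure IsAdmissible (T M B : ℝ) (m : Torus d × ℝ → ℝ) (v v₁ : Torus d × ℝ → E d) :
    Prop where
  meas : Measurable v₁
  bound : ∀ z, ‖v₁ z‖ ≤ M
  ae_eq : v =ᵐ[cylMeasure d T] v₁
  fp : IsWeakFP T M B (m ∘ clamp T) fun z => (m ∘ clamp T) z • v₁ z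

theorem norm_smul_le_of_bound {M : ℝ} {m : Torus d × ℝ → ℝ} {v : Torus d × ℝ → E d}
    (hv : ∀ z, ‖v z‖ ≤ M) (z : Torus d × ℝ) : ‖m z • v z‖ ≤ M * |m z| := by
  rw [norm_smul, Real.norm_eq_abs, mul_comm]
  exact mul_le_mul_of_nonneg_right (hv z) (abs_nonneg _)

theorem integrable_smooth_mul {F : Torus d × ℝ → ℝ} (hF : Measurable F) {C : ℝ}
    (hC : ∀ z, |F z| ≤ C) {ψ : Torus d → ℝ} (hψ : Continuous ψ) (t : ℝ) :
    Integrable fun x => ψ x * F (x, t) := by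
  obtain ⟨K, -, hK⟩ := exists_norm_le_of_continuous hψ
  exact (integrable_slice hF fun x => hC (x, t)).bdd_mul hψ.aestronglyMeasurable
    (Eventually.of_forall hK)

/-- Classical solutions of the Fokker-Planck equation are weak solutions. -/
theorem exists_isAdmissible_of_classical {α : ℝ≥0} (hα : 0 < α) (hT : 0 < T)
    {m : Torus d × ℝ → ℝ} {v : Torus d × ℝ → E d} (hm : MemC21 T α m) (hv : MemC10 T α v)
    (h : ∀ z ∈ cyl d T, dt T m z - lapx m z + divx (fun y => m y • v y) z = 0) :
    ∃ M B, IsAdmissible T M B m v (v ∘ clamp T) := by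
  have hm' := hm.isC21 hα hT
  obtain ⟨⟨K, hvK⟩, hvp, hvx⟩ := hv
  have hvc : Continuous (v ∘ clamp T) := ContinuousOn.comp_clamp hT.le (hvK.continuousOn hα)
  have hbound : ∀ {V : Type} [NormedAddCommGroup V] (F : Torus d × ℝ → V),
      Continuous (F ∘ clamp T) → ∃ C, 0 ≤ C ∧ ∀ z, ‖(F ∘ clamp T) z‖ ≤ C := by
    intro V _ F hF
    obtain ⟨C, hC⟩ := (isCompact_cyl d T).exists_bound_of_continuousOn hF.continuousOn
    refine ⟨max C 0, le_max_right _ _, fun z => ?_⟩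
    have := hC _ (clamp_mem hT.le z)
    rw [Function.comp_apply, clamp_of_mem (clamp_mem hT.le z)] at this
    exact this.trans (le_max_left _ _)
  obtain ⟨M, hM0, hM⟩ := hbound v hvc
  obtain ⟨B, -, hB⟩ := hbound m hm'.cont
  set m₁ := m ∘ clamp T with hm₁
  set v₁ := v ∘ clamp T with hv₁
  have hmc := hm'.cont
  have hbc : Continuous fun z => m₁ z • v₁ z := hmc.smul hvc
  refine ⟨M, B, hvc.measurable, hM, (comp_clamp_ae_eq v).symm, hT, hM0, hmc, hB, hbc.measurable,
    norm_smul_le_of_bound hM, fun ψ hψ t ht => ?_⟩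
  have hpart : ∀ i t, HasPartial i (fun x => m₁ (x, t) * v₁ (x, t) i) ∧
      Continuous (pderiv i fun x => m₁ (x, t) * v₁ (x, t) i) := by
    intro i t
    have h1 : HasPartial i fun x => v₁ (x, t) :=
      hvp _ (clamp_mem hT.le ((0 : Torus d), t)).2 i
    obtain ⟨h2, h3⟩ := h1.coord i
    obtain ⟨h4, h5⟩ := (hm'.part i t).mul h2
    refine ⟨h4, ?_⟩
    rw [h5, h3]
    obtain ⟨K', hK'⟩ := hvx i
    have h6 : Continuous fun x => pderiv i (fun x => v₁ (x, t)) x i := by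
      have h7 : Continuous (dx i v ∘ clamp T) := ContinuousOn.comp_clamp hT.le (hK'.continuousOn hα)
      exact (EuclideanSpace.proj (𝕜 := ℝ) i).continuous.comp (h7.comp (Continuous.prodMk_left t))
    have h8 : Continuous fun x => pderiv i (fun x => m₁ (x, t)) x :=
      (hm'.cont_x i).comp (Continuous.prodMk_left t)
    have h9 : Continuous fun x => v₁ (x, t) i :=
      (EuclideanSpace.proj (𝕜 := ℝ) i).continuous.comp (hvc.comp (Continuous.prodMk_left t))
    exact (h8.mul h9).add ((hmc.comp (Continuous.prodMk_left t)).mul h6)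
  -- The fundamental theorem of calculus at fixed `x`; multiplying by ψ and exchanging the integrals
  -- gives the weak form.
  have htime : ∀ x, ∀ t ∈ Icc 0 T, m₁ (x, t) - m₁ (x, 0) =
      ∫ s in (0 : ℝ)..t, (dt T m ∘ clamp T) (x, s) := by
    intro x t ht
    refine (intervalIntegral.integral_eq_sub_of_hasDerivAt_of_le (f := fun s => m₁ (x, s))
      (f' := fun s => (dt T m ∘ clamp T) (x, s)) ht.1 ?_ (fun s hs => ?_) ?_).symm
    · exact (hmc.comp (Continuous.prodMk_right x)).continuousOn
    · have hsT : s ∈ Icc 0 T := ⟨hs.1.le, hs.2.le.trans ht.2⟩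
      rw [← hm'.deriv_eq x s hsT]
      exact (hm'.diff x s hsT).hasDerivWithinAt.hasDerivAt
        (Icc_mem_nhds hs.1 (hs.2.trans_le ht.2))
    · exact (hm'.cont_t.comp (Continuous.prodMk_right x)).intervalIntegrable _ _
  have hcs : ∀ {F : Torus d × ℝ → ℝ}, Continuous F → ∀ t, Continuous fun x => F (x, t) :=
    fun hF t => hF.comp (Continuous.prodMk_left t)
  have hi0 : ∀ t, Integrable fun x => ψ x * m₁ (x, t) := fun t =>
    integrable_of_continuous (hψ.continuous.mul (hcs hmc t))
  change (∫ x, ψ x * m₁ (x, t)) - ∫ x, ψ x * m₁ (x, 0) = ∫ s in (0 : ℝ)..t, ∫ x,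
    ∑ i, (pderiv i (pderiv i ψ) x * m₁ (x, s) + pderiv i ψ x * (m₁ (x, s) • v₁ (x, s)) i)
  rw [← integral_sub (hi0 t) (hi0 0)]
  have h1 : ∀ x, ψ x * m₁ (x, t) - ψ x * m₁ (x, 0) =
      ∫ s in (0 : ℝ)..t, ψ x * (dt T m ∘ clamp T) (x, s) := fun x => by
    rw [intervalIntegral.integral_const_mul, ← htime x t ht, mul_sub]
  have hFc : Continuous fun z : Torus d × ℝ => ψ z.1 * (dt T m ∘ clamp T) z :=
    (hψ.continuous.comp continuous_fst).mul hm'.cont_t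
  obtain ⟨C, -, hC⟩ := exists_bound_cyl hFc T
  rw [integral_congr_ae (Eventually.of_forall h1), integral_swap_of_bound hFc.measurable hC ht]
  refine intervalIntegral.integral_congr fun s hs => ?_
  rw [uIcc_of_le ht.1] at hs
  have hsT : s ∈ Icc 0 T := ⟨hs.1, hs.2.trans ht.2⟩
  have h2 : ∀ x, ψ x * (dt T m ∘ clamp T) (x, s) =
      ∑ i, (ψ x * dx i (dx i m₁) (x, s) - ψ x * pderiv i (fun x => m₁ (x, s) * v₁ (x, s) i) x) := by
    intro x
    have h3 := h (x, s) ⟨mem_univ _, hsT⟩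
    have h4 : (dt T m ∘ clamp T) (x, s) = dt T m (x, s) := by simp [clamp_mk hsT]
    have h5 : ∀ i, dx i (dx i m₁) (x, s) = dx i (dx i m) (x, s) := fun i => by
      rw [hm₁, dx_comp_clamp, dx_comp_clamp, Function.comp_apply, clamp_mk hsT]
    have h6 : ∀ i, pderiv i (fun x => m₁ (x, s) * v₁ (x, s) i) x =
        dx i (fun y => (m y • v y) i) (x, s) := fun i => by
      simp only [hm₁, hv₁, Function.comp_apply, clamp_mk hsT]
      rfl
    rw [h4, show dt T m (x, s) = lapx m (x, s) - divx (fun y => m y • v y) (x, s) by linarith,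
      lapx, divx, ← Finset.sum_sub_distrib, Finset.mul_sum]
    exact Finset.sum_congr rfl fun i _ => by rw [h5, h6, mul_sub]
  simp only [h2]
  have hψi := fun i => hψ.pderiv i
  have hbi : ∀ i, Continuous fun x => m₁ (x, s) * v₁ (x, s) i := fun i =>
    (hcs hmc s).mul ((EuclideanSpace.proj (𝕜 := ℝ) i).continuous.comp
      (hvc.comp (Continuous.prodMk_left s)))
  have hi1 : ∀ i, Integrable fun x => ψ x * dx i (dx i m₁) (x, s) := fun i =>
    integrable_of_continuous (hψ.continuous.mul (hcs (hm'.cont_xx i) s))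
  have hi2 : ∀ i, Integrable fun x => ψ x * pderiv i (fun x => m₁ (x, s) * v₁ (x, s) i) x :=
    fun i => integrable_of_continuous (hψ.continuous.mul (hpart i s).2)
  have hi3 : ∀ i, Integrable fun x => pderiv i (pderiv i ψ) x * m₁ (x, s) := fun i =>
    integrable_of_continuous (((hψi i).pderiv i).continuous.mul (hcs hmc s))
  have hi4 : ∀ i, Integrable fun x => pderiv i ψ x * (m₁ (x, s) • v₁ (x, s)) i := fun i =>
    integrable_of_continuous ((hψi i).continuous.mul (hbi i))
  have hi12 : ∀ i, Integrable fun x => ψ x * dx i (dx i m₁) (x, s) -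
    ψ x * pderiv i (fun x => m₁ (x, s) * v₁ (x, s) i) x := fun i => (hi1 i).sub (hi2 i)
  have hi34 : ∀ i, Integrable fun x => pderiv i (pderiv i ψ) x * m₁ (x, s) +
    pderiv i ψ x * (m₁ (x, s) • v₁ (x, s)) i := fun i => (hi3 i).add (hi4 i)
  rw [integral_finsetSum _ fun i _ => hi12 i, integral_finsetSum _ fun i _ => hi34 i]
  refine Finset.sum_congr rfl fun i _ => ?_
  rw [integral_sub (hi1 i) (hi2 i), integral_add (hi3 i) (hi4 i)]
  -- Two integrations by parts for the Laplacian (`e1`, `e2`) and one for the divergence (`e3`).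
  have e1 := integral_mul_pderiv (hψ.hasPartial i) (hm'.part2 i s) hψ.continuous
    (hcs (hm'.cont_x i) s) (hψi i).continuous (hcs (hm'.cont_xx i) s)
  have e2 := integral_mul_pderiv ((hψi i).hasPartial i) (hm'.part i s) (hψi i).continuous
    (hcs hmc s) ((hψi i).pderiv i).continuous (hcs (hm'.cont_x i) s)
  have e3 := integral_mul_pderiv (hψ.hasPartial i) (hpart i s).1 hψ.continuous
    (hbi i) (hψi i).continuous (hpart i s).2
  have e1' : ∫ x, ψ x * dx i (dx i m₁) (x, s) = -∫ x, pderiv i ψ x * dx i m₁ (x, s) := e1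
  have e2' : ∫ x, pderiv i ψ x * dx i m₁ (x, s) = -∫ x, pderiv i (pderiv i ψ) x * m₁ (x, s) := e2
  have e3' : ∫ x, ψ x * pderiv i (fun x => m₁ (x, s) * v₁ (x, s) i) x =
    -∫ x, pderiv i ψ x * (m₁ (x, s) • v₁ (x, s)) i := e3
  rw [e1', e2', e3']
  ring

end Clamp

/-! ### Sobolev solutions are weak solutions -/

section Feasible

variable {d : ℕ} {T : ℝ}

/-- An essentially bounded field has an everywhere bounded measurable representative. -/
theorem exists_bounded_representative {V : Type*} [NormedAddCommGroup V] [MeasurableSpace V]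
    [BorelSpace V] {X : Type*} [MeasurableSpace X] {μ : Measure X} {v : X → V}
    (hv : MemLp v ∞ μ) :
    ∃ (v₁ : X → V) (M : ℝ), 0 ≤ M ∧ Measurable v₁ ∧ (∀ z, ‖v₁ z‖ ≤ M) ∧ v =ᵐ[μ] v₁ := by
  obtain ⟨v₀, hv₀, hvv₀⟩ := hv.1
  obtain ⟨M, hM⟩ := eLpNormEssSup_lt_top_iff_isBoundedUnder.1
    (by simpa using hv.2)
  have hM' : ∀ᵐ z ∂μ, ‖v z‖ ≤ M := (eventually_map.1 hM).mono fun z hz => by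
    exact_mod_cast hz
  classical
  -- A measurable representative is cut off at the essential bound, which changes it only on a null
  -- set.
  refine ⟨fun z => if ‖v₀ z‖ ≤ M then v₀ z else 0, M, M.2, ?_, fun z => ?_, ?_⟩
  · exact Measurable.ite (hv₀.norm.measurable measurableSet_Iic) hv₀.measurable measurable_const
  · dsimp only
    split_ifs with h
    · exact h
    · simp
  · filter_upwards [hvv₀, hM'] with z h1 h2
    rw [if_pos (by rwa [← h1]), h1]

/-- Products `χ(t) ψ(x)` are admissible test functions in space-time. -/
theorem isC1SpaceTime_mul {ψ : Torus d → ℝ} (hψ : IsSmooth ψ) {χ : ℝ → ℝ}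
    (hχ : ContDiff ℝ 1 χ) : IsC1SpaceTime fun z : Torus d × ℝ => χ z.2 * ψ z.1 := by
  unfold IsC1SpaceTime
  refine (hχ.comp contDiff_snd).mul ?_
  exact ContDiff.comp (g := fun y : Fin d → ℝ => ψ (Torus.proj y)) (hψ.of_le (by simp))
    contDiff_fst

theorem tsupport_mul_subset {ψ : Torus d → ℝ} {χ : ℝ → ℝ} {S : Set ℝ} (h : tsupport χ ⊆ S) :
    tsupport (fun z : Torus d × ℝ => χ z.2 * ψ z.1) ⊆ univ ×ˢ S := by
  have h1 : tsupport (fun z : Torus d × ℝ => χ z.2 * ψ z.1) ⊆ Prod.snd ⁻¹' tsupport χ := by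
    refine closure_minimal (fun z hz => subset_tsupport χ ?_)
      ((isClosed_tsupport χ).preimage continuous_snd)
    exact left_ne_zero_of_mul hz
  exact fun z hz => ⟨mem_univ _, h (h1 hz)⟩

theorem integral_smul_coord {n : ℕ} {ψ : Torus d → ℝ} {w : Torus d → E n}
    (h : Integrable fun x => ψ x • w x) (j : Fin n) :
    (∫ x, ψ x • w x) j = ∫ x, ψ x * w x j :=
  ((EuclideanSpace.proj (𝕜 := ℝ) j).integral_comp_comm h).symm

/-- Strong solutions of the Fokker-Planck equation in Sobolev spaces are weak solutions. -/
theorem exists_isAdmissible_of_fokkerPlanck (hT : 0 < T) {q : ℝ≥0∞} (hq : 1 ≤ q)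
    {m : Torus d × ℝ → ℝ} {v : Torus d × ℝ → E d} (hm : ContinuousOn m (cyl d T))
    (hv : MemLp v ∞ (cylMeasure d T)) (h : FokkerPlanck q T m v) :
    ∃ v₁ M B, IsAdmissible T M B m v v₁ := by
  obtain ⟨v₁, M, hM0, hv₁, hM, hvv₁⟩ := exists_bounded_representative hv
  obtain ⟨mt, mx, mxx, wx, ⟨hmt, hmtw⟩, hx, heq⟩ := h
  set m₁ := m ∘ clamp T with hm₁
  have hmc : Continuous m₁ := ContinuousOn.comp_clamp hT.le hm
  obtain ⟨B, hB0, hB'⟩ := exists_bound_cyl hmc T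
  have hB : ∀ z, |m₁ z| ≤ B := fun z => by
    have := hB' (clamp T z).1 (clamp T z).2 (clamp_mem hT.le z).2
    rwa [Prod.mk.eta, hm₁, Function.comp_apply, clamp_of_mem (clamp_mem hT.le z)] at this
  have hbm : Measurable fun z => m₁ z • v₁ z := hmc.measurable.smul hv₁
  have hbi : ∀ i, Measurable fun z => (m₁ z • v₁ z) i := fun i =>
    (EuclideanSpace.proj (𝕜 := ℝ) i).continuous.measurable.comp hbm
  have hbB : ∀ z i, |(m₁ z • v₁ z) i| ≤ M * B := fun z i =>
    (PiLp.norm_apply_le (m₁ z • v₁ z) i).trans ((norm_smul_le_of_bound hM z).trans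
      (mul_le_mul_of_nonneg_left (hB z) hM0))
  refine ⟨v₁, M, B, hv₁, hM, hvv₁, hT, hM0, hmc, hB, hbm, norm_smul_le_of_bound hM,
    fun ψ hψ t ht => ?_⟩
  have hmti : Integrable mt (cylMeasure d T) := hmt.integrable hq
  obtain ⟨Cψ, hCψ0, hCψ⟩ := exists_norm_le_of_continuous hψ.continuous
  choose C₁ hC₁0 hC₁ using fun i => exists_norm_le_of_continuous (hψ.pderiv i).continuous
  choose C₂ hC₂0 hC₂ using fun i => exists_norm_le_of_continuous ((hψ.pderiv i).pderiv i).continuous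
  set K : ℝ → ℝ := fun s => ∫ x, ∑ i, (pderiv i (pderiv i ψ) x * m₁ (x, s) +
    pderiv i ψ x * (m₁ (x, s) • v₁ (x, s)) i) with hK
  have hi3 : ∀ s i, Integrable fun x => pderiv i (pderiv i ψ) x * m₁ (x, s) := fun s i =>
    integrable_smooth_mul hmc.measurable hB ((hψ.pderiv i).pderiv i).continuous s
  have hi4 : ∀ s i, Integrable fun x => pderiv i ψ x * (m₁ (x, s) • v₁ (x, s)) i := fun s i =>
    integrable_smooth_mul (hbi i) (fun z => hbB z i) (hψ.pderiv i).continuous s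
  have hKm : Measurable K := by
    refine measurable_integral_slice (F := fun z => ∑ i, (pderiv i (pderiv i ψ) z.1 * m₁ z +
      pderiv i ψ z.1 * (m₁ z • v₁ z) i)) (Finset.measurable_sum _ fun i _ => ?_)
    exact ((((hψ.pderiv i).pderiv i).continuous.measurable.comp measurable_fst).mul
      hmc.measurable).add (((hψ.pderiv i).continuous.measurable.comp measurable_fst).mul (hbi i))
  have hKi : IntegrableOn K (Icc 0 T) := by
    refine Measure.integrableOn_of_bounded (M := ∑ i, (C₂ i * B + C₁ i * (M * B))) (by simp)
      hKm.aestronglyMeasurable (Eventually.of_forall fun s => ?_)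
    refine abs_integral_slice_le fun x => (Finset.abs_sum_le_sum_abs _ _).trans
      (Finset.sum_le_sum fun i _ => (abs_add_le _ _).trans (add_le_add ?_ ?_))
    · rw [abs_mul]
      exact mul_le_mul (hC₂ i x) (hB _) (abs_nonneg _) (hC₂0 i)
    · rw [abs_mul]
      exact mul_le_mul (hC₁ i x) (hbB _ i) (abs_nonneg _) (hC₁0 i)
  -- On almost every time slice the equation holds almost everywhere in `x`, and the weak spatial
  -- derivatives can be moved onto ψ.
  have hslice : ∀ᵐ s ∂(volume.restrict (Icc 0 T) : Measure ℝ), ∫ x, ψ x * mt (x, s) = K s := by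
    have a1 := ae_ae_of_ae_cyl heq
    have a2 := eventually_all.2 fun i => integrable_slice_ae ((hx i).2.1.1.integrable hq)
    have a3 := eventually_all.2 fun i => integrable_slice_ae ((hx i).2.2.1.integrable hq)
    have a4 := eventually_all.2 fun i => (hx i).1.2
    have a5 := eventually_all.2 fun i => (hx i).2.1.2
    have a6 := eventually_all.2 fun i => (hx i).2.2.2
    have a7 := ae_ae_of_ae_cyl hvv₁
    have a8 : ∀ᵐ s ∂(volume.restrict (Icc 0 T) : Measure ℝ), s ∈ Icc 0 T :=
      ae_restrict_mem measurableSet_Icc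
    filter_upwards [a1, a2, a3, a4, a5, a6, a7, a8] with s h1 h2 h3 h4 h5 h6 h7 h8
    have hms : ∀ x, m (x, s) = m₁ (x, s) := fun x => by simp [hm₁, clamp_mk h8]
    have hw1 : ∀ i, Integrable fun x => ψ x * mxx i (x, s) := fun i =>
      (h2 i).bdd_mul hψ.continuous.aestronglyMeasurable (Eventually.of_forall hCψ)
    have hw2 : ∀ i, Integrable fun x => ψ x • wx i (x, s) := fun i =>
      (h3 i).bdd_smul Cψ hψ.continuous.aestronglyMeasurable (Eventually.of_forall hCψ)
    have hw3 : ∀ i, Integrable fun x => ψ x * wx i (x, s) i := fun i =>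
      (EuclideanSpace.proj (𝕜 := ℝ) i).integrable_comp (hw2 i)
    have e1 : ∫ x, ψ x * mt (x, s) =
        ∫ x, ∑ i, (ψ x * mxx i (x, s) - ψ x * wx i (x, s) i) := by
      refine integral_congr_ae (h1.mono fun x hx' => ?_)
      simp only
      rw [show mt (x, s) = (∑ i, mxx i (x, s)) - ∑ i, wx i (x, s) i by linarith,
        ← Finset.sum_sub_distrib, Finset.mul_sum]
      exact Finset.sum_congr rfl fun i _ => by rw [mul_sub]
    have hw13 : ∀ i, Integrable fun x => ψ x * mxx i (x, s) - ψ x * wx i (x, s) i :=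
      fun i => (hw1 i).sub (hw3 i)
    have hi34 : ∀ i, Integrable fun x => pderiv i (pderiv i ψ) x * m₁ (x, s) +
      pderiv i ψ x * (m₁ (x, s) • v₁ (x, s)) i := fun i => (hi3 s i).add (hi4 s i)
    rw [e1, hK, integral_finsetSum _ fun i _ => hw13 i]
    simp only
    rw [integral_finsetSum _ fun i _ => hi34 i]
    refine Finset.sum_congr rfl fun i _ => ?_
    rw [integral_sub (hw1 i) (hw3 i), integral_add (hi3 s i) (hi4 s i)]
    have e2 := h4 i _ (hψ.pderiv i).isC1
    have e3 := h5 i _ hψ.isC1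
    have e4 := h6 i _ hψ.isC1
    simp only [smul_eq_mul, hms] at e2 e3
    have hw4 : ∫ x, pderiv i ψ x • m (x, s) • v (x, s) =
        ∫ x, pderiv i ψ x • m₁ (x, s) • v₁ (x, s) := by
      refine integral_congr_ae (h7.mono fun x hx' => ?_)
      simp only [hms, hx']
    have hw5 : Integrable fun x => pderiv i ψ x • m₁ (x, s) • v₁ (x, s) := by
      refine Integrable.of_bound (C := C₁ i * (M * B)) ?_ (Eventually.of_forall fun x => ?_)
      · exact ((hψ.pderiv i).continuous.measurable.smul
          (hbm.comp (by fun_prop : Measurable fun x : Torus d => (x, s)))).aestronglyMeasurable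
      · rw [norm_smul]
        exact mul_le_mul (hC₁ i x) ((norm_smul_le_of_bound hM _).trans
          (mul_le_mul_of_nonneg_left (hB _) hM0)) (norm_nonneg _) (hC₁0 i)
    rw [hw4] at e4
    have e5 := congrArg (fun w : E d => w i) e4
    simp only [PiLp.neg_apply] at e5
    rw [integral_smul_coord hw5 i, integral_smul_coord (hw2 i) i] at e5
    linarith
  -- Testing with products `χ(t) ψ(x)` shows that `K` is the weak derivative of `t ↦ ∫ ψ m(·,t)`.
  -- Since this function is continuous, the integrated identity holds at every time, including the
  -- endpoints.
  refine sub_eq_integral_of_weak_deriv (h := fun s => ∫ x, ψ x * m₁ (x, s)) (k := K) (C := Cψ * B)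
    ?_ (fun s => ?_) hKi (fun χ hχ hsupp => ?_) ht
  · exact continuous_integral_slice (F := fun z => ψ z.1 * m₁ z)
      ((hψ.continuous.comp continuous_fst).mul hmc)
  · refine abs_integral_slice_le fun x => ?_
    rw [abs_mul]
    exact mul_le_mul (hCψ x) (hB _) (abs_nonneg _) hCψ0
  · have h1 := hmtw _ (isC1SpaceTime_mul hψ hχ) (tsupport_mul_subset hsupp)
    have hχd : ∀ s, DifferentiableAt ℝ χ s := fun s => hχ.differentiable (by simp) s
    have hχc : Continuous (deriv χ) := hχ.continuous_deriv (by simp)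
    simp only [smul_eq_mul] at h1
    have hl : ∫ z, deriv (fun s => χ s * ψ z.1) z.2 * m z ∂cylMeasure d T =
        ∫ z, deriv χ z.2 * ψ z.1 * m₁ z ∂cylMeasure d T := by
      refine integral_congr_ae ((comp_clamp_ae_eq m).mono fun z hz => ?_)
      simp only [hm₁, hz]
      rw [deriv_mul_const (hχd _)]
    have hlc : Continuous fun z : Torus d × ℝ => deriv χ z.2 * ψ z.1 * m₁ z :=
      ((hχc.comp continuous_snd).mul (hψ.continuous.comp continuous_fst)).mul hmc
    have hrc : Continuous fun z : Torus d × ℝ => χ z.2 * ψ z.1 :=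
      (hχ.continuous.comp continuous_snd).mul (hψ.continuous.comp continuous_fst)
    obtain ⟨R, -, hR⟩ := exists_bound_cyl hrc T
    have hri : Integrable (fun z => χ z.2 * ψ z.1 * mt z) (cylMeasure d T) :=
      hmti.bdd_mul (c := R) hrc.aestronglyMeasurable
        (ae_mem_cyl.mono fun z hz => hR z.1 z.2 hz.2)
    rw [hl, integral_cyl (integrable_cyl_of_continuous hlc), integral_cyl hri] at h1
    simp only [mul_assoc, integral_const_mul] at h1
    rw [h1]
    congr 1
    refine integral_congr_ae (hslice.mono fun s hs => ?_)
    simp only [hs]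

end Feasible

/-! ### Strongly convex Lagrangians and their Legendre transforms -/

section Legendre

variable {V : Type*} [NormedAddCommGroup V] [InnerProductSpace ℝ V] [FiniteDimensional ℝ V]
  {ℓ : V → ℝ} {c : ℝ}

/-- On the segment from `v` to `w`, subtract from ℓ its first-order part at `v` and the parabola `s²
c/2 ‖w - v‖²`. By monotonicity of the gradient between `v + s(w - v)` and `v`, the result is
nondecreasing on `[0, 1]`; compare its endpoint values. -/
theorem le_of_strongly_monotone_gradient (hd : Differentiable ℝ ℓ)
    (hm : ∀ v v' : V, c * ‖v - v'‖ ^ 2 ≤ ⟪gradient ℓ v - gradient ℓ v', v - v'⟫) (v w : V) :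
    ℓ v + ⟪gradient ℓ v, w - v⟫ + c / 2 * ‖w - v‖ ^ 2 ≤ ℓ w := by
  set g : ℝ → ℝ := fun s => ℓ (v + s • (w - v)) - s * ⟪gradient ℓ v, w - v⟫ -
    s ^ 2 * (c / 2 * ‖w - v‖ ^ 2) with hg
  have hgd : ∀ s, HasDerivAt g (⟪gradient ℓ (v + s • (w - v)), w - v⟫ - ⟪gradient ℓ v, w - v⟫ -
      2 * s * (c / 2 * ‖w - v‖ ^ 2)) s := by
    intro s
    have h1 : HasDerivAt (fun s : ℝ => v + s • (w - v)) (w - v) s := by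
      simpa using ((hasDerivAt_id s).smul_const (w - v)).const_add v
    have h2 := (hd (v + s • (w - v))).hasGradientAt.hasFDerivAt.comp_hasDerivAt s h1
    rw [InnerProductSpace.toDual_apply_apply] at h2
    have h3 : HasDerivAt (fun s : ℝ => s * ⟪gradient ℓ v, w - v⟫) ⟪gradient ℓ v, w - v⟫ s := by
      simpa using (hasDerivAt_id s).mul_const ⟪gradient ℓ v, w - v⟫
    have h4 : HasDerivAt (fun s : ℝ => s ^ 2 * (c / 2 * ‖w - v‖ ^ 2))
        (2 * s * (c / 2 * ‖w - v‖ ^ 2)) s := by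
      simpa using (hasDerivAt_pow 2 s).mul_const (c / 2 * ‖w - v‖ ^ 2)
    exact (h2.sub h3).sub h4
  have hmono : MonotoneOn g (Icc 0 1) := by
    refine monotoneOn_of_deriv_nonneg (convex_Icc 0 1)
      (fun s _ => (hgd s).continuousAt.continuousWithinAt)
      (fun s _ => (hgd s).differentiableAt.differentiableWithinAt) fun s hs => ?_
    rw [interior_Icc] at hs
    rw [(hgd s).deriv]
    have h1 := hm (v + s • (w - v)) v
    rw [add_sub_cancel_left, inner_smul_right, norm_smul, inner_sub_left, mul_pow,
      Real.norm_eq_abs, sq_abs] at h1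
    have h2 : 0 ≤ s * (⟪gradient ℓ (v + s • (w - v)), w - v⟫ - ⟪gradient ℓ v, w - v⟫ -
      2 * s * (c / 2 * ‖w - v‖ ^ 2)) := by nlinarith
    exact nonneg_of_mul_nonneg_right h2 hs.1
  have := hmono (left_mem_Icc.2 zero_le_one) (right_mem_Icc.2 zero_le_one) zero_le_one
  simp only [hg, zero_smul, add_zero, zero_mul, one_smul, add_sub_cancel, one_mul, sub_zero,
    one_pow, ne_eq, OfNat.ofNat_ne_zero, not_false_eq_true, zero_pow] at this
  linarith

/-- The gradient of a strongly convex function is onto. -/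
theorem exists_gradient_eq (hc : 0 < c) (hd : Differentiable ℝ ℓ)
    (hm : ∀ v v' : V, c * ‖v - v'‖ ^ 2 ≤ ⟪gradient ℓ v - gradient ℓ v', v - v'⟫) (q : V) :
    ∃ v, gradient ℓ v = -q := by
  -- The quadratic lower bound on ℓ gives coercivity; in finite dimension a maximizer exists, and it
  -- is the required critical point.
  have htend : Tendsto (fun w : V => -⟪q, w⟫ - ℓ w) (cocompact V) atBot := by
    have h1 : Tendsto (fun r : ℝ => -ℓ 0 + r * ((‖q‖ + ‖gradient ℓ 0‖) + -(c / 2) * r)) atTop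
        atBot := by
      refine tendsto_atBot_add_const_left _ _ (tendsto_id.atTop_mul_atBot₀ ?_)
      exact tendsto_atBot_add_const_left _ _ (tendsto_id.const_mul_atTop_of_neg (by linarith))
    refine tendsto_atBot_mono (fun w => ?_) (h1.comp (tendsto_norm_cocompact_atTop (E := V)))
    have h2 := le_of_strongly_monotone_gradient hd hm 0 w
    have h3 := (abs_le.1 (abs_real_inner_le_norm q w)).1
    have h4 := (abs_le.1 (abs_real_inner_le_norm (gradient ℓ 0) w)).1
    rw [sub_zero] at h2
    simp only [Function.comp_apply]
    nlinarith
  have hcont : Continuous fun w : V => -⟪q, w⟫ - ℓ w :=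
    (continuous_const.inner continuous_id).neg.sub hd.continuous
  obtain ⟨v, hv⟩ := hcont.exists_forall_ge htend
  refine ⟨v, ?_⟩
  have h1 : HasFDerivAt (fun w : V => -⟪q, w⟫ - ℓ w)
      (-(innerSL ℝ q) - (InnerProductSpace.toDual ℝ V (gradient ℓ v) : V →L[ℝ] ℝ)) v :=
    (innerSL ℝ q).hasFDerivAt.neg.sub (hd v).hasGradientAt.hasFDerivAt
  have h2 : IsLocalMax (fun w : V => -⟪q, w⟫ - ℓ w) v := Eventually.of_forall hv
  have h3 := h2.hasFDerivAt_eq_zero h1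
  refine ext_inner_right ℝ fun w => ?_
  have h4 := DFunLike.congr_fun h3 w
  simp only [sub_apply, neg_apply, innerSL_apply_apply,
    zero_apply] at h4
  rw [InnerProductSpace.toDual_apply_apply] at h4
  rw [inner_neg_left]
  linarith

/-- The tangent inequality at `v` makes `v` a maximizer. It also bounds the family above, so the
real supremum is a true supremum and not a default value. -/
theorem legendre_eq (hc : 0 < c) (hd : Differentiable ℝ ℓ)
    (hm : ∀ v v' : V, c * ‖v - v'‖ ^ 2 ≤ ⟪gradient ℓ v - gradient ℓ v', v - v'⟫) {q v : V}
    (hv : gradient ℓ v = -q) :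
    (∀ w, -⟪q, w⟫ - ℓ w ≤ -⟪q, v⟫ - ℓ v) ∧ (⨆ w, (-⟪q, w⟫ - ℓ w)) = -⟪q, v⟫ - ℓ v := by
  have h1 : ∀ w, -⟪q, w⟫ - ℓ w ≤ -⟪q, v⟫ - ℓ v := fun w => by
    have h2 := le_of_strongly_monotone_gradient hd hm v w
    rw [hv, inner_neg_left, inner_sub_right] at h2
    have : 0 ≤ c / 2 * ‖w - v‖ ^ 2 := by positivity
    linarith
  exact ⟨h1, le_antisymm (ciSup_le h1) (le_ciSup (f := fun w => -⟪q, w⟫ - ℓ w)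
    ⟨_, forall_mem_range.2 h1⟩ v)⟩

/-- The Legendre transform of a strongly convex function is differentiable. -/
theorem hasGradientAt_legendre (hc : 0 < c) (hd : Differentiable ℝ ℓ)
    (hm : ∀ v v' : V, c * ‖v - v'‖ ^ 2 ≤ ⟪gradient ℓ v - gradient ℓ v', v - v'⟫) {q v : V}
    (hv : gradient ℓ v = -q) :
    HasGradientAt (fun q => ⨆ w, (-⟪q, w⟫ - ℓ w)) (-v) q := by
  rw [hasGradientAt_iff_isLittleO]
  have hO : (fun q' : V => (⨆ w, (-⟪q', w⟫ - ℓ w)) - (⨆ w, (-⟪q, w⟫ - ℓ w)) -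
      ⟪-v, q' - q⟫) =O[𝓝 q] fun q' => ‖q' - q‖ ^ 2 := by
    -- With maximizers `v`, `v'` for `q`, `q'`, using each as a competitor for the other puts the
    -- remainder between 0 and `⟪q' - q, v - v'⟫`. Strong monotonicity gives `‖v - v'‖ ≤ c⁻¹ ‖q' -
    -- q‖`.
    refine Asymptotics.IsBigO.of_bound c⁻¹ (Eventually.of_forall fun q' => ?_)
    obtain ⟨v', hv'⟩ := exists_gradient_eq hc hd hm q'
    obtain ⟨h1, h2⟩ := legendre_eq hc hd hm hv
    obtain ⟨h3, h4⟩ := legendre_eq hc hd hm hv'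
    have h5 := h1 v'
    have h6 := h3 v
    have h7 := hm v v'
    rw [hv, hv'] at h7
    have h8 : -q - -q' = q' - q := by abel
    rw [h8] at h7
    have h9 := h7.trans (real_inner_le_norm _ _)
    have h10 : ‖v - v'‖ ≤ c⁻¹ * ‖q' - q‖ := by
      rcases (norm_nonneg (v - v')).eq_or_lt with h0 | h0
      · rw [← h0]
        positivity
      · rw [inv_mul_eq_div, le_div_iff₀ hc]
        nlinarith
    have h11 : ⟪q' - q, v - v'⟫ ≤ c⁻¹ * ‖q' - q‖ ^ 2 := by
      refine (real_inner_le_norm _ _).trans ?_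
      nlinarith [norm_nonneg (q' - q)]
    rw [h2, h4, inner_neg_left, real_inner_comm (q' - q) v, Real.norm_eq_abs, norm_pow, norm_norm,
      abs_of_nonneg]
    · simp only [inner_sub_left, inner_sub_right] at h11 ⊢
      linarith
    · simp only [inner_sub_left] at h5 ⊢
      linarith
  refine hO.trans_isLittleO ?_
  have h1 : (fun q' : V => ‖q' - q‖ ^ 2) =o[𝓝 q] fun q' => ‖q' - q‖ := by
    have h2 : Tendsto (fun q' : V => ‖q' - q‖) (𝓝 q) (𝓝 0) := by
      have : Continuous fun q' : V => ‖q' - q‖ := by fun_prop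
      simpa using this.tendsto q
    simpa [Function.comp_def] using
      (Asymptotics.isLittleO_pow_pow (𝕜 := ℝ) (m := 1) (n := 2) (by norm_num)).comp_tendsto h2
  exact h1.of_norm_right

end Legendre

/-! ### Lagrangian and Hamiltonian along an optimal feedback -/

namespace Data

variable {d k : ℕ} {D : Data d k}

/-- The Legendre results identify `Hp z q` with minus the maximizer, so the feedback law places `v`
exactly where the supremum defining `H` is attained. -/
theorem Assumptions.optimality {c : ℝ} (hc : 0 < c) (hD : D.Assumptions)
    (hm : ∀ z ∈ cyl d D.T, ∀ v v' : E d, c * ‖v - v'‖ ^ 2 ≤ ⟪D.Lv z v - D.Lv z v', v - v'⟫)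
    {z : Torus d × ℝ} (hz : z ∈ cyl d D.T) {q v : E d} (hv : v = -D.Hp z q) :
    D.Lv z v = -q ∧ D.H z q = -⟪q, v⟫ - D.L z v := by
  obtain ⟨w, hw⟩ := exists_gradient_eq hc (hD.L_diff z hz) (hm z hz) q
  have h1 : D.Hp z q = -w :=
    (hasGradientAt_legendre hc (hD.L_diff z hz) (hm z hz) hw).gradient
  rw [h1, neg_neg] at hv
  subst hv
  exact ⟨hw, (legendre_eq hc (hD.L_diff z hz) (hm z hz) hw).2⟩

/-- The running cost of a competitor is bounded below in terms of the Hamiltonian. -/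
theorem Assumptions.cost_sub_ge {c : ℝ} (hc : 0 < c) (hD : D.Assumptions)
    (hm : ∀ z ∈ cyl d D.T, ∀ v v' : E d, c * ‖v - v'‖ ^ 2 ≤ ⟪D.Lv z v - D.Lv z v', v - v'⟫)
    {z : Torus d × ℝ} (hz : z ∈ cyl d D.T) {q v : E d} (hv : v = -D.Hp z q) (w : E d)
    {μ μ' : ℝ} (hμ : 0 ≤ μ) :
    -D.H z q * (μ - μ') - ⟪q, μ • w - μ' • v⟫ + c / 2 * (‖w - v‖ ^ 2 * μ) ≤
      D.L z w * μ - D.L z v * μ' := by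
  obtain ⟨h1, h2⟩ := hD.optimality hc hm hz hv
  have h3 := le_of_strongly_monotone_gradient (hD.L_diff z hz) (hm z hz) v w
  have h4 : gradient (D.L z) v = -q := h1
  rw [h4, inner_neg_left, inner_sub_right] at h3
  have h5 := mul_le_mul_of_nonneg_right h3 hμ
  rw [h2, inner_sub_right, inner_smul_right, inner_smul_right]
  nlinarith

end Data

/-! ### Finiteness of the potential cost -/

section Cost

variable {d k : ℕ} {D : Data d k} {M B : ℝ} {m : Torus d × ℝ → ℝ} {v v₁ : Torus d × ℝ → E d}

/-- The retraction of `ℝ` onto `[0,T]`. -/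
def clampTime (T t : ℝ) : ℝ := max 0 (min T t)

theorem continuous_clampTime (T : ℝ) : Continuous (clampTime T) := by
  unfold clampTime
  fun_prop

theorem clampTime_mem {T : ℝ} (hT : 0 ≤ T) (t : ℝ) : clampTime T t ∈ Icc 0 T :=
  ⟨le_max_left _ _, max_le hT (min_le_left _ _)⟩

theorem clampTime_of_mem {T t : ℝ} (ht : t ∈ Icc 0 T) : clampTime T t = t := by
  simp [clampTime, ht.1, ht.2]

namespace Data

/-- Hölder bounds are available on each ball of velocities; at a given point the ball of radius `‖v‖
+ 1` is a neighbourhood of `v`. -/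
theorem Assumptions.continuous_L (hD : D.Assumptions) :
    Continuous fun q : (Torus d × ℝ) × E d => D.L (clamp D.T q.1) q.2 := by
  refine continuous_iff_continuousAt.2 fun q => ?_
  obtain ⟨α, hα, -, ⟨K, hK⟩, -⟩ := hD.holder_loc (‖q.2‖ + 1) (by positivity)
  have h1 : ContinuousOn (fun q : (Torus d × ℝ) × E d => D.L (clamp D.T q.1) q.2)
      (univ ×ˢ Metric.closedBall 0 (‖q.2‖ + 1)) := by
    refine (hK.continuousOn hα).comp (f := fun q : (Torus d × ℝ) × E d => (clamp D.T q.1, q.2))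
      ((continuous_clamp.comp continuous_fst).prodMk continuous_snd).continuousOn fun q hq => ?_
    exact ⟨clamp_mem hD.T_pos.le _, hq.2⟩
  refine h1.continuousAt (prod_mem_nhds univ_mem ?_)
  refine mem_of_superset (Metric.ball_mem_nhds q.2 one_pos) fun w hw => ?_
  rw [Metric.mem_ball, dist_eq_norm] at hw
  rw [mem_closedBall_zero_iff]
  have := norm_sub_norm_le w q.2
  linarith

theorem Assumptions.continuous_a (hD : D.Assumptions) : Continuous (D.a ∘ clamp D.T) := by
  obtain ⟨α, hα, -, ⟨K, hK⟩, -⟩ := hD.a_holder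
  exact ContinuousOn.comp_clamp hD.T_pos.le (hK.continuousOn hα)

/-- A convex function lies above its tangent: restrict to the line through `z` and `w` and compare
the derivative at 0 with the slope on `[0, 1]`. -/
theorem Assumptions.Φ_sub_ge (hD : D.Assumptions) {t : ℝ} (ht : t ∈ Icc 0 D.T) (z w : E k) :
    ⟪D.φ t z, w - z⟫ ≤ D.Φ t w - D.Φ t z := by
  have h1 : ConvexOn ℝ univ fun s : ℝ => D.Φ t (z + s • (w - z)) := by
    have := (hD.Φ_convex t ht).comp_affineMap (AffineMap.lineMap z w : ℝ →ᵃ[ℝ] E k)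
    rw [preimage_univ] at this
    refine this.congr fun s _ => ?_
    simp only [Function.comp_apply, AffineMap.lineMap_apply, vsub_eq_sub, vadd_eq_add]
    rw [add_comm]
  have h2 : HasDerivAt (fun s : ℝ => z + s • (w - z)) (w - z) 0 := by
    simpa using ((hasDerivAt_id (0 : ℝ)).smul_const (w - z)).const_add z
  have h3 : HasFDerivAt (D.Φ t) (InnerProductSpace.toDual ℝ (E k) (D.φ t z))
      (z + (0 : ℝ) • (w - z)) := by
    rw [zero_smul, add_zero]
    exact (hD.Φ_grad t ht z).hasFDerivAt
  have h4 := h3.comp_hasDerivAt (0 : ℝ) h2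
  rw [InnerProductSpace.toDual_apply_apply] at h4
  have h5 := h1.le_slope_of_hasDerivAt (mem_univ 0) (mem_univ 1) one_pos h4
  simpa [slope_def_field] using h5

end Data

namespace IsAdmissible

variable (hD : D.Assumptions) (h : IsAdmissible D.T M B m v v₁)

theorem smul_ae_eq {T : ℝ} (h : IsAdmissible T M B m v v₁) :
    (fun z => m z • v z) =ᵐ[cylMeasure d T] fun z => (m ∘ clamp T) z • v₁ z := by
  filter_upwards [comp_clamp_ae_eq m, h.ae_eq] with z h1 h2
  rw [h1, h2]

theorem slice_eq {V : Type*} (u : Torus d × ℝ → V) {T t : ℝ} (ht : t ∈ Icc 0 T) :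
    (fun x => u (x, t)) = fun x => (u ∘ clamp T) (x, t) :=
  funext fun x => by rw [Function.comp_apply, clamp_mk ht]

theorem norm_flux_le {T : ℝ} (h : IsAdmissible T M B m v v₁) (z : Torus d × ℝ) :
    ‖(m ∘ clamp T) z • v₁ z‖ ≤ M * B :=
  (h.fp.flux z).trans (mul_le_mul_of_nonneg_left (h.fp.bdd z) h.fp.M_nonneg)

include hD h

theorem nonneg (h0 : ∀ x, m (x, 0) = D.m₀ x) {t : ℝ} (ht : t ∈ Icc 0 D.T) (x : Torus d) :
    0 ≤ m (x, t) := by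
  obtain ⟨ε, hε, hm₀⟩ := hD.m₀_pos
  have h1 : ∀ {s : ℝ}, s ∈ Icc 0 D.T → (m ∘ clamp D.T) (x, s) = m (x, s) := fun hs =>
    (congrFun (slice_eq m hs) x).symm
  rw [← h1 ht]
  refine h.fp.nonneg (fun y => ?_) ht x
  rw [← congrFun (slice_eq m ⟨le_rfl, hD.T_pos.le⟩) y, h0]
  exact hε.le.trans (hm₀ y)

/-- Positivity and conservation of mass make every time slice a legitimate argument of `f` and `F`.
-/
theorem mem_D1 (h0 : ∀ x, m (x, 0) = D.m₀ x) {t : ℝ} (ht : t ∈ Icc 0 D.T) :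
    (fun x => m (x, t)) ∈ D1 d := by
  refine ⟨?_, Eventually.of_forall fun x => h.nonneg hD h0 ht x, ?_⟩
  · rw [slice_eq m ht]
    refine memLp_top_of_bound (C := B) ?_ (Eventually.of_forall fun x => h.fp.bdd _)
    exact (h.fp.cont.comp (Continuous.prodMk_left t)).aestronglyMeasurable
  · rw [slice_eq m ht, h.fp.integral_eq ht, ← slice_eq m ⟨le_rfl, hD.T_pos.le⟩, funext h0]
    exact hD.m₀_mem.2.2

theorem integrable_cost : Integrable (fun z => D.L z (v z) * m z) (cylMeasure d D.T) := by
  have hL := hD.continuous_L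
  obtain ⟨C, hC⟩ := ((isCompact_cyl d D.T).prod
    (isCompact_closedBall (0 : E d) M)).exists_bound_of_continuousOn hL.continuousOn
  have h1 : Measurable fun z => D.L (clamp D.T z) (v₁ z) :=
    hL.measurable.comp (measurable_id.prodMk h.meas)
  have h2 : Integrable (fun z => D.L (clamp D.T z) (v₁ z) * (m ∘ clamp D.T) z)
      (cylMeasure d D.T) := by
    refine (integrable_cyl_of_continuous h.fp.cont).bdd_mul (c := C) h1.aestronglyMeasurable
      (ae_mem_cyl.mono fun z hz => hC (z, v₁ z) ⟨hz, ?_⟩)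
    rw [mem_closedBall_zero_iff]
    exact h.bound z
  refine h2.congr ?_
  filter_upwards [ae_mem_cyl, h.ae_eq] with z h3 h4
  rw [Function.comp_apply, clamp_of_mem h3, h4]

theorem stronglyMeasurable_a :
    StronglyMeasurable fun z => (D.a ∘ clamp D.T) z ((m ∘ clamp D.T) z • v₁ z) :=
  isBoundedBilinearMap_apply.continuous.comp_stronglyMeasurable
    (hD.continuous_a.stronglyMeasurable.prodMk h.fp.meas.stronglyMeasurable)

theorem exists_norm_a_le : ∃ C, 0 ≤ C ∧
    ∀ z, ‖(D.a ∘ clamp D.T) z ((m ∘ clamp D.T) z • v₁ z)‖ ≤ C := by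
  obtain ⟨C, hC⟩ := (isCompact_cyl d D.T).exists_bound_of_continuousOn
    hD.continuous_a.continuousOn
  have hC' : ∀ z, ‖(D.a ∘ clamp D.T) z‖ ≤ C := fun z => by
    have := hC _ (clamp_mem hD.T_pos.le z)
    rwa [Function.comp_apply, clamp_of_mem (clamp_mem hD.T_pos.le z)] at this
  have hMB : 0 ≤ M * B := (norm_nonneg _).trans (h.norm_flux_le (0, 0))
  refine ⟨C * (M * B), mul_nonneg ((norm_nonneg _).trans (hC' (0, 0))) hMB, fun z => ?_⟩
  refine (ContinuousLinearMap.le_opNorm _ _).trans ?_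
  exact mul_le_mul (hC' z) (h.norm_flux_le z) (norm_nonneg _) ((norm_nonneg _).trans (hC' z))

omit hD in
theorem A_ae_eq : D.A (fun z => m z • v z) =ᵐ[volume.restrict (Icc 0 D.T)]
    fun t => ∫ x, (D.a ∘ clamp D.T) (x, t) ((m ∘ clamp D.T) (x, t) • v₁ (x, t)) := by
  have h2 : ∀ᵐ s ∂(volume.restrict (Icc 0 D.T) : Measure ℝ), s ∈ Icc 0 D.T :=
    ae_restrict_mem measurableSet_Icc
  filter_upwards [ae_ae_of_ae_cyl h.smul_ae_eq, h2] with t h1 ht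
  rw [Data.A]
  refine integral_congr_ae (h1.mono fun x hx => ?_)
  simp only [hx]
  rw [Function.comp_apply (f := D.a), clamp_mk ht]

theorem stronglyMeasurable_A : StronglyMeasurable fun t =>
    ∫ x, (D.a ∘ clamp D.T) (x, t) ((m ∘ clamp D.T) (x, t) • v₁ (x, t)) := by
  have h1 : StronglyMeasurable (Function.uncurry fun (t : ℝ) (x : Torus d) =>
      (D.a ∘ clamp D.T) (x, t) ((m ∘ clamp D.T) (x, t) • v₁ (x, t))) :=
    (h.stronglyMeasurable_a hD).comp_measurable measurable_swap
  exact h1.integral_prod_right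

theorem exists_norm_A_le : ∃ C, ∀ t,
    ‖∫ x, (D.a ∘ clamp D.T) (x, t) ((m ∘ clamp D.T) (x, t) • v₁ (x, t))‖ ≤ C := by
  obtain ⟨C, -, hC⟩ := h.exists_norm_a_le hD
  refine ⟨C, fun t => ?_⟩
  simpa using norm_integral_le_of_norm_le_const (μ := (volume : Measure (Torus d)))
    (Eventually.of_forall fun x => hC (x, t))

/-- The duality between `A` and `A⋆`. -/
theorem integral_Astar {P : ℝ → E k} (hP : ContinuousOn P (Icc 0 D.T)) :
    Integrable (fun z => ⟪D.Astar P z, m z • v z⟫) (cylMeasure d D.T) ∧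
    IntegrableOn (fun t => ⟪P t, D.A (fun z => m z • v z) t⟫) (Icc 0 D.T) ∧
    ∫ z, ⟪D.Astar P z, m z • v z⟫ ∂cylMeasure d D.T =
      ∫ t in Icc 0 D.T, ⟪P t, D.A (fun z => m z • v z) t⟫ := by
  have hPc : Continuous fun t => P (clampTime D.T t) :=
    hP.comp_continuous (continuous_clampTime _) (clampTime_mem hD.T_pos.le)
  set a₁ : Torus d × ℝ → E k := fun z => (D.a ∘ clamp D.T) z ((m ∘ clamp D.T) z • v₁ z) with ha₁
  obtain ⟨C, hC0, hC⟩ := h.exists_norm_a_le hD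
  obtain ⟨K, hK⟩ := isCompact_Icc.exists_bound_of_continuousOn hP
  have hK' : ∀ t, ‖P (clampTime D.T t)‖ ≤ K := fun t => hK _ (clampTime_mem hD.T_pos.le t)
  have hFm : Measurable fun z : Torus d × ℝ => ⟪P (clampTime D.T z.2), a₁ z⟫ :=
    (StronglyMeasurable.inner (hPc.comp continuous_snd).stronglyMeasurable
      (h.stronglyMeasurable_a hD)).measurable
  have hFb : ∀ z : Torus d × ℝ, |⟪P (clampTime D.T z.2), a₁ z⟫| ≤ K * C := fun z =>
    (abs_real_inner_le_norm _ _).trans (mul_le_mul (hK' _) (hC z) (norm_nonneg _)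
      ((norm_nonneg _).trans (hK' 0)))
  have hFi := integrable_cyl_of_bound (T := D.T) hFm fun x s _ => hFb (x, s)
  have hae : (fun z : Torus d × ℝ => ⟪P (clampTime D.T z.2), a₁ z⟫) =ᵐ[cylMeasure d D.T]
      fun z => ⟪D.Astar P z, m z • v z⟫ := by
    filter_upwards [ae_mem_cyl, h.smul_ae_eq] with z h1 h2
    simp only [ha₁]
    rw [Data.Astar, ContinuousLinearMap.adjoint_inner_left, h2, clampTime_of_mem h1.2,
      Function.comp_apply (f := D.a), clamp_of_mem h1]
  have hae2 : (fun t => ∫ x, ⟪P (clampTime D.T t), a₁ (x, t)⟫) =ᵐ[volume.restrict (Icc 0 D.T)]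
      fun t => ⟪P t, D.A (fun z => m z • v z) t⟫ := by
    have h2 : ∀ᵐ s ∂(volume.restrict (Icc 0 D.T) : Measure ℝ), s ∈ Icc 0 D.T :=
      ae_restrict_mem measurableSet_Icc
    filter_upwards [h.A_ae_eq, h2] with t h3 ht
    have hi : Integrable fun x => a₁ (x, t) := Integrable.of_bound (C := C)
      ((h.stronglyMeasurable_a hD).comp_measurable
        (measurable_id.prodMk measurable_const)).aestronglyMeasurable
      (Eventually.of_forall fun x => hC _)
    rw [integral_inner hi, h3, clampTime_of_mem ht]
  refine ⟨hFi.congr hae, ?_, ?_⟩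
  · refine IntegrableOn.congr_fun_ae ?_ hae2
    rw [cylMeasure_eq] at hFi
    exact hFi.integral_prod_right
  · rw [← integral_congr_ae hae, ← integral_congr_ae hae2]
    exact integral_cyl hFi

/-- Tangent inequalities at 0 and at `A[mv](t)`, with φ bounded, trap the integrand within a
constant of `Φ t 0`, which is integrable. Clamping time yields measurability, since `Φ` is
measurable only over `[0, T]`. -/
theorem integrable_Φ : IntegrableOn (fun t => D.Φ t (D.A (fun z => m z • v z) t)) (Icc 0 D.T) := by
  set A₁ : ℝ → E k := fun t =>
    ∫ x, (D.a ∘ clamp D.T) (x, t) ((m ∘ clamp D.T) (x, t) • v₁ (x, t)) with hA₁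
  obtain ⟨C, hC⟩ := h.exists_norm_A_le hD
  obtain ⟨K, hK0, hK⟩ := hD.φ_bdd
  have hτ : Measurable fun t => (⟨clampTime D.T t, clampTime_mem hD.T_pos.le t⟩ : Icc 0 D.T) :=
    (continuous_clampTime D.T).measurable.subtype_mk
  have hm1 : Measurable fun t => D.Φ (clampTime D.T t) (A₁ t) :=
    hD.Φ_meas.comp (hτ.prodMk (h.stronglyMeasurable_A hD).measurable)
  have hmem : ∀ᵐ s ∂(volume.restrict (Icc 0 D.T) : Measure ℝ), s ∈ Icc 0 D.T :=
    ae_restrict_mem measurableSet_Icc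
  have hint : IntegrableOn (fun t => |D.Φ t 0| + K * C) (Icc 0 D.T) :=
    (hD.Φ_int 0).abs.add (integrable_const _)
  refine Integrable.mono' hint ?_ ?_
  · refine hm1.aestronglyMeasurable.congr ?_
    filter_upwards [hmem, h.A_ae_eq] with t ht h1
    rw [h1, clampTime_of_mem ht]
  · filter_upwards [hmem, h.A_ae_eq] with t ht h1
    have hle : ‖D.A (fun z => m z • v z) t‖ ≤ C := by
      rw [h1]
      exact hC t
    set z := D.A (fun z => m z • v z) t
    have h2 := hD.Φ_sub_ge ht 0 z
    have h3 := hD.Φ_sub_ge ht z 0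
    have h4 : ∀ y, |⟪D.φ t y, z⟫| ≤ K * C := fun y =>
      (abs_real_inner_le_norm _ _).trans (mul_le_mul (hK t ht y) hle (norm_nonneg _) hK0.le)
    have h5 := abs_le.1 (h4 0)
    have h6 := abs_le.1 (h4 z)
    rw [sub_zero] at h2
    rw [zero_sub, inner_neg_right] at h3
    rw [Real.norm_eq_abs, abs_le]
    have h7 := abs_le.1 (le_refl |D.Φ t 0|)
    constructor <;> linarith

end IsAdmissible

end Cost

/-! ### The congestion potential -/

section Congestion

variable {d k : ℕ} {D : Data d k}

theorem convex_combination_mem_D1 {m₁ m₂ : Torus d → ℝ} (h₁ : m₁ ∈ D1 d) (h₂ : m₂ ∈ D1 d) {s : ℝ}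
    (hs : s ∈ Icc (0 : ℝ) 1) : s • m₂ + (1 - s) • m₁ ∈ D1 d := by
  refine ⟨(h₂.1.const_smul s).add (h₁.1.const_smul (1 - s)), ?_, ?_⟩
  · filter_upwards [h₁.2.1, h₂.2.1] with x h3 h4
    simp only [Pi.add_apply, Pi.smul_apply, smul_eq_mul]
    have := sub_nonneg.2 hs.2
    have := hs.1
    positivity
  · have h3 : Integrable m₁ := h₁.1.integrable le_top
    have h4 : Integrable m₂ := h₂.1.integrable le_top
    have h5 : ∫ x, (s • m₂ + (1 - s) • m₁) x = s * (∫ x, m₂ x) + (1 - s) * ∫ x, m₁ x := by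
      simp only [Pi.add_apply, Pi.smul_apply, smul_eq_mul]
      rw [integral_add (h4.const_mul s) (h3.const_mul (1 - s)), integral_const_mul,
        integral_const_mul]
    rw [h5, h₁.2.2, h₂.2.2]
    ring

/-- The torus has volume one, so uniform estimates can be fed into the `L²` continuity assumption on
`f`. -/
theorem toReal_eLpNorm_le {u : Torus d → ℝ} {C : ℝ} (hC0 : 0 ≤ C) (hC : ∀ᵐ x, |u x| ≤ C) :
    (eLpNorm u 2 volume).toReal ≤ C := by
  have h1 := eLpNorm_le_of_ae_bound (f := u) (C := C) (p := 2) (μ := (volume : Measure (Torus d))) hC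
  refine ENNReal.toReal_le_of_le_ofReal hC0 (h1.trans (le_of_eq ?_))
  simp

namespace Data

theorem Assumptions.continuous_f (hD : D.Assumptions) {t : ℝ} (ht : t ∈ Icc 0 D.T)
    {m : Torus d → ℝ} (hm : m ∈ D1 d) : Continuous fun x => D.f (x, t) m := by
  obtain ⟨α, hα, -, C, hC, h⟩ := hD.f_holder
  refine (LipschitzWith.of_dist_le_mul (K := C.toNNReal) fun x y => ?_).continuous
  have := h y x t ht t ht m hm m hm
  rw [sub_self, abs_zero, Real.zero_rpow hα.ne', sub_self, eLpNorm_zero, ENNReal.toReal_zero,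
    add_zero, add_zero] at this
  rwa [Real.dist_eq, Real.coe_toNNReal C hC.le]

theorem Assumptions.f_sub_le (hD : D.Assumptions) : ∃ C, 0 < C ∧ ∀ x, ∀ t ∈ Icc 0 D.T,
    ∀ m₁ ∈ D1 d, ∀ m₂ ∈ D1 d, ∀ r, 0 ≤ r → (∀ᵐ x, |(m₂ - m₁) x| ≤ r) →
      |D.f (x, t) m₂ - D.f (x, t) m₁| ≤ C * r := by
  obtain ⟨α, hα, -, C, hC, h⟩ := hD.f_holder
  refine ⟨C, hC, fun x t ht m₁ h₁ m₂ h₂ r hr hb => ?_⟩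
  have := h x x t ht t ht m₁ h₁ m₂ h₂
  rw [dist_self, sub_self, abs_zero, Real.zero_rpow hα.ne', zero_add, zero_add] at this
  exact this.trans (mul_le_mul_of_nonneg_left (toReal_eLpNorm_le hr hb) hC.le)

/-- Convexity of the potential `F` of a monotone function. -/
theorem Assumptions.F_sub_ge (hD : D.Assumptions) {t : ℝ} (ht : t ∈ Icc 0 D.T)
    {m₁ m₂ : Torus d → ℝ} (h₁ : m₁ ∈ D1 d) (h₂ : m₂ ∈ D1 d) :
    ∫ x, D.f (x, t) m₁ * (m₂ x - m₁ x) ≤ D.F t m₂ - D.F t m₁ := by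
  rw [hD.F_primitive t ht m₁ h₁ m₂ h₂]
  obtain ⟨C₀, hC₀, hfb⟩ := hD.f_bdd
  obtain ⟨C, hC, hfl⟩ := hD.f_sub_le
  have hdm : MemLp (fun x => m₂ x - m₁ x) ∞ volume := h₂.1.sub h₁.1
  have hdi : Integrable fun x => m₂ x - m₁ x := hdm.integrable le_top
  obtain ⟨w, R, hR0, -, hR, hw⟩ := exists_bounded_representative hdm
  have hRb : ∀ᵐ x, |m₂ x - m₁ x| ≤ R := hw.mono fun x hx => by
    have := hR x
    rwa [← hx] at this
  have hi : ∀ m ∈ D1 d, Integrable fun x => D.f (x, t) m * (m₂ x - m₁ x) := fun m hm =>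
    hdi.bdd_mul (c := C₀) (hD.continuous_f ht hm).aestronglyMeasurable
      (Eventually.of_forall fun x => hfb (x, t) ⟨mem_univ _, ht⟩ m hm)
  have hs : ∀ s ∈ Icc (0 : ℝ) 1, s • m₂ + (1 - s) • m₁ ∈ D1 d := fun s hs =>
    convex_combination_mem_D1 h₁ h₂ hs
  -- Lipschitz dependence on `s` ensures that the integrand in the formula for `F` is interval
  -- integrable, as the comparison of integrals requires.
  have hlip : LipschitzOnWith (C * R * R).toNNReal
      (fun s : ℝ => ∫ x, D.f (x, t) (s • m₂ + (1 - s) • m₁) * (m₂ x - m₁ x)) (Icc 0 1) := by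
    refine LipschitzOnWith.of_dist_le_mul fun s hs1 s' hs2 => ?_
    rw [Real.coe_toNNReal _ (by positivity), Real.dist_eq, Real.dist_eq,
      ← integral_sub (hi _ (hs s hs1)) (hi _ (hs s' hs2))]
    have := norm_integral_le_of_norm_le_const (μ := (volume : Measure (Torus d)))
      (f := fun x => D.f (x, t) (s • m₂ + (1 - s) • m₁) * (m₂ x - m₁ x) -
        D.f (x, t) (s' • m₂ + (1 - s') • m₁) * (m₂ x - m₁ x)) (C := C * R * R * |s - s'|)
      (hRb.mono fun x hx => by
        rw [← sub_mul, norm_mul, Real.norm_eq_abs, Real.norm_eq_abs]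
        have h3 := hfl x t ht _ (hs s' hs2) _ (hs s hs1) (|s - s'| * R) (by positivity)
          (hRb.mono fun y hy => by
            simp only [Pi.add_apply, Pi.sub_apply, Pi.smul_apply, smul_eq_mul]
            rw [show s * m₂ y + (1 - s) * m₁ y - (s' * m₂ y + (1 - s') * m₁ y) =
              (s - s') * (m₂ y - m₁ y) by ring, abs_mul]
            exact mul_le_mul_of_nonneg_left hy (abs_nonneg _))
        calc _ ≤ C * (|s - s'| * R) * R := mul_le_mul h3 hx (abs_nonneg _) (by positivity)
          _ = _ := by ring)
    simpa using this
  have hc : ∫ x, D.f (x, t) m₁ * (m₂ x - m₁ x) =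
      ∫ _s in (0 : ℝ)..1, ∫ x, D.f (x, t) m₁ * (m₂ x - m₁ x) := by simp
  rw [hc]
  refine intervalIntegral.integral_mono_on zero_le_one (by simp)
    (ContinuousOn.intervalIntegrable_of_Icc zero_le_one hlip.continuousOn) fun s hs1 => ?_
  rcases hs1.1.eq_or_lt with rfl | hs0
  · simp
  -- Monotonicity is applied between `m₁` and the combination at parameter `s`, whose difference is
  -- `s (m₂ - m₁)`; the factor `s > 0` is then divided out.
  have h3 := hD.f_mono t ht m₁ h₁ _ (hs s hs1)
  have h4 : ∀ x, (D.f (x, t) (s • m₂ + (1 - s) • m₁) - D.f (x, t) m₁) *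
      ((s • m₂ + (1 - s) • m₁) x - m₁ x) = s * (D.f (x, t) (s • m₂ + (1 - s) • m₁) *
        (m₂ x - m₁ x) - D.f (x, t) m₁ * (m₂ x - m₁ x)) := fun x => by
    simp only [Pi.add_apply, Pi.smul_apply, smul_eq_mul]
    ring
  simp_rw [h4] at h3
  rw [integral_const_mul, integral_sub (hi _ (hs s hs1)) (hi _ h₁)] at h3
  exact sub_nonneg.1 (nonneg_of_mul_nonneg_right h3 hs0)

/-- The congestion cost along a continuous curve of continuous densities is continuous. -/
theorem Assumptions.continuous_f_comp (hD : D.Assumptions) {X : Type*} [TopologicalSpace X]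
    {τ : X → ℝ} (hτ : Continuous τ) (hτm : ∀ p, τ p ∈ Icc 0 D.T) (N : C(X × Torus d, ℝ))
    (hN : ∀ p, (fun x => N (p, x)) ∈ D1 d) :
    Continuous fun q : X × Torus d => D.f (q.2, τ q.1) fun x => N (q.1, x) := by
  obtain ⟨α, hα, -, C, hC, h⟩ := hD.f_holder
  refine continuous_iff_continuousAt.2 fun q₀ => ?_
  rw [ContinuousAt, tendsto_iff_norm_sub_tendsto_zero]
  -- Currying the jointly continuous `N` over the compact torus gives continuity of the densities in
  -- sup norm, which dominates the `L²` norm.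
  have hbound : Continuous fun q : X × Torus d =>
      C * (dist q.2 q₀.2 + |τ q.1 - τ q₀.1| ^ α + ‖N.curry q.1 - N.curry q₀.1‖) := by
    have h1 : Continuous fun q : X × Torus d => |τ q.1 - τ q₀.1| ^ α :=
      Continuous.rpow_const (by fun_prop) fun _ => Or.inr hα.le
    have h2 : Continuous fun q : X × Torus d => ‖N.curry q.1 - N.curry q₀.1‖ :=
      ((N.curry.continuous.comp continuous_fst).sub continuous_const).norm
    exact continuous_const.mul (((continuous_snd.dist continuous_const).add h1).add h2)
  have hlim := hbound.tendsto q₀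
  simp only [dist_self, sub_self, abs_zero, Real.zero_rpow hα.ne', norm_zero, add_zero,
    mul_zero] at hlim
  refine squeeze_zero (fun _ => norm_nonneg _) (fun q => ?_) hlim
  refine (h q₀.2 q.2 _ (hτm _) _ (hτm _) _ (hN _) _ (hN _)).trans ?_
  refine mul_le_mul_of_nonneg_left (add_le_add le_rfl ?_) hC.le
  exact toReal_eLpNorm_le (norm_nonneg _) (Eventually.of_forall fun x =>
    (N.curry q.1 - N.curry q₀.1).norm_coe_le_norm x)

end Data

theorem one_mem_D1 (d : ℕ) : (fun _ : Torus d => (1 : ℝ)) ∈ D1 d :=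
  ⟨memLp_const 1, Eventually.of_forall fun _ => zero_le_one, by simp⟩

namespace IsAdmissible

variable {M B : ℝ} {m : Torus d × ℝ → ℝ} {v v₁ : Torus d × ℝ → E d} (hD : D.Assumptions)
  (h : IsAdmissible D.T M B m v v₁)

include hD h

/-- `F` is known to be integrable in time only at a fixed density, so the constant density 1 serves
as reference. By the primitive formula the difference `F(t, m(t)) - F(t, 1)` is a continuous
function of `t`. -/
theorem integrable_F (h0 : ∀ x, m (x, 0) = D.m₀ x) :
    IntegrableOn (fun t => D.F t fun x => m (x, t)) (Icc 0 D.T) := by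
  have hT := hD.T_pos
  have hmc := h.fp.cont
  set N : C((ℝ × ℝ) × Torus d, ℝ) := ⟨fun q => clampTime 1 q.1.2 * (m ∘ clamp D.T) (q.2, q.1.1) +
    (1 - clampTime 1 q.1.2), by
      have := (continuous_clampTime 1).comp (continuous_snd.comp
        (continuous_fst : Continuous fun q : (ℝ × ℝ) × Torus d => q.1))
      exact (this.mul (hmc.comp (by fun_prop))).add (continuous_const.sub this)⟩ with hN
  have hslice : ∀ t, (fun x => (m ∘ clamp D.T) (x, t)) ∈ D1 d := fun t =>
    h.mem_D1 hD h0 (clampTime_mem hT.le t)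
  have hND : ∀ p, (fun x => N (p, x)) ∈ D1 d := fun p => by
    have := convex_combination_mem_D1 (one_mem_D1 d) (hslice p.1) (clampTime_mem zero_le_one p.2)
    convert this using 1
    funext x
    simp [hN]
  have hfc := hD.continuous_f_comp (τ := fun p : ℝ × ℝ => clampTime D.T p.1)
    ((continuous_clampTime _).comp continuous_fst) (fun p => clampTime_mem hT.le _) N hND
  have hgc : Continuous fun q : (ℝ × ℝ) × Torus d =>
      D.f (q.2, clampTime D.T q.1.1) (fun x => N (q.1, x)) * ((m ∘ clamp D.T) (q.2, q.1.1) - 1) :=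
    hfc.mul ((hmc.comp (by fun_prop)).sub continuous_const)
  have hic : Continuous fun p : ℝ × ℝ => ∫ x, D.f (x, clampTime D.T p.1) (fun x => N (p, x)) *
      ((m ∘ clamp D.T) (x, p.1) - 1) := by
    have := continuous_parametric_integral_of_continuous (μ := (volume : Measure (Torus d)))
      (f := fun (p : ℝ × ℝ) x => D.f (x, clampTime D.T p.1) (fun x => N (p, x)) *
        ((m ∘ clamp D.T) (x, p.1) - 1)) hgc isCompact_univ
    simpa using this
  have hIc : Continuous fun t : ℝ => ∫ s in (0 : ℝ)..1, ∫ x,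
      D.f (x, clampTime D.T t) (fun x => N ((t, s), x)) * ((m ∘ clamp D.T) (x, t) - 1) :=
    intervalIntegral.continuous_parametric_intervalIntegral_of_continuous' (f := fun t s => ∫ x,
      D.f (x, clampTime D.T t) (fun x => N ((t, s), x)) * ((m ∘ clamp D.T) (x, t) - 1)) hic 0 1
  have hsum := (hD.F_int _ (one_mem_D1 d)).add
    (hIc.continuousOn.integrableOn_compact (isCompact_Icc (a := 0) (b := D.T)))
  refine hsum.congr_fun (fun t ht => ?_) measurableSet_Icc
  have h1 := hD.F_primitive t ht _ (one_mem_D1 d) _ (h.mem_D1 hD h0 ht)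
  have h2 : ∫ s in (0 : ℝ)..1, ∫ x, D.f (x, clampTime D.T t) (fun x => N ((t, s), x)) *
      ((m ∘ clamp D.T) (x, t) - 1) = (D.F t fun x => m (x, t)) - D.F t fun _ => 1 := by
    rw [h1]
    refine intervalIntegral.integral_congr fun s hs => ?_
    rw [uIcc_of_le zero_le_one] at hs
    have h3 : (fun x => N ((t, s), x)) =
        (s • fun x => m (x, t)) + (1 - s) • fun _ : Torus d => (1 : ℝ) := by
      funext x
      simp [hN, clampTime_of_mem hs, clamp_mk ht]
    simp only [h3, clampTime_of_mem ht, Function.comp_apply, clamp_mk ht]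
  rw [Pi.add_apply, h2, add_sub_cancel]

end IsAdmissible

end Congestion

/-! ### Optimality of solutions of the mean field game system -/

section Optimality

variable {d k : ℕ} {D : Data d k}

namespace IsAdmissible

variable {M B : ℝ} {m : Torus d × ℝ → ℝ} {v v₁ : Torus d × ℝ → E d} (hD : D.Assumptions)
  (h : IsAdmissible D.T M B m v v₁)

include hD h

theorem jFinite (h0 : ∀ x, m (x, 0) = D.m₀ x) : D.JFinite m v := by
  refine ⟨h.integrable_cost hD, h.integrable_F hD h0, h.integrable_Φ hD, ?_⟩
  obtain ⟨α, -, -, -, hg⟩ := hD.boundary_reg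
  have h1 : Continuous fun x => m (x, D.T) := by
    rw [slice_eq m ⟨hD.T_pos.le, le_rfl⟩]
    exact h.fp.cont.comp (Continuous.prodMk_left D.T)
  exact integrable_of_continuous (hg.1.mul h1)

/-- Duality with a classical function, in terms of the original pair. -/
theorem dual_cyl {α : ℝ≥0} (hα : 0 < α) {u : Torus d × ℝ → ℝ} (hu : MemC21 D.T α u) :
    Integrable (fun z => (dt D.T u z + lapx u z) * m z + ⟪gradx u z, m z • v z⟫)
      (cylMeasure d D.T) ∧
    ∫ z, ((dt D.T u z + lapx u z) * m z + ⟪gradx u z, m z • v z⟫) ∂cylMeasure d D.T =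
      (∫ x, u (x, D.T) * m (x, D.T)) - ∫ x, u (x, 0) * m (x, 0) := by
  have hT := hD.T_pos
  have hu' := hu.isC21 hα hT
  set u₁ := u ∘ clamp D.T with hu₁
  set m₁ := m ∘ clamp D.T with hm₁
  have hwc : Continuous fun z => (dt D.T u ∘ clamp D.T) z + lapx u₁ z :=
    hu'.cont_t.add (continuous_finsetSum _ fun i _ => hu'.cont_xx i)
  obtain ⟨C₁, hC₁0, hC₁⟩ := exists_bound_cyl hwc D.T
  choose C₃ hC₃0 hC₃ using fun i => exists_bound_cyl (hu'.cont_x i) D.T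
  have hFi : Integrable (fun z => ((dt D.T u ∘ clamp D.T) z + lapx u₁ z) * m₁ z +
      ∑ i, dx i u₁ z * (m₁ z • v₁ z) i) (cylMeasure d D.T) := by
    refine integrable_cyl_of_bound (C := C₁ * B + ∑ i, C₃ i * (M * B)) ?_ fun x s hs => ?_
    · exact (hwc.mul h.fp.cont).measurable.add (Finset.measurable_sum _ fun i _ =>
        (hu'.cont_x i).measurable.mul (h.fp.measurable_coord i))
    · refine (abs_add_le _ _).trans (add_le_add ?_ ((Finset.abs_sum_le_sum_abs _ _).trans
        (Finset.sum_le_sum fun i _ => ?_)))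
      · rw [abs_mul]
        exact mul_le_mul (hC₁ x s hs) (h.fp.bdd _) (abs_nonneg _) hC₁0
      · rw [abs_mul]
        exact mul_le_mul (hC₃ i x s hs) (h.fp.abs_coord_le' _ i) (abs_nonneg _) (hC₃0 i)
  have hae : (fun z => ((dt D.T u ∘ clamp D.T) z + lapx u₁ z) * m₁ z +
      ∑ i, dx i u₁ z * (m₁ z • v₁ z) i) =ᵐ[cylMeasure d D.T]
      fun z => (dt D.T u z + lapx u z) * m z + ⟪gradx u z, m z • v z⟫ := by
    filter_upwards [ae_mem_cyl, h.smul_ae_eq] with z hz h1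
    rw [h1, PiLp.inner_apply]
    simp only [hu₁, hm₁, lapx_comp_clamp, dx_comp_clamp, Function.comp_apply, clamp_of_mem hz,
      gradx]
    congr 1
    exact Finset.sum_congr rfl fun i _ => by simp [mul_comm]
  refine ⟨hFi.congr hae, ?_⟩
  rw [← integral_congr_ae hae, integral_cyl hFi, integral_Icc_eq_integral_Ioc,
    ← intervalIntegral.integral_of_le hT.le]
  refine (h.fp.dual hu').symm.trans ?_
  have h1 : ∀ {t : ℝ}, t ∈ Icc 0 D.T → ∀ x, u₁ (x, t) * m₁ (x, t) = u (x, t) * m (x, t) :=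
    fun ht x => by simp only [hu₁, hm₁, Function.comp_apply, clamp_mk ht]
  simp only [← hm₁, h1 ⟨hT.le, le_rfl⟩, h1 ⟨le_rfl, hT.le⟩]

theorem integral_congestion {γ : Torus d × ℝ → ℝ} (hγ : ContinuousOn γ (cyl d D.T)) :
    Integrable (fun z => γ z * m z) (cylMeasure d D.T) ∧
    IntegrableOn (fun t => ∫ x, γ (x, t) * m (x, t)) (Icc 0 D.T) ∧
    ∫ z, γ z * m z ∂cylMeasure d D.T = ∫ t in Icc 0 D.T, ∫ x, γ (x, t) * m (x, t) := by
  have hγc := ContinuousOn.comp_clamp hD.T_pos.le hγ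
  have hi : Integrable (fun z => γ z * m z) (cylMeasure d D.T) := by
    refine (integrable_cyl_of_continuous (hγc.mul h.fp.cont)).congr ?_
    filter_upwards [comp_clamp_ae_eq m, comp_clamp_ae_eq γ] with z h1 h2
    rw [Pi.mul_apply, h1, h2]
  refine ⟨hi, ?_, integral_cyl hi⟩
  rw [cylMeasure_eq] at hi
  exact hi.integral_prod_right

theorem integrable_congestion_slice {γ : Torus d × ℝ → ℝ} (hγ : ContinuousOn γ (cyl d D.T))
    {t : ℝ} (ht : t ∈ Icc 0 D.T) : Integrable fun x => γ (x, t) * m (x, t) := by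
  have hγc := ContinuousOn.comp_clamp hD.T_pos.le hγ
  have h1 : (fun x => γ (x, t) * m (x, t)) =
      fun x => (γ ∘ clamp D.T) (x, t) * (m ∘ clamp D.T) (x, t) := by
    funext x
    simp only [Function.comp_apply, clamp_mk ht]
  rw [h1]
  exact integrable_of_continuous ((hγc.comp (Continuous.prodMk_left t)).mul
    (h.fp.cont.comp (Continuous.prodMk_left t)))

omit hD in
theorem integrable_sq {M' B' : ℝ} {m' : Torus d × ℝ → ℝ} {v' v₁' : Torus d × ℝ → E d}
    (h' : IsAdmissible D.T M' B' m' v' v₁') :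
    Integrable (fun z => ‖v z - v' z‖ ^ 2 * m z) (cylMeasure d D.T) := by
  have h1 : Integrable (fun z => ‖v₁ z - v₁' z‖ ^ 2 * (m ∘ clamp D.T) z) (cylMeasure d D.T) := by
    refine (integrable_cyl_of_continuous h.fp.cont).bdd_mul (c := (M + M') ^ 2)
      ((h.meas.sub h'.meas).norm.pow_const 2).aestronglyMeasurable
      (Eventually.of_forall fun z => ?_)
    rw [norm_pow, norm_norm]
    exact pow_le_pow_left₀ (norm_nonneg _)
      ((norm_sub_le _ _).trans (add_le_add (h.bound z) (h'.bound z))) 2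
  refine h1.congr ?_
  filter_upwards [comp_clamp_ae_eq m, h.ae_eq, h'.ae_eq] with z h2 h3 h4
  rw [h2, h3, h4]

end IsAdmissible

theorem Data.IsSolution.exists_isAdmissible (hD : D.Assumptions) {m : Torus d × ℝ → ℝ}
    {v : Torus d × ℝ → E d} {u γ : Torus d × ℝ → ℝ} {P : ℝ → E k}
    (hs : D.IsSolution m v u γ P) : ∃ M B, IsAdmissible D.T M B m v (v ∘ clamp D.T) := by
  obtain ⟨α, hα, -, hm, hv, -⟩ := hs.regular
  exact exists_isAdmissible_of_classical hα hD.T_pos hm hv hs.fp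

/-- Integrates the pointwise cost inequality term by term. `X`, `Y`, `G` stand for the pairings with
ū, with the price and with the congestion cost, `S` for the quadratic gain and `L` for the running
cost. -/
theorem combination_integral_le {Ω : Type*} [MeasurableSpace Ω] {μ : Measure Ω}
    {X X' Y Y' G G' S L L' : Ω → ℝ} {c : ℝ} (x : Integrable X μ) (x' : Integrable X' μ)
    (y : Integrable Y μ) (y' : Integrable Y' μ) (g : Integrable G μ) (g' : Integrable G' μ)
    (s : Integrable S μ) (l : Integrable L μ) (l' : Integrable L' μ)
    (h : ∀ᵐ z ∂μ, -(X z - X' z) - (Y z - Y' z) - (G z - G' z) + c * S z ≤ L z - L' z) :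
    -((∫ z, X z ∂μ) - ∫ z, X' z ∂μ) - ((∫ z, Y z ∂μ) - ∫ z, Y' z ∂μ) -
      ((∫ z, G z ∂μ) - ∫ z, G' z ∂μ) + c * ∫ z, S z ∂μ ≤ (∫ z, L z ∂μ) - ∫ z, L' z ∂μ := by
  have e := integral_mono_ae ((((x.sub x').neg.sub (y.sub y')).sub (g.sub g')).add
    (s.const_mul c)) (l.sub l') h
  rwa [integral_add' (((x.sub x').neg.sub (y.sub y')).sub (g.sub g')) (s.const_mul c),
    integral_sub' ((x.sub x').neg.sub (y.sub y')) (g.sub g'),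
    integral_sub' (x.sub x').neg (y.sub y'), integral_neg', integral_sub' x x', integral_sub' y y',
    integral_sub' g g', integral_sub' l l', integral_const_mul] at e

/-- The quadratic lower bound for the potential cost at a solution. -/
theorem Data.IsSolution.cost_sub_ge (hD : D.Assumptions) {c : ℝ} (hc : 0 < c)
    (hL : ∀ z ∈ cyl d D.T, ∀ v v' : E d, c * ‖v - v'‖ ^ 2 ≤ ⟪D.Lv z v - D.Lv z v', v - v'⟫)
    {m' : Torus d × ℝ → ℝ} {v' : Torus d × ℝ → E d} {u γ : Torus d × ℝ → ℝ} {P : ℝ → E k}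
    (hs : D.IsSolution m' v' u γ P) {M B : ℝ} {m : Torus d × ℝ → ℝ} {v v₁ : Torus d × ℝ → E d}
    (h : IsAdmissible D.T M B m v v₁) (h0 : ∀ x, m (x, 0) = D.m₀ x) :
    c / 2 * ∫ z, ‖v z - v' z‖ ^ 2 * m z ∂cylMeasure d D.T ≤ D.J m v - D.J m' v' := by
  obtain ⟨M', B', h'⟩ := hs.exists_isAdmissible hD
  obtain ⟨α, hα, -, -, -, hu, ⟨Kγ, hγ⟩, ⟨KP, hP⟩⟩ := hs.regular
  have hγc := hγ.continuousOn hα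
  have hPc := hP.continuousOn hα
  have h0' := hs.fp_init
  obtain ⟨f1, f2, f3, f4⟩ := h.jFinite hD h0
  obtain ⟨f1', f2', f3', f4'⟩ := h'.jFinite hD h0'
  obtain ⟨x1, x2⟩ := h.dual_cyl hD hα hu
  obtain ⟨x1', x2'⟩ := h'.dual_cyl hD hα hu
  obtain ⟨y1, y2, y3⟩ := h.integral_Astar hD hPc
  obtain ⟨y1', y2', y3'⟩ := h'.integral_Astar hD hPc
  obtain ⟨g1, g2, g3⟩ := h.integral_congestion hD hγc
  obtain ⟨g1', g2', g3'⟩ := h'.integral_congestion hD hγc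
  have hsq := h.integrable_sq h'
  have hrun : -((∫ z, ((dt D.T u z + lapx u z) * m z + ⟪gradx u z, m z • v z⟫) ∂cylMeasure d D.T) -
        ∫ z, ((dt D.T u z + lapx u z) * m' z + ⟪gradx u z, m' z • v' z⟫) ∂cylMeasure d D.T) -
      ((∫ z, ⟪D.Astar P z, m z • v z⟫ ∂cylMeasure d D.T) -
        ∫ z, ⟪D.Astar P z, m' z • v' z⟫ ∂cylMeasure d D.T) -
      ((∫ z, γ z * m z ∂cylMeasure d D.T) - ∫ z, γ z * m' z ∂cylMeasure d D.T) +
      c / 2 * ∫ z, ‖v z - v' z‖ ^ 2 * m z ∂cylMeasure d D.T ≤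
      (∫ z, D.L z (v z) * m z ∂cylMeasure d D.T) - ∫ z, D.L z (v' z) * m' z ∂cylMeasure d D.T := by
    refine combination_integral_le x1 x1' y1 y1' g1 g1' hsq f1 f1' ?_
    filter_upwards [ae_mem_cyl] with z hz
    have e1 := hD.cost_sub_ge hc hL hz (hs.control z hz) (v z) (μ := m z) (μ' := m' z)
      (h.nonneg hD h0 hz.2 z.1)
    have e2 := hs.hjb z hz
    -- The Hamilton-Jacobi equation trades the Hamiltonian for the expressions that duality and the
    -- convexity of the potentials can handle.
    rw [show -D.H z (gradx u z + D.Astar P z) = -(γ z + dt D.T u z + lapx u z) by linarith,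
      inner_add_left, inner_sub_right, inner_sub_right] at e1
    linarith
  -- The two pairs share the initial density, so the contributions at time 0 cancel on subtraction
  -- and only the terminal cost survives.
  have hterm : ∀ {n : Torus d × ℝ → ℝ}, (∀ x, n (x, 0) = D.m₀ x) →
      (∫ x, u (x, D.T) * n (x, D.T)) - ∫ x, u (x, 0) * n (x, 0) =
      (∫ x, D.g x * n (x, D.T)) - ∫ x, u (x, 0) * D.m₀ x := fun hn => by
    simp only [hs.hjb_final, hn]
  rw [hterm h0] at x2
  rw [hterm h0'] at x2'
  have hprice : (∫ t in Icc 0 D.T, ⟪P t, D.A (fun z => m z • v z) t⟫) -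
      ∫ t in Icc 0 D.T, ⟪P t, D.A (fun z => m' z • v' z) t⟫ ≤
      (∫ t in Icc 0 D.T, D.Φ t (D.A (fun z => m z • v z) t)) -
        ∫ t in Icc 0 D.T, D.Φ t (D.A (fun z => m' z • v' z) t) := by
    rw [← integral_sub y2 y2', ← integral_sub f3 f3']
    refine setIntegral_mono_on (y2.sub y2') (f3.sub f3') measurableSet_Icc fun t ht => ?_
    rw [← inner_sub_right, hs.price t ht]
    exact hD.Φ_sub_ge ht _ _
  have hcong : (∫ t in Icc 0 D.T, ∫ x, γ (x, t) * m (x, t)) -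
      ∫ t in Icc 0 D.T, ∫ x, γ (x, t) * m' (x, t) ≤
      (∫ t in Icc 0 D.T, D.F t fun x => m (x, t)) - ∫ t in Icc 0 D.T, D.F t fun x => m' (x, t) := by
    rw [← integral_sub g2 g2', ← integral_sub f2 f2']
    refine setIntegral_mono_on (g2.sub g2') (f2.sub f2') measurableSet_Icc fun t ht => ?_
    -- The base point is the equilibrium density, at which `f` equals γ̄ by the congestion equation.
    have e1 := hD.F_sub_ge ht (h'.mem_D1 hD h0' ht) (h.mem_D1 hD h0 ht)
    rw [← integral_sub (h.integrable_congestion_slice hD hγc ht)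
      (h'.integrable_congestion_slice hD hγc ht)]
    refine le_trans (le_of_eq (integral_congr_ae (Eventually.of_forall fun x => ?_))) e1
    simp only
    rw [hs.congestion x t ht, mul_sub]
  rw [Data.J, Data.J, integral_add f2 f3, integral_add f2' f3']
  linarith

end Optimality

end MFG

end

/-! ### The quadratic lower bound for the potential cost -/

theorem mainTheorem5 {d k : ℕ} (hd : 0 < d) (hk : 0 < k) (p : ℝ) (hp : (d : ℝ) + 2 < p)
    (D : MFG.Data d k) (hD : D.Assumptions) :
    ∃ C : ℝ, 0 < C ∧
      ∀ (m' : MFG.Torus d × ℝ → ℝ) (v' : MFG.Torus d × ℝ → MFG.E d)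
        (u' γ' : MFG.Torus d × ℝ → ℝ) (P' : ℝ → MFG.E k), D.IsSolution m' v' u' γ' P' →
        D.JFinite m' v' ∧
        ∀ (m : MFG.Torus d × ℝ → ℝ) (v : MFG.Torus d × ℝ → MFG.E d), (m, v) ∈ D.feasible p →
          D.JFinite m v ∧
          MeasureTheory.Integrable (fun z => ‖v z - v' z‖ ^ 2 * m z) (MFG.cylMeasure d D.T) ∧
          1 / C * ∫ z, ‖v z - v' z‖ ^ 2 * m z ∂MFG.cylMeasure d D.T ≤ D.J m v - D.J m' v' := by
  obtain ⟨C₀, hC₀, hL⟩ := hD.L_strong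
  -- Strong monotonicity with constant `1 / C₀` gives the quadratic term in the tangent inequality
  -- half that constant; it depends on `L` alone and not on the solution.
  refine ⟨2 * C₀, by positivity, fun m' v' u' γ' P' hs => ?_⟩
  obtain ⟨M', B', h'⟩ := hs.exists_isAdmissible hD
  refine ⟨h'.jFinite hD hs.fp_init, fun m v hmv => ?_⟩
  obtain ⟨hm, -, hv, hfp, h0⟩ := hmv
  -- Exponent at least one makes the weak derivatives integrable on the finite measure space Q.
  have hq : (1 : ENNReal) ≤ ENNReal.ofReal p := by
    rw [ENNReal.one_le_ofReal]
    have : (0 : ℝ) ≤ d := Nat.cast_nonneg d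
    linarith
  obtain ⟨v₁, M, B, h⟩ := MFG.exists_isAdmissible_of_fokkerPlanck hD.T_pos hq hm hv.1 hfp
  refine ⟨h.jFinite hD h0, h.integrable_sq h', ?_⟩
  have key := hs.cost_sub_ge hD (one_div_pos.2 hC₀) hL h h0
  rwa [show (1 : ℝ) / (2 * C₀) = 1 / C₀ / 2 by ring]
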